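/- Let $H\in(0,1)$, $T>0$, $\sigma>0$, $p\ge 0$ an integer and $\theta\in\mathbb{R}^p$. Let $\mathcal{P}_2(\mathbb{R})$ be the set of probability measures on $\mathbb{R}$ with finite second moment and let $W_2(\mu,\nu)=\big(\inf_m \int_{\mathbb{R}^2}|x-y|^2\,m(dx,dy)\big)^{1/2}$, the infimum being over all couplings $m$ of $\mu$ and $\nu$. Let $b_1,\dots,b_p:\mathbb{R}\times\mathcal{P}_2(\mathbb{R})\to\mathbb{R}$ and a probability measure $\mu_0$ on $\mathbb{R}$ satisfy, for some constant $C>0$ and all $m\in\{1,\dots,p\}$, $x,y\in\mathbb{R}$, $\mu,\nu\in\mathcal{P}_2(\mathbb{R})$: 1. $|b_m(x,\mu)-b_m(y,\nu)|\le C\,(|x-y|+W_2(\mu,\nu))$; 2. $|b_m(0,\delta_0)|\le C$; 3. $\int_{\mathbb{R}}|x|^k\,\mu_0(dx)<\infty$ for all integers $k\ge 1$. For $N\ge 1$ let $\xi^1,\dots,\xi^N$ be i.i.d. random variables with law $\mu_0$ and let $B^{1},\dots,B^{N}$ be independent fractional Brownian motions on $[0,T]$ of Hurst index $H$ (centered Gaussian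 processes with continuous paths and covariance $\frac12(t^{2H}+s^{2H}-|t-s|^{2H})$), the family $(B^i)_i$ being independent of $(\xi^i)_i$. Let $(X^{i,N})_{i\le N}$ be the interacting particle system $$X^{i,N}_t=\xi^i+\int_0^t\sum_{m=1}^p\theta_m b_m(X^{i,N}_s,\mu^N_s)\,ds+\sigma B^i_t,\qquad \mu^N_t=\frac1N\sum_{j=1}^N\delta_{X^{j,N}_t},\qquad t\in[0,T],$$ and let $(\bar X^i)_{i\le N}$ be the i.i.d. solutions of the McKean–Vlasov equation driven by the same fractional Brownian motions and started at the same initial values, $$\bar X^{i}_t=\xi^i+\int_0^t\sum_{m=1}^p\theta_m b_m(\bar X^{i}_s,\bar\mu_s)\,ds+\sigma B^i_t,\qquad \bar\mu_t=\mathcal{L}(\bar X^i_t)\in\mathcal{P}_2(\mathbb{R}),\qquad t\in[0,T].$$ Then for every real $q\ge 2$ there is a constant $c>0$, depending only on $H,T,\sigma,\theta,b,\mu_0,q$ (in particular not on $N$ or $i$), such that for all $N\ge1$ and all $i\in\{1,\dots,N\}$ $$\mathbb{E}\Big[\sup_{t\in[0,T]}|X^{i,N}_t-\bar X^i_t|^q\Big]\le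 \frac{c}{\sqrt N},\qquad \mathbb{E}\Big[\sup_{t\in[0,T]}W_2^q(\mu^N_t,\bar\mu_t)\Big]\le \frac{c}{\sqrt N}.$$ -/

import Mathlib

open MeasureTheory ProbabilityTheory
open scoped ENNReal

noncomputable section

namespace McKeanVlasovFBM

/-- The set of couplings of `μ` and `ν`: measures on `ℝ × ℝ` with marginals `μ` and `ν`. -/
def couplings (μ ν : Measure ℝ) : Set (Measure (ℝ × ℝ)) :=
  {m | m.map Prod.fst = μ ∧ m.map Prod.snd = ν}

/-- The Wasserstein distance `W_l(μ, ν) = (inf_m ∫ |x - y|^l m(dx, dy))^(1/l)`, the infimum being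
over all couplings `m` of `μ` and `ν`, with values in `[0, ∞]`. -/
def wasserstein (l : ℝ) (μ ν : Measure ℝ) : ℝ≥0∞ :=
  (⨅ m ∈ couplings μ ν, ∫⁻ z, ENNReal.ofReal (|z.1 - z.2| ^ l) ∂m) ^ (1 / l)

/-- The space `𝒫₂(ℝ)` of probability measures on `ℝ` with finite second moment. -/
def P2 : Type :=
  {μ : Measure ℝ // IsProbabilityMeasure μ ∧ Integrable (fun x : ℝ => x ^ 2) μ}

/-- The distance `W₂` on `𝒫₂(ℝ)`, as a real number (it is finite, see `wasserstein_ne_top`). -/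
def W2 (μ ν : P2) : ℝ := (wasserstein 2 μ.1 ν.1).toReal

theorem wasserstein_ne_top (μ ν : P2) : wasserstein 2 μ.1 ν.1 ≠ ∞ := by
  obtain ⟨μ, hμ, hμ2⟩ := μ
  obtain ⟨ν, hν, hν2⟩ := ν
  refine ENNReal.rpow_ne_top_of_nonneg (by norm_num) (ne_top_of_le_ne_top ?_
    (iInf₂_le (μ.prod ν) ⟨by simp, by simp⟩))
  have h : Integrable (fun z : ℝ × ℝ => |z.1 - z.2| ^ (2 : ℝ)) (μ.prod ν) := by
    have hb : Integrable (fun z : ℝ × ℝ => 2 * z.1 ^ 2 + 2 * z.2 ^ 2) (μ.prod ν) :=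
      ((hμ2.comp_fst ν).const_mul 2).add ((hν2.comp_snd μ).const_mul 2)
    refine hb.mono' (Measurable.aestronglyMeasurable (by fun_prop)) (ae_of_all _ fun z => ?_)
    rw [Real.rpow_two, sq_abs, Real.norm_of_nonneg (sq_nonneg _)]
    nlinarith [sq_nonneg (z.1 + z.2)]
  exact h.lintegral_lt_top.ne

/-- The Dirac measure at `0` as an element of `𝒫₂(ℝ)`. -/
def diracZero : P2 :=
  ⟨Measure.dirac 0, inferInstance, integrable_dirac (by simp)⟩

/-- The empirical measure `N⁻¹ ∑ᵢ δ_{xᵢ}` of a configuration of `N ≥ 1` points. -/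
def empiricalMeasure {N : ℕ} [NeZero N] (x : Fin N → ℝ) : P2 :=
  ⟨(N : ℝ≥0∞)⁻¹ • ∑ i, Measure.dirac (x i),
    ⟨by
      simp only [Measure.smul_apply, Measure.coe_finsetSum, Finset.sum_apply, measure_univ,
        Finset.sum_const, Finset.card_univ, Fintype.card_fin, smul_eq_mul, nsmul_eq_mul, mul_one]
      exact ENNReal.inv_mul_cancel (by exact_mod_cast NeZero.ne N) (ENNReal.natCast_ne_top N)⟩,
    Integrable.smul_measure
      (integrable_finsetSum_measure.2 fun i _ => integrable_dirac (by simp))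
      (ENNReal.inv_ne_top.2 (by exact_mod_cast NeZero.ne N))⟩

/-- Lipschitz continuity of all `b_m` in `(x, μ)` with respect to `|·|` and `W₂`. -/
def LipschitzDrift {p : ℕ} (b : Fin p → ℝ → P2 → ℝ) : Prop :=
  ∃ c : ℝ, 0 < c ∧ ∀ (m : Fin p) (x y : ℝ) (μ ν : P2),
    |b m x μ - b m y ν| ≤ c * (|x - y| + W2 μ ν)

/-- The numbers `b_m(0, δ₀)` are bounded. -/
def BoundedAtZero {p : ℕ} (b : Fin p → ℝ → P2 → ℝ) : Prop :=
  ∃ c : ℝ, 0 < c ∧ ∀ m : Fin p, |b m 0 diracZero| ≤ c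

/-- All moments of `μ₀` are finite. -/
def FiniteMoments (μ₀ : Measure ℝ) : Prop :=
  ∀ k : ℕ, 1 ≤ k → Integrable (fun x : ℝ => |x| ^ k) μ₀

/-- The drift `∑ₘ θₘ bₘ(x, μ)`. -/
def drift {p : ℕ} (θ : Fin p → ℝ) (b : Fin p → ℝ → P2 → ℝ) (x : ℝ) (μ : P2) : ℝ :=
  ∑ m, θ m * b m x μ

variable {Ω : Type*} [MeasurableSpace Ω]

/-- `(B_t)_{t ∈ [0,T]}` is a fractional Brownian motion of Hurst index `H`: a centered Gaussian
process with a.s. continuous paths and covariance `(t^{2H} + s^{2H} - |t - s|^{2H}) / 2`. -/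
structure IsFractionalBrownianMotion (H T : ℝ) (P : Measure Ω) (B : ℝ → Ω → ℝ) : Prop where
  measurable : ∀ t ∈ Set.Icc 0 T, Measurable (B t)
  gaussian : IsGaussianProcess (fun (t : Set.Icc (0 : ℝ) T) => B t) P
  centered : ∀ t ∈ Set.Icc 0 T, ∫ ω, B t ω ∂P = 0
  covariance : ∀ s ∈ Set.Icc 0 T, ∀ t ∈ Set.Icc 0 T,
    ∫ ω, B t ω * B s ω ∂P = (t ^ (2 * H) + s ^ (2 * H) - |t - s| ^ (2 * H)) / 2
  continuous_paths : ∀ᵐ ω ∂P, ContinuousOn (fun t => B t ω) (Set.Icc 0 T)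

/-- The random input of `N` particles: i.i.d. initial values `ξ i` with law `μ₀` and independent
fractional Brownian motions `B i` on `[0, T]`, the family `B` being independent of `ξ`. -/
structure IsInput {N : ℕ} (H T : ℝ) (μ₀ : Measure ℝ) (P : Measure Ω)
    (ξ : Fin N → Ω → ℝ) (B : Fin N → ℝ → Ω → ℝ) : Prop where
  measurable_init : ∀ i, Measurable (ξ i)
  law_init : ∀ i, P.map (ξ i) = μ₀
  indep_init : iIndepFun ξ P
  fbm : ∀ i, IsFractionalBrownianMotion H T P (B i)
  indep_fbm : iIndepFun (fun i ω (t : Set.Icc (0 : ℝ) T) => B i t ω) P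
  indep_init_fbm : IndepFun (fun ω i => ξ i ω)
    (fun ω i (t : Set.Icc (0 : ℝ) T) => B i t ω) P

/-- `X` solves the interacting particle system
`dXⁱ_t = ∑ₘ θₘ bₘ(Xⁱ_t, μᴺ_t) dt + σ dBⁱ_t`, `Xⁱ_0 = ξⁱ`, on `[0, T]`, where `μᴺ_t` is the
empirical measure of `X¹_t, …, Xᴺ_t`. -/
structure IsParticleSystem {p N : ℕ} [NeZero N] (T σ : ℝ) (θ : Fin p → ℝ)
    (b : Fin p → ℝ → P2 → ℝ) (P : Measure Ω) (ξ : Fin N → Ω → ℝ) (B : Fin N → ℝ → Ω → ℝ)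
    (X : Fin N → ℝ → Ω → ℝ) : Prop where
  aemeasurable : ∀ i, ∀ t ∈ Set.Icc 0 T, AEMeasurable (X i t) P
  continuous_paths : ∀ᵐ ω ∂P, ∀ i, ContinuousOn (fun t => X i t ω) (Set.Icc 0 T)
  integrable : ∀ᵐ ω ∂P, ∀ i, IntervalIntegrable
    (fun s => drift θ b (X i s ω) (empiricalMeasure fun j => X j s ω)) volume 0 T
  equation : ∀ᵐ ω ∂P, ∀ i, ∀ t ∈ Set.Icc 0 T,
    X i t ω = ξ i ω
      + (∫ s in (0 : ℝ)..t, drift θ b (X i s ω) (empiricalMeasure fun j => X j s ω))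
      + σ * B i t ω

/-- `Y`, with flow of marginal laws `μ`, solves the McKean–Vlasov equation
`dY_t = ∑ₘ θₘ bₘ(Y_t, μ_t) dt + σ dB_t`, `Y_0 = ξ`, `μ_t = Law(Y_t)`, on `[0, T]`. -/
structure IsMcKeanVlasovSolution {p : ℕ} (T σ : ℝ) (θ : Fin p → ℝ)
    (b : Fin p → ℝ → P2 → ℝ) (P : Measure Ω) (ξ : Ω → ℝ) (B : ℝ → Ω → ℝ)
    (Y : ℝ → Ω → ℝ) (μ : ℝ → P2) : Prop where
  aemeasurable : ∀ t ∈ Set.Icc 0 T, AEMeasurable (Y t) P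
  law : ∀ t ∈ Set.Icc 0 T, P.map (Y t) = (μ t).1
  continuous_paths : ∀ᵐ ω ∂P, ContinuousOn (fun t => Y t ω) (Set.Icc 0 T)
  integrable : ∀ᵐ ω ∂P, IntervalIntegrable (fun s => drift θ b (Y s ω) (μ s)) volume 0 T
  equation : ∀ᵐ ω ∂P, ∀ t ∈ Set.Icc 0 T,
    Y t ω = ξ ω + (∫ s in (0 : ℝ)..t, drift θ b (Y s ω) (μ s)) + σ * B t ω

end McKeanVlasovFBM

end

/-! Everything reduces to the fluctuations of the empirical measure ν^N of the independent copies.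
Subtracting the particle equation from the limit equation cancels the noise. Grönwall, applied to
the largest gap over all particles, bounds that gap by a constant times sup_t W₂(ν^N_t, μ_t)
(`IsRegularDrift.abs_sub_le_mul_exp`). A squared triangle inequality for W₂ then passes from ν^N to
the empirical measure of the particles.

To control a supremum in time, the transport cost is linearised. The line is embedded in the Hilbert
space L²((1 + x²)³ dx) by sending y to the signed indicator of (0, y], so that the embedded
difference of two laws is, up to sign, the difference F - G of their distribution functions. For b ≤
a one has (a - b)² ≤ φ(a) - φ(b) with φ(x) = x + x³. Hence the quantile coupling costs at most ∫ |F
- G| φ' dx, and Cauchy–Schwarz bounds W₂² by a constant times the Hilbert norm of the difference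
(`exists_wasserstein_two_sq_le`).

After embedding, ν^N_t - μ_t becomes an average Z_t of independent centered Hilbert-valued
variables. Independence of the copies is not assumed: each copy is shown to be a measurable
functional of its own input, as a limit of Euler schemes
(`IsMcKeanVlasovSolution.ae_eq_eulerLimit`). The embedding is locally 1/2-Hölder with polynomial
constants and the solutions have increments of order |t - s|^H, so the Marcinkiewicz–Zygmund
inequality (`integral_norm_sum_pow_le`) gives E‖Z_t - Z_s‖^{2m} ≤ C N^{-m} |t - s|³ once Hm ≥ 3.
Dyadic chaining (`exists_maximal_bound`) brings the supremum inside the expectation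
(`exists_deviation_bound`). Since W₂^q is of order ‖Z‖^{q/2}, the rate is N^{-q/4}, which is at most
N^{-1/2} for q ≥ 2.

The moments needed on the way (`exists_uniform_bound`) come in two stages: comparison with one fixed
path shows that second moments are finite and continuous in time, and Grönwall then bounds them by
constants that depend only on the data. -/

noncomputable section

namespace McKeanVlasovFBM

/-! ### Grönwall's inequality for continuous functions. -/

section Gronwall

/-- Grönwall's inequality in integral form. -/
theorem le_mul_exp_of_le_add_integral {T A L : ℝ} (hL : 0 ≤ L) {f : ℝ → ℝ}
    (hf : ContinuousOn f (Set.Icc 0 T))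
    (h : ∀ t ∈ Set.Icc 0 T, f t ≤ A + L * ∫ s in (0 : ℝ)..t, f s) :
    ∀ t ∈ Set.Icc 0 T, f t ≤ A * Real.exp (L * t) := by
  intro t ht
  have hT : (0 : ℝ) ≤ T := ht.1.trans ht.2
  set g : ℝ → ℝ := Set.IccExtend hT (fun s => f s) with hg
  have hgc : Continuous g := (continuousOn_iff_continuous_domRestrict.1 hf).Icc_extend'
  have hgf : ∀ s ∈ Set.Icc 0 T, g s = f s := fun s hs => by
    simp [hg, Set.IccExtend_of_mem hT _ hs]
  have hint : ∀ s ∈ Set.Icc 0 T, ∫ u in (0 : ℝ)..s, f u = ∫ u in (0 : ℝ)..s, g u := by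
    intro s hs
    refine intervalIntegral.integral_congr fun u hu => ?_
    rw [Set.uIcc_of_le hs.1] at hu
    exact (hgf u ⟨hu.1, hu.2.trans hs.2⟩).symm
  set G : ℝ → ℝ := fun s => A + L * ∫ u in (0 : ℝ)..s, g u with hG
  have hderiv : ∀ s, HasDerivAt G (L * g s) s := fun s =>
    ((intervalIntegral.integral_hasDerivAt_right (hgc.intervalIntegrable _ _)
      (hgc.stronglyMeasurableAtFilter _ _) hgc.continuousAt).const_mul L).const_add A
  have key := le_gronwallBound_of_liminf_deriv_right_le (f := G) (f' := fun s => L * g s)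
    (δ := A) (K := L) (ε := 0) (a := 0) (b := T)
    (fun s _ => (hderiv s).continuousAt.continuousWithinAt)
    (fun s _ r hr => by
      simpa [slope_def_field, div_eq_inv_mul] using
        (hderiv s).hasDerivWithinAt.liminf_right_slope_le hr)
    (by simp [hG])
    (fun s hs => by
      have hs' : s ∈ Set.Icc 0 T := ⟨hs.1, hs.2.le⟩
      have := h s hs'
      rw [hint s hs', ← hgf s hs'] at this
      simpa using mul_le_mul_of_nonneg_left this hL) t ht
  rw [gronwallBound_ε0, sub_zero] at key
  have := h t ht
  rw [hint t ht] at this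
  exact this.trans key

end Gronwall

/-! ### The quadratic Wasserstein distance: couplings, gluing, empirical measures. -/

section Wasserstein

theorem ofReal_abs_rpow_two (x : ℝ) : ENNReal.ofReal (|x| ^ (2 : ℝ)) = ‖x‖ₑ ^ 2 := by
  rw [Real.rpow_two, Real.enorm_eq_ofReal_abs, ENNReal.ofReal_pow (abs_nonneg x)]

theorem wasserstein_two_sq (μ ν : Measure ℝ) :
    wasserstein 2 μ ν ^ 2 = ⨅ m ∈ couplings μ ν, ∫⁻ z, ‖z.1 - z.2‖ₑ ^ 2 ∂m := by
  simp only [wasserstein, ofReal_abs_rpow_two]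
  rw [← ENNReal.rpow_natCast, ← ENNReal.rpow_mul]
  norm_num

theorem wasserstein_two_sq_le {μ ν : Measure ℝ} {m : Measure (ℝ × ℝ)} (hm : m ∈ couplings μ ν) :
    wasserstein 2 μ ν ^ 2 ≤ ∫⁻ z, ‖z.1 - z.2‖ₑ ^ 2 ∂m := by
  rw [wasserstein_two_sq]
  exact iInf₂_le m hm

variable {Ω : Type*} [MeasurableSpace Ω]

/-- The joint law of `U` and `V` is a coupling of their laws. -/
theorem wasserstein_two_sq_map_le {P : Measure Ω} {U V : Ω → ℝ} (hU : AEMeasurable U P)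
    (hV : AEMeasurable V P) :
    wasserstein 2 (P.map U) (P.map V) ^ 2 ≤ ∫⁻ ω, ‖U ω - V ω‖ₑ ^ 2 ∂P := by
  have hUV := hU.prodMk hV
  refine (wasserstein_two_sq_le (m := P.map fun ω => (U ω, V ω)) ⟨?_, ?_⟩).trans ?_
  · rw [AEMeasurable.map_map_of_aemeasurable measurable_fst.aemeasurable hUV]; rfl
  · rw [AEMeasurable.map_map_of_aemeasurable measurable_snd.aemeasurable hUV]; rfl
  · rw [lintegral_map' (by fun_prop) hUV]

theorem wasserstein_two_self (μ : Measure ℝ) : wasserstein 2 μ μ = 0 := by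
  have := wasserstein_two_sq_map_le (P := μ) (U := id) (V := id) aemeasurable_id aemeasurable_id
  simpa using this

theorem W2_self (μ : P2) : W2 μ μ = 0 := by
  simp [W2, wasserstein_two_self]

theorem W2_nonneg (μ ν : P2) : 0 ≤ W2 μ ν := ENNReal.toReal_nonneg

theorem ofReal_W2 (μ ν : P2) : ENNReal.ofReal (W2 μ ν) = wasserstein 2 μ.1 ν.1 :=
  ENNReal.ofReal_toReal (wasserstein_ne_top μ ν)

theorem W2_le_of_sq_le {μ ν : P2} {a : ℝ} (ha : 0 ≤ a)
    (h : wasserstein 2 μ.1 ν.1 ^ 2 ≤ ENNReal.ofReal (a ^ 2)) : W2 μ ν ≤ a := by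
  rw [← ofReal_W2, ← ENNReal.ofReal_pow (W2_nonneg _ _),
    ENNReal.ofReal_le_ofReal_iff (by positivity)] at h
  exact (pow_le_pow_iff_left₀ (W2_nonneg _ _) ha two_ne_zero).1 h

/-- Gluing of couplings: the squared triangle inequality for `W₂`. -/
theorem wasserstein_two_sq_triangle (μ ν ρ : Measure ℝ) [IsFiniteMeasure ν] :
    wasserstein 2 μ ρ ^ 2 ≤ 2 * wasserstein 2 μ ν ^ 2 + 2 * wasserstein 2 ν ρ ^ 2 := by
  have hglue : ∀ m₁ ∈ couplings μ ν, ∀ m₂ ∈ couplings ν ρ, wasserstein 2 μ ρ ^ 2 ≤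
      2 * ∫⁻ z, ‖z.1 - z.2‖ₑ ^ 2 ∂m₁ + 2 * ∫⁻ z, ‖z.1 - z.2‖ₑ ^ 2 ∂m₂ := by
    intro m₁ hm₁ m₂ hm₂
    have : IsFiniteMeasure m₁ := ⟨by
      have : m₁ Set.univ = ν Set.univ := by
        rw [← hm₁.2, Measure.map_apply measurable_snd MeasurableSet.univ]; rfl
      rw [this]; exact measure_lt_top ν _⟩
    have : IsFiniteMeasure m₂ := ⟨by
      have : m₂ Set.univ = ν Set.univ := by
        rw [← hm₂.1, Measure.map_apply measurable_fst MeasurableSet.univ]; rfl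
      rw [this]; exact measure_lt_top ν _⟩
    have hfst : m₂.fst = ν := hm₂.1
    set κ := m₂.condKernel
    -- Draw two points from `m₁`, then a third from the conditional law of `m₂` given the middle
    -- point. The last two points have law `m₂` because both couplings share the marginal `ν`.
    set M : Measure ((ℝ × ℝ) × ℝ) := m₁ ⊗ₘ (κ.comap Prod.snd measurable_snd)
    have hM₁ : M.map Prod.fst = m₁ := Measure.fst_compProd _ _
    have hM₂ : M.map (fun z => (z.1.2, z.2)) = m₂ := by
      ext s hs
      rw [Measure.map_apply (by fun_prop) hs, Measure.compProd_apply (hs.preimage (by fun_prop)),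
        ← m₂.disintegrate κ, Measure.compProd_apply hs, hfst, ← hm₁.2,
        lintegral_map (Kernel.measurable_kernel_prodMk_left hs) measurable_snd]
      rfl
    have hcoup : M.map (fun z => (z.1.1, z.2)) ∈ couplings μ ρ := by
      refine ⟨?_, ?_⟩
      · rw [Measure.map_map measurable_fst (by fun_prop), ← hm₁.1]
        conv_rhs => rw [← hM₁]
        rw [Measure.map_map measurable_fst measurable_fst]
        rfl
      · rw [Measure.map_map measurable_snd (by fun_prop), ← hm₂.2]
        conv_rhs => rw [← hM₂]
        rw [Measure.map_map measurable_snd (by fun_prop)]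
        rfl
    refine (wasserstein_two_sq_le hcoup).trans ?_
    rw [lintegral_map (by fun_prop) (by fun_prop)]
    conv_rhs => rw [← hM₁, ← hM₂]
    rw [lintegral_map (by fun_prop) (by fun_prop), lintegral_map (by fun_prop) (by fun_prop),
      ← lintegral_const_mul _ (by fun_prop), ← lintegral_const_mul _ (by fun_prop),
      ← lintegral_add_left (by fun_prop)]
    refine lintegral_mono fun z => ?_
    have h1 : ‖z.1.1 - z.2‖ₑ ≤ ‖z.1.1 - z.1.2‖ₑ + ‖z.1.2 - z.2‖ₑ := by
      simpa using enorm_add_le (z.1.1 - z.1.2) (z.1.2 - z.2)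
    have h2 := ENNReal.rpow_add_le_mul_rpow_add_rpow ‖z.1.1 - z.1.2‖ₑ ‖z.1.2 - z.2‖ₑ
      (one_le_two : (1 : ℝ) ≤ 2)
    norm_num at h2
    rw [← mul_add]
    exact (pow_le_pow_left' h1 2).trans h2
  rw [wasserstein_two_sq μ ν, wasserstein_two_sq ν ρ]
  simp only [ENNReal.mul_iInf_of_ne two_ne_zero ENNReal.ofNat_ne_top]
  exact ENNReal.le_iInf₂_add_iInf₂ hglue

/-- Viewing empirical measures as laws under the uniform measure on indices lets two configurations
be coupled index by index. -/
theorem empiricalMeasure_eq_map {N : ℕ} [NeZero N] (x : Fin N → ℝ) :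
    (empiricalMeasure x).1 = ((N : ℝ≥0∞)⁻¹ • Measure.count : Measure (Fin N)).map x := by
  ext s hs
  rw [Measure.map_apply (measurable_of_countable x) hs]
  simp [empiricalMeasure, Measure.count, hs]
  rfl

theorem lintegral_uniform_fin {N : ℕ} (f : Fin N → ℝ≥0∞) :
    ∫⁻ i, f i ∂((N : ℝ≥0∞)⁻¹ • Measure.count : Measure (Fin N)) = (N : ℝ≥0∞)⁻¹ * ∑ i, f i := by
  rw [lintegral_smul_measure, lintegral_count, tsum_fintype, smul_eq_mul]

theorem wasserstein_empiricalMeasure_sq_le {N : ℕ} [NeZero N] {x y : Fin N → ℝ} {a : ℝ≥0∞}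
    (h : ∀ i, ‖x i - y i‖ₑ ≤ a) :
    wasserstein 2 (empiricalMeasure x).1 (empiricalMeasure y).1 ^ 2 ≤ a ^ 2 := by
  rw [empiricalMeasure_eq_map, empiricalMeasure_eq_map]
  refine (wasserstein_two_sq_map_le (measurable_of_countable x).aemeasurable
    (measurable_of_countable y).aemeasurable).trans ?_
  rw [lintegral_uniform_fin]
  calc (N : ℝ≥0∞)⁻¹ * ∑ i, ‖x i - y i‖ₑ ^ 2 ≤ (N : ℝ≥0∞)⁻¹ * ∑ _i : Fin N, a ^ 2 := by
        gcongr with i; exact h i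
    _ = a ^ 2 := by
        rw [Finset.sum_const, Finset.card_univ, Fintype.card_fin, nsmul_eq_mul, ← mul_assoc,
          ENNReal.inv_mul_cancel (by exact_mod_cast NeZero.ne N) (ENNReal.natCast_ne_top N),
          one_mul]

theorem W2_empiricalMeasure_le {N : ℕ} [NeZero N] {x y : Fin N → ℝ} {a : ℝ} (ha : 0 ≤ a)
    (h : ∀ i, |x i - y i| ≤ a) : W2 (empiricalMeasure x) (empiricalMeasure y) ≤ a := by
  refine W2_le_of_sq_le ha ?_
  rw [ENNReal.ofReal_pow ha]
  refine wasserstein_empiricalMeasure_sq_le fun i => ?_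
  rw [Real.enorm_eq_ofReal_abs]
  exact ENNReal.ofReal_le_ofReal (h i)

end Wasserstein

/-! ### Quantile functions. -/

section Quantile

/-- The quantile function of a probability measure on the line. -/
def quantile (μ : Measure ℝ) (u : ℝ) : ℝ := sInf {x | u ≤ cdf μ x}

/-- The Galois connection between quantile and distribution function. The forward direction rests on
right continuity of the latter; `u` strictly between 0 and 1 keeps the infimum that of a nonempty
set bounded below. -/
theorem quantile_le_iff (μ : Measure ℝ) {u : ℝ} (hu : u ∈ Set.Ioo (0 : ℝ) 1) (x : ℝ) :
    quantile μ u ≤ x ↔ u ≤ cdf μ x := by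
  have hne : {x | u ≤ cdf μ x}.Nonempty :=
    ((tendsto_cdf_atTop μ).eventually (eventually_ge_nhds hu.2)).exists
  have hbdd : BddBelow {x | u ≤ cdf μ x} := by
    obtain ⟨a, ha⟩ := ((tendsto_cdf_atBot μ).eventually (eventually_lt_nhds hu.1)).exists
    refine ⟨a, fun x hx => ?_⟩
    by_contra! hxa
    exact absurd (hx.trans (monotone_cdf μ hxa.le)) (not_le.2 ha)
  refine ⟨fun h => ?_, fun h => csInf_le hbdd h⟩
  refine le_trans ?_ (monotone_cdf μ h)
  rw [← (cdf μ).iInf_Ioi_eq]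
  refine le_ciInf fun r => ?_
  obtain ⟨y, hy, hyr⟩ := exists_lt_of_csInf_lt hne r.2
  exact le_trans hy (monotone_cdf μ hyr.le)

theorem aemeasurable_quantile (μ : Measure ℝ) :
    AEMeasurable (quantile μ) (volume.restrict (Set.Ioo (0 : ℝ) 1)) := by
  refine aemeasurable_restrict_of_monotoneOn measurableSet_Ioo fun u hu v hv huv => ?_
  rw [quantile_le_iff μ hu]
  exact huv.trans ((quantile_le_iff μ hv _).1 le_rfl)

/-- By the Galois connection the preimage of (-∞, x] is, within (0, 1), the set u ≤ F(x), of length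
F(x). -/
theorem map_quantile (μ : Measure ℝ) [IsProbabilityMeasure μ] :
    (volume.restrict (Set.Ioo (0 : ℝ) 1)).map (quantile μ) = μ := by
  have : IsFiniteMeasure (volume.restrict (Set.Ioo (0 : ℝ) 1)) := ⟨by simp⟩
  refine Measure.ext_of_Iic _ _ fun x => ?_
  rw [Measure.map_apply_of_aemeasurable (aemeasurable_quantile μ) measurableSet_Iic,
    Measure.restrict_apply₀' measurableSet_Ioo.nullMeasurableSet]
  have hset : quantile μ ⁻¹' Set.Iic x ∩ Set.Ioo 0 1 = Set.Iic (cdf μ x) ∩ Set.Ioo 0 1 := by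
    ext u
    simp only [Set.mem_inter_iff, Set.mem_preimage, Set.mem_Iic]
    exact and_congr_left fun hu => quantile_le_iff μ hu x
  have hcdf : ENNReal.ofReal (cdf μ x) = μ (Set.Iic x) := by
    rw [cdf_eq_real, ofReal_measureReal]
  rw [hset, ← hcdf]
  refine le_antisymm ?_ ?_
  · refine (measure_mono (t := Set.Ioc 0 (cdf μ x)) fun u hu => ⟨hu.2.1, hu.1⟩).trans ?_
    simp
  · refine le_trans ?_ (measure_mono (s := Set.Ioo 0 (cdf μ x))
      fun u hu => ⟨hu.2.le, hu.1, hu.2.trans_le (cdf_le_one μ x)⟩)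
    simp

end Quantile

/-! ### The Hilbert embedding of the line and the dual bound of the transport cost. -/

section Embedding

/-- The measure `(1 + x²)³ dx`. -/
def weight : Measure ℝ := volume.withDensity fun x => ENNReal.ofReal ((1 + x ^ 2) ^ 3)

instance : NullSingletonClass weight :=
  inferInstanceAs (NullSingletonClass (volume.withDensity _))

theorem weight_Ioc_le (a b : ℝ) :
    weight (Set.Ioc a b) ≤ ENNReal.ofReal ((b - a) * (1 + a ^ 2 + b ^ 2) ^ 3) := by
  rw [weight, withDensity_apply _ measurableSet_Ioc]
  calc ∫⁻ x in Set.Ioc a b, ENNReal.ofReal ((1 + x ^ 2) ^ 3)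
      ≤ ∫⁻ _x in Set.Ioc a b, ENNReal.ofReal ((1 + a ^ 2 + b ^ 2) ^ 3) := by
        refine setLIntegral_mono measurable_const fun x hx => ENNReal.ofReal_le_ofReal ?_
        have : x ^ 2 ≤ a ^ 2 + b ^ 2 := by
          rcases le_total 0 x with h | h <;> nlinarith [hx.1, hx.2, sq_nonneg a, sq_nonneg b]
        exact pow_le_pow_left₀ (by positivity) (by linarith) 3
    _ = _ := by
        rw [setLIntegral_const, Real.volume_Ioc, mul_comm, ← ENNReal.ofReal_mul' (by positivity)]

theorem weight_Ioc_ne_top (a b : ℝ) : weight (Set.Ioc a b) ≠ ∞ :=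
  ne_top_of_le_ne_top ENNReal.ofReal_ne_top (weight_Ioc_le a b)

/-- The embedding of the line into `L²((1 + x²)³ dx)` by (signed) indicators of `(0, y]`. -/
def embed (y : ℝ) : Lp ℝ 2 weight :=
  indicatorConstLp 2 measurableSet_Ioc (weight_Ioc_ne_top 0 y) 1 -
    indicatorConstLp 2 measurableSet_Ioc (weight_Ioc_ne_top y 0) 1

theorem embed_sub_embed {a b : ℝ} (h : a ≤ b) :
    embed b - embed a = indicatorConstLp 2 measurableSet_Ioc (weight_Ioc_ne_top a b) 1 := by
  simp only [embed, indicatorConstLp, ← MemLp.toLp_sub]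
  congr 1
  ext x
  simp only [Pi.sub_apply, Set.indicator_apply, Set.mem_Ioc]
  split_ifs <;> grind

/-- The squared norm is the weight of the interval between the points. The embedding is therefore
1/2-Hölder up to a polynomial factor, which halves the order of time increments. -/
theorem norm_embed_sub_sq_le (a b : ℝ) :
    ‖embed a - embed b‖ ^ 2 ≤ |a - b| * (1 + a ^ 2 + b ^ 2) ^ 3 := by
  wlog h : b ≤ a generalizing a b
  · have := this b a (not_le.1 h).le
    rwa [norm_sub_rev, abs_sub_comm, add_right_comm] at this
  rw [embed_sub_embed h, norm_indicatorConstLp two_ne_zero ENNReal.ofNat_ne_top, norm_one, one_mul,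
    ENNReal.toReal_ofNat, ← Real.sqrt_eq_rpow, Real.sq_sqrt measureReal_nonneg,
    abs_of_nonneg (sub_nonneg.2 h)]
  refine ENNReal.toReal_le_of_le_ofReal
    (mul_nonneg (sub_nonneg.2 h) (by positivity)) ((weight_Ioc_le b a).trans_eq ?_)
  rw [add_right_comm]

theorem continuous_embed : Continuous embed := by
  rw [continuous_iff_continuousAt]
  intro a
  rw [ContinuousAt, tendsto_iff_norm_sub_tendsto_zero]
  have h1 : Filter.Tendsto (fun b => Real.sqrt (|b - a| * (1 + b ^ 2 + a ^ 2) ^ 3)) (nhds a)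
      (nhds 0) := by
    have : Continuous fun b => Real.sqrt (|b - a| * (1 + b ^ 2 + a ^ 2) ^ 3) := by fun_prop
    simpa using this.tendsto a
  refine squeeze_zero (fun b => norm_nonneg _) (fun b => ?_) h1
  exact Real.le_sqrt_of_sq_le (norm_embed_sub_sq_le b a)

/-- The density appearing in the dual representation of the transport cost. -/
def dualDensity (x : ℝ) : ℝ := (1 + 3 * x ^ 2) / (1 + x ^ 2) ^ 3

theorem measurable_dualDensity : Measurable dualDensity := by
  unfold dualDensity; fun_prop

/-- Squared and weighted, the density is (1 + 3x²)²/(1 + x²)³ ≤ 9/(1 + x²). The exponent 3 in the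
weight makes this integrable. -/
theorem memLp_dualDensity : MemLp dualDensity 2 weight := by
  rw [memLp_two_iff_integrable_sq measurable_dualDensity.aestronglyMeasurable, weight,
    integrable_withDensity_iff_integrable_smul' (by fun_prop) (by simp)]
  refine (integrable_inv_one_add_sq.const_mul 9).mono'
    (by unfold dualDensity; exact Measurable.aestronglyMeasurable (by fun_prop))
    (ae_of_all _ fun x => ?_)
  have hx : (0 : ℝ) < 1 + x ^ 2 := by positivity
  rw [ENNReal.toReal_ofReal (by positivity), smul_eq_mul, Real.norm_of_nonneg (by positivity),
    dualDensity, div_pow, ← pow_mul, mul_div_assoc', div_le_iff₀ (by positivity)]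
  have : 9 * (1 + x ^ 2)⁻¹ * (1 + x ^ 2) ^ (3 * 2) = 9 * (1 + x ^ 2) ^ 2 * (1 + x ^ 2) ^ 3 := by
    field_simp
  rw [this, mul_comm]
  gcongr
  nlinarith [sq_nonneg x, sq_nonneg (x ^ 2)]

/-- Multiplied by the weight, the density becomes 1 + 3x², the derivative of x + x³. -/
theorem intervalIntegral_dualDensity (a b : ℝ) :
    ∫ x in a..b, dualDensity x ∂weight = (b + b ^ 3) - (a + a ^ 3) := by
  have hset : ∀ s : Set ℝ, MeasurableSet s → ∫ x in s, dualDensity x ∂weight =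
      ∫ x in s, (1 + 3 * x ^ 2) := by
    intro s hs
    rw [weight, setIntegral_withDensity_eq_setIntegral_toReal_smul (by fun_prop) (by simp) _ hs]
    refine setIntegral_congr_fun hs fun x _ => ?_
    have hx : (0 : ℝ) < 1 + x ^ 2 := by positivity
    simp only [dualDensity]
    rw [ENNReal.toReal_ofReal (by positivity), smul_eq_mul]
    field_simp
  rw [intervalIntegral, hset _ measurableSet_Ioc, hset _ measurableSet_Ioc, ← intervalIntegral]
  rw [intervalIntegral.integral_add (by simp) (by apply Continuous.intervalIntegrable; fun_prop),
    intervalIntegral.integral_const_mul]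
  simp
  ring

/-- With d = a - b, the difference of the two sides is d(d - 2)²/4 + 3d(a + b)²/4. The linear term
handles short distances and the cubic term long ones. -/
theorem sq_sub_le_of_le {a b : ℝ} (h : b ≤ a) : (a - b) ^ 2 ≤ (a + a ^ 3) - (b + b ^ 3) := by
  have h0 : 0 ≤ a - b := sub_nonneg.2 h
  nlinarith [mul_nonneg h0 (sq_nonneg (a - b - 2)), mul_nonneg h0 (sq_nonneg (a + b))]

theorem inner_embed (f : Lp ℝ 2 weight) (y : ℝ) :
    inner ℝ (embed y) f = ∫ x in (0 : ℝ)..y, f x ∂weight := by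
  rw [embed, inner_sub_left, L2.inner_indicatorConstLp_one, L2.inner_indicatorConstLp_one,
    intervalIntegral]

theorem intervalIntegrable_of_memLp_weight (f : Lp ℝ 2 weight) (a b : ℝ) :
    IntervalIntegrable f weight a b := by
  have : ∀ a b : ℝ, IntegrableOn f (Set.Ioc a b) weight := fun a b => by
    have : IsFiniteMeasure (weight.restrict (Set.Ioc a b)) :=
      ⟨by simpa using (weight_Ioc_ne_top a b).lt_top⟩
    exact ((Lp.memLp f).restrict _).integrable one_le_two
  exact ⟨this a b, this b a⟩

/-- Dual bound of the quadratic transport cost on the line. -/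
theorem exists_wasserstein_two_sq_le : ∃ c : ℝ, 0 ≤ c ∧ ∀ (μ ν : Measure ℝ)
    [IsProbabilityMeasure μ] [IsProbabilityMeasure ν], Integrable embed μ → Integrable embed ν →
    wasserstein 2 μ ν ^ 2 ≤ ENNReal.ofReal (c * ‖∫ y, embed y ∂μ - ∫ y, embed y ∂ν‖) := by
  refine ⟨(eLpNorm dualDensity 2 weight).toReal, ENNReal.toReal_nonneg, ?_⟩
  intro μ ν _ _ hμ hν
  -- This sign turns the signed mass of φ' between the two quantiles of level u into its absolute
  -- value: strictly between them exactly one distribution function is below u, and which one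
  -- depends only on the order of the quantiles.
  set s : ℝ → ℝ := fun x => if cdf μ x < cdf ν x then 1 else -1 with hs
  have hsm : Measurable s := Measurable.ite
    (measurableSet_lt (monotone_cdf μ).measurable (monotone_cdf ν).measurable)
    measurable_const measurable_const
  set h : ℝ → ℝ := fun x => s x * dualDensity x with hh
  have hnorm : ∀ x, ‖h x‖ ≤ ‖dualDensity x‖ := fun x => by
    simp only [hh, hs]; split_ifs <;> simp
  have hLp : MemLp h 2 weight := memLp_dualDensity.mono
    (hsm.mul measurable_dualDensity).aestronglyMeasurable (ae_of_all _ hnorm)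
  set f : Lp ℝ 2 weight := hLp.toLp h
  have hfh : f =ᵐ[weight] h := hLp.coeFn_toLp
  have hfnorm : ‖f‖ ≤ (eLpNorm dualDensity 2 weight).toReal := by
    rw [Lp.norm_toLp]
    exact ENNReal.toReal_mono memLp_dualDensity.eLpNorm_ne_top (eLpNorm_mono hnorm)
  -- As a function of y this is a primitive of `h`, while its mean under a law is linear in the
  -- embedded law. It thus links pointwise cost to Hilbert norm.
  set Ψ : ℝ → ℝ := fun y => inner ℝ (embed y) f with hΨ
  have hΨc : Continuous Ψ := continuous_embed.inner continuous_const
  have hΨi : ∀ a b, Ψ a - Ψ b = ∫ x in b..a, h x ∂weight := by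
    intro a b
    simp only [hΨ, inner_embed]
    rw [intervalIntegral.integral_interval_sub_left (intervalIntegrable_of_memLp_weight _ _ _)
      (intervalIntegrable_of_memLp_weight _ _ _)]
    exact intervalIntegral.integral_congr_ae (hfh.mono fun x hx _ => hx)
  have hΨμ : ∀ (μ : Measure ℝ), Integrable embed μ →
      Integrable Ψ μ ∧ ∫ y, Ψ y ∂μ = inner ℝ (∫ y, embed y ∂μ) f := by
    intro μ hμ
    refine ⟨hμ.inner_const f, ?_⟩
    simp only [hΨ]
    simp_rw [real_inner_comm f]
    exact integral_inner hμ f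
  have hpt : ∀ u ∈ Set.Ioo (0 : ℝ) 1, ‖quantile μ u - quantile ν u‖ₑ ^ 2 ≤
      ENNReal.ofReal (Ψ (quantile μ u) - Ψ (quantile ν u)) := by
    intro u hu
    rw [← ofReal_abs_rpow_two, Real.rpow_two, sq_abs]
    refine ENNReal.ofReal_le_ofReal ?_
    rcases le_total (quantile ν u) (quantile μ u) with hle | hle
    · rw [hΨi]
      refine (sq_sub_le_of_le hle).trans_eq ?_
      rw [← intervalIntegral_dualDensity]
      refine intervalIntegral.integral_congr_Ioo_of_le hle fun x hx => ?_
      have h1 : cdf μ x < u := by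
        rw [← not_le, ← quantile_le_iff μ hu]; exact not_le.2 hx.2
      have h2 : u ≤ cdf ν x := (quantile_le_iff ν hu x).1 hx.1.le
      simp [hh, hs, h1.trans_le h2]
    · rw [hΨi, intervalIntegral.integral_symm, sub_sq_comm]
      refine (sq_sub_le_of_le hle).trans_eq ?_
      rw [← intervalIntegral_dualDensity, ← intervalIntegral.integral_neg]
      refine intervalIntegral.integral_congr_Ioo_of_le hle fun x hx => ?_
      have h1 : cdf ν x < u := by
        rw [← not_le, ← quantile_le_iff ν hu]; exact not_le.2 hx.2
      have h2 : u ≤ cdf μ x := (quantile_le_iff μ hu x).1 hx.1.le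
      simp [hh, hs, not_lt.2 (h1.trans_le h2).le]
  have hmap : ∀ (μ : Measure ℝ) [IsProbabilityMeasure μ], Integrable embed μ →
      Integrable (fun u => Ψ (quantile μ u)) (volume.restrict (Set.Ioo (0 : ℝ) 1)) ∧
      ∫ u in Set.Ioo (0 : ℝ) 1, Ψ (quantile μ u) = inner ℝ (∫ y, embed y ∂μ) f := by
    intro μ _ hμ
    rw [← (hΨμ μ hμ).2]
    constructor
    · have := (hΨμ μ hμ).1
      rw [← map_quantile μ] at this
      exact this.comp_aemeasurable (aemeasurable_quantile μ)
    · conv_rhs => rw [← map_quantile μ]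
      rw [integral_map (aemeasurable_quantile μ) hΨc.aestronglyMeasurable]
  have hcost : wasserstein 2 μ ν ^ 2 ≤
      ∫⁻ u in Set.Ioo (0 : ℝ) 1, ‖quantile μ u - quantile ν u‖ₑ ^ 2 := by
    have := wasserstein_two_sq_map_le (aemeasurable_quantile μ) (aemeasurable_quantile ν)
    rwa [map_quantile, map_quantile] at this
  have hnn : 0 ≤ᵐ[volume.restrict (Set.Ioo (0 : ℝ) 1)]
      fun u => Ψ (quantile μ u) - Ψ (quantile ν u) := by
    filter_upwards [ae_restrict_mem measurableSet_Ioo] with u hu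
    by_contra hneg
    have hlt : Ψ (quantile μ u) - Ψ (quantile ν u) < 0 := not_le.1 hneg
    have := hpt u hu
    rw [ENNReal.ofReal_of_nonpos hlt.le] at this
    have h0 : quantile μ u = quantile ν u := by
      simpa [sub_eq_zero] using le_antisymm this bot_le
    simp [h0] at hlt
  refine (hcost.trans (setLIntegral_mono_ae' measurableSet_Ioo (ae_of_all _ hpt))).trans ?_
  rw [← ofReal_integral_eq_lintegral_ofReal
      (f := fun u => Ψ (quantile μ u) - Ψ (quantile ν u)) ((hmap μ hμ).1.sub (hmap ν hν).1) hnn,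
    integral_sub (hmap μ hμ).1 (hmap ν hν).1, (hmap μ hμ).2, (hmap ν hν).2, ← inner_sub_left]
  refine ENNReal.ofReal_le_ofReal ((real_inner_le_norm _ _).trans ?_)
  rw [mul_comm]
  exact mul_le_mul_of_nonneg_right hfnorm (norm_nonneg _)

end Embedding

/-! ### Moments of sums of independent centered Hilbert-valued variables. -/

section MarcinkiewiczZygmund

/-- Among monomials of fixed total degree and degree at least two in `w`, the two extreme ones
dominate: compare according to which of `s`, `w` is larger. -/
theorem pow_mul_pow_le_of_two_le {s w : ℝ} (hs : 0 ≤ s) (hw : 0 ≤ w) {i j n : ℕ} (hj : 2 ≤ j)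
    (hij : i + j = n + 2) : s ^ i * w ^ j ≤ s ^ n * w ^ 2 + w ^ (n + 2) := by
  obtain ⟨l, rfl⟩ := Nat.exists_eq_add_of_le hj
  obtain rfl : n = i + l := by omega
  rcases le_total w s with h | h
  · calc s ^ i * w ^ (2 + l) = s ^ i * w ^ l * w ^ 2 := by ring
      _ ≤ s ^ i * s ^ l * w ^ 2 := by gcongr
      _ = s ^ (i + l) * w ^ 2 := by ring
      _ ≤ _ := le_add_of_nonneg_right (by positivity)
  · calc s ^ i * w ^ (2 + l) ≤ w ^ i * w ^ (2 + l) := by gcongr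
      _ = w ^ (i + l + 2) := by ring
      _ ≤ _ := le_add_of_nonneg_left (by positivity)

/-- The constant in the second-order expansion of `‖x + y‖ ^ (2 * k + 2)`. -/
def expansionConst : ℕ → ℝ
  | 0 => 1
  | k + 1 => 1 + 6 * (k + 1) + 8 * expansionConst k

theorem expansionConst_nonneg (k : ℕ) : 0 ≤ expansionConst k := by
  induction k with
  | zero => simp [expansionConst]
  | succ k ih => simp only [expansionConst]; positivity

/-- Here `p` stands for an inner product. The first-order term keeps its sign, since it must vanish
in expectation later; all terms of order two or more in `w` may be estimated crudely. -/
theorem pow_expansion_le {s w p : ℝ} (hs : 0 ≤ s) (hw : 0 ≤ w) (hp : |p| ≤ s * w) (k : ℕ) :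
    (s ^ 2 + 2 * p + w ^ 2) ^ (k + 1) ≤ s ^ (2 * k + 2) + 2 * (k + 1) * (s ^ (2 * k) * p) +
      expansionConst k * (s ^ (2 * k) * w ^ 2 + w ^ (2 * k + 2)) := by
  have hp' := abs_le.1 hp
  have h0 : 0 ≤ s ^ 2 + 2 * p + w ^ 2 := by nlinarith [sq_nonneg (s - w)]
  have h2 : s ^ 2 + 2 * p + w ^ 2 ≤ 2 * (s ^ 2 + w ^ 2) := by nlinarith [sq_nonneg (s - w)]
  induction k with
  | zero => simp [expansionConst]; nlinarith [sq_nonneg w]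
  | succ k ih =>
    have hC := expansionConst_nonneg k
    set D := s ^ (2 * (k + 1)) * w ^ 2 + w ^ (2 * (k + 1) + 2) with hD
    have e1 : s ^ (2 * k + 2) * w ^ 2 ≤ D :=
      pow_mul_pow_le_of_two_le hs hw le_rfl (by ring)
    have e2 : s ^ (2 * k) * w ^ 4 ≤ D :=
      pow_mul_pow_le_of_two_le hs hw (by norm_num) (by ring)
    have e3 : s ^ 2 * w ^ (2 * k + 2) ≤ D :=
      pow_mul_pow_le_of_two_le hs hw (by omega) (by ring)
    have e4 : s ^ 0 * w ^ (2 * k + 4) ≤ D :=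
      pow_mul_pow_le_of_two_le hs hw (by omega) (by ring)
    have e5 : s ^ (2 * k + 1) * w ^ 3 ≤ D :=
      pow_mul_pow_le_of_two_le hs hw (by norm_num) (by ring)
    have q1 : s ^ (2 * k) * (p * (2 * p + w ^ 2)) ≤ 3 * D := by
      have hpp : p * (2 * p + w ^ 2) ≤ 2 * (s * w) ^ 2 + (s * w) * w ^ 2 := by
        have : p ^ 2 ≤ (s * w) ^ 2 := sq_le_sq' hp'.1 hp'.2
        nlinarith [mul_le_mul_of_nonneg_right hp'.2 (sq_nonneg w)]
      calc s ^ (2 * k) * (p * (2 * p + w ^ 2))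
          ≤ s ^ (2 * k) * (2 * (s * w) ^ 2 + (s * w) * w ^ 2) := by gcongr
        _ = 2 * (s ^ (2 * k + 2) * w ^ 2) + s ^ (2 * k + 1) * w ^ 3 := by ring
        _ ≤ 3 * D := by linarith
    have q2 : (s ^ (2 * k) * w ^ 2 + w ^ (2 * k + 2)) * (s ^ 2 + 2 * p + w ^ 2) ≤ 8 * D := by
      calc _ ≤ (s ^ (2 * k) * w ^ 2 + w ^ (2 * k + 2)) * (2 * (s ^ 2 + w ^ 2)) := by gcongr
        _ = 2 * (s ^ (2 * k + 2) * w ^ 2 + s ^ (2 * k) * w ^ 4 + s ^ 2 * w ^ (2 * k + 2) +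
            s ^ 0 * w ^ (2 * k + 4)) := by ring
        _ ≤ 8 * D := by linarith
    calc (s ^ 2 + 2 * p + w ^ 2) ^ (k + 1 + 1)
        = (s ^ 2 + 2 * p + w ^ 2) ^ (k + 1) * (s ^ 2 + 2 * p + w ^ 2) := by ring
      _ ≤ (s ^ (2 * k + 2) + 2 * (k + 1) * (s ^ (2 * k) * p) +
          expansionConst k * (s ^ (2 * k) * w ^ 2 + w ^ (2 * k + 2))) *
            (s ^ 2 + 2 * p + w ^ 2) := by gcongr
      _ = s ^ (2 * (k + 1) + 2) + 2 * ((k + 1) + 1) * (s ^ (2 * (k + 1)) * p) +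
          (s ^ (2 * k + 2) * w ^ 2 + 2 * (k + 1) * (s ^ (2 * k) * (p * (2 * p + w ^ 2))) +
          expansionConst k * ((s ^ (2 * k) * w ^ 2 + w ^ (2 * k + 2)) *
            (s ^ 2 + 2 * p + w ^ 2))) := by ring
      _ ≤ s ^ (2 * (k + 1) + 2) + 2 * ((k + 1) + 1) * (s ^ (2 * (k + 1)) * p) +
          (D + 2 * (k + 1) * (3 * D) + expansionConst k * (8 * D)) := by gcongr
      _ = _ := by simp only [expansionConst]; push_cast; ring

variable {E : Type*} [NormedAddCommGroup E] [InnerProductSpace ℝ E]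

theorem norm_add_pow_le (x y : E) (k : ℕ) :
    ‖x + y‖ ^ (2 * k + 2) ≤ ‖x‖ ^ (2 * k + 2) + 2 * (k + 1) * (‖x‖ ^ (2 * k) * inner ℝ x y) +
      expansionConst k * (‖x‖ ^ (2 * k) * ‖y‖ ^ 2 + ‖y‖ ^ (2 * k + 2)) := by
  refine le_trans (le_of_eq ?_)
    (pow_expansion_le (norm_nonneg x) (norm_nonneg y) (abs_real_inner_le_norm x y) k)
  rw [← norm_add_sq_real, ← pow_mul]
  ring_nf

/-- The constant in the Marcinkiewicz–Zygmund inequality of order `2 * m`. -/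
def mzConst : ℕ → ℝ
  | 0 => 1
  | m + 1 => expansionConst m * (mzConst m + 1)

theorem mzConst_nonneg (m : ℕ) : 0 ≤ mzConst m := by
  induction m with
  | zero => simp [mzConst]
  | succ m ih => exact mul_nonneg (expansionConst_nonneg m) (by linarith)

variable {Ω : Type*} [MeasurableSpace Ω] {P : Measure Ω} [IsProbabilityMeasure P]

theorem integrable_norm_pow_of_le_memLp {F : Type*} [NormedAddCommGroup F] {n : ℕ} {f : Ω → F}
    (hf : MemLp f n P) {j : ℕ} (hj : j ≤ n) : Integrable (fun ω => ‖f ω‖ ^ j) P :=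
  (hf.mono_exponent (by exact_mod_cast hj)).integrable_norm_pow'

variable [CompleteSpace E] [SecondCountableTopology E] [MeasurableSpace E] [BorelSpace E]

/-- One step of the Marcinkiewicz–Zygmund inequality: adding an independent centered term. -/
theorem integral_norm_add_pow_le {S V : Ω → E} (hSV : IndepFun S V P) {k : ℕ}
    (hS : MemLp S (2 * k + 2 : ℕ) P) (hV : MemLp V (2 * k + 2 : ℕ) P) (hV0 : ∫ ω, V ω ∂P = 0) :
    ∫ ω, ‖S ω + V ω‖ ^ (2 * k + 2) ∂P ≤ ∫ ω, ‖S ω‖ ^ (2 * k + 2) ∂P +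
      expansionConst k * ((∫ ω, ‖S ω‖ ^ (2 * k) ∂P) * (∫ ω, ‖V ω‖ ^ 2 ∂P) +
        ∫ ω, ‖V ω‖ ^ (2 * k + 2) ∂P) := by
  have iS : ∀ j ≤ 2 * k + 2, Integrable (fun ω => ‖S ω‖ ^ j) P := fun j hj =>
    integrable_norm_pow_of_le_memLp hS hj
  have iV : ∀ j ≤ 2 * k + 2, Integrable (fun ω => ‖V ω‖ ^ j) P := fun j hj =>
    integrable_norm_pow_of_le_memLp hV hj
  have hVi : Integrable V P := hV.integrable (by exact_mod_cast (by omega : 1 ≤ 2 * k + 2))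
  -- The first-order term is a bilinear pairing of this vector with `V`; independence factors its
  -- mean, and `V` is centered.
  have hXi : Integrable (fun ω => ‖S ω‖ ^ (2 * k) • S ω) P := by
    refine (iS (2 * k + 1) (by omega)).mono'
      ((hS.1.norm.pow _).smul hS.1) (ae_of_all _ fun ω => ?_)
    rw [norm_smul, norm_pow, norm_norm, pow_succ]
  have hXV : IndepFun (fun ω => ‖S ω‖ ^ (2 * k) • S ω) V P :=
    hSV.comp (φ := fun x : E => ‖x‖ ^ (2 * k) • x) (ψ := id)
      (by fun_prop) measurable_id
  have hcross := hXV.integral_bilin hXi hVi (innerSL ℝ)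
  have icross := hXV.integrable_bilin hXi hVi (innerSL ℝ)
  rw [hV0, map_zero] at hcross
  have hinner : ∀ ω, innerSL ℝ (‖S ω‖ ^ (2 * k) • S ω) (V ω) =
      ‖S ω‖ ^ (2 * k) * inner ℝ (S ω) (V ω) := fun ω => real_inner_smul_left _ _ _
  simp_rw [hinner] at hcross icross
  have hNV : IndepFun (fun ω => ‖S ω‖ ^ (2 * k)) (fun ω => ‖V ω‖ ^ 2) P :=
    hSV.comp (φ := fun x : E => ‖x‖ ^ (2 * k)) (ψ := fun x : E => ‖x‖ ^ 2)
      (by fun_prop) (by fun_prop)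
  have hprod := hNV.integral_fun_mul_eq_mul_integral (iS _ (by omega)).1 (iV 2 (by omega)).1
  have iprod : Integrable (fun ω => ‖S ω‖ ^ (2 * k) * ‖V ω‖ ^ 2) P :=
    hNV.integrable_mul (iS _ (by omega)) (iV 2 (by omega))
  have iV' := iV (2 * k + 2) le_rfl
  have iS' := iS (2 * k + 2) le_rfl
  have i1 : Integrable (fun ω => ‖S ω‖ ^ (2 * k + 2) +
      2 * (k + 1) * (‖S ω‖ ^ (2 * k) * inner ℝ (S ω) (V ω))) P := iS'.add (icross.const_mul _)
  have i2 : Integrable (fun ω => ‖S ω‖ ^ (2 * k) * ‖V ω‖ ^ 2 + ‖V ω‖ ^ (2 * k + 2)) P :=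
    iprod.add iV'
  refine (integral_mono (integrable_norm_pow_of_le_memLp (hS.add hV) le_rfl)
    (i1.add (i2.const_mul (expansionConst k))) fun ω => norm_add_pow_le _ _ _).trans_eq ?_
  simp only [Pi.add_apply]
  rw [integral_add i1 (i2.const_mul _), integral_add iS' (icross.const_mul _), integral_const_mul,
    integral_const_mul, hcross, integral_add iprod iV', hprod, mul_zero, add_zero]

/-- The Marcinkiewicz–Zygmund inequality for independent centered Hilbert-valued variables. -/
theorem integral_norm_sum_pow_le {ι : Type*} {V : ι → Ω → E} (hind : iIndepFun V P) (m : ℕ)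
    (hV : ∀ i, MemLp (V i) (2 * m : ℕ) P) (hV1 : ∀ i, Integrable (V i) P)
    (hV0 : ∀ i, ∫ ω, V i ω ∂P = 0) {v : ℝ} (hv : 0 ≤ v)
    (hVv : ∀ i, ∀ j ≤ m, ∫ ω, ‖V i ω‖ ^ (2 * j) ∂P ≤ v ^ (2 * j)) (s : Finset ι) :
    ∫ ω, ‖∑ i ∈ s, V i ω‖ ^ (2 * m) ∂P ≤ mzConst m * (s.card : ℝ) ^ m * v ^ (2 * m) := by
  classical
  induction m generalizing s with
  | zero => simp [mzConst]
  | succ m ih =>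
    have hle : ((2 * m : ℕ) : ℝ≥0∞) ≤ (2 * (m + 1) : ℕ) := by exact_mod_cast (by omega)
    have ih' := ih (fun i => (hV i).mono_exponent hle) (fun i j hj => hVv i j (by omega))
    have hM := mzConst_nonneg m
    have hE := expansionConst_nonneg m
    -- Terms are added one at a time. The lower-order moment of each partial sum, known from the
    -- induction on `m`, is bounded using the full cardinality of `s`, so every step costs the same.
    have key : ∀ t : Finset ι, t ⊆ s → ∫ ω, ‖∑ i ∈ t, V i ω‖ ^ (2 * (m + 1)) ∂P ≤
        t.card * (expansionConst m * (mzConst m * (s.card : ℝ) ^ m + 1) * v ^ (2 * (m + 1))) := by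
      intro t
      induction t using Finset.induction_on with
      | empty => simp
      | insert a t hat iht =>
        intro hts
        have hsub : t ⊆ s := (Finset.subset_insert a t).trans hts
        have hindep : IndepFun (fun ω => ∑ i ∈ t, V i ω) (V a) P := by
          have := hind.indepFun_finsetSum_of_notMem₀ (fun i => (hV1 i).aemeasurable) hat
          convert this using 1
          ext ω; simp
        have hSt : MemLp (fun ω => ∑ i ∈ t, V i ω) (2 * m + 2 : ℕ) P :=
          memLp_finsetSum t fun i _ => hV i
        have hstep := integral_norm_add_pow_le hindep hSt (hV a) (hV0 a)
        have h1 : ∫ ω, ‖V a ω‖ ^ 2 ∂P ≤ v ^ 2 := hVv a 1 (by omega)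
        have h2 : ∫ ω, ‖V a ω‖ ^ (2 * m + 2) ∂P ≤ v ^ (2 * m + 2) := hVv a (m + 1) le_rfl
        have h3 : ∫ ω, ‖∑ i ∈ t, V i ω‖ ^ (2 * m) ∂P ≤
            mzConst m * (s.card : ℝ) ^ m * v ^ (2 * m) := by
          refine (ih' t).trans ?_
          have : (t.card : ℝ) ≤ s.card := by exact_mod_cast Finset.card_le_card hsub
          gcongr
        have h4 := iht hsub
        calc ∫ ω, ‖∑ i ∈ insert a t, V i ω‖ ^ (2 * (m + 1)) ∂P
            = ∫ ω, ‖∑ i ∈ t, V i ω + V a ω‖ ^ (2 * m + 2) ∂P := by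
              simp only [Finset.sum_insert hat, add_comm (V a _)]; rfl
          _ ≤ _ := hstep
          _ ≤ t.card * (expansionConst m * (mzConst m * (s.card : ℝ) ^ m + 1) *
                v ^ (2 * (m + 1))) + expansionConst m *
                (mzConst m * (s.card : ℝ) ^ m * v ^ (2 * m) * v ^ 2 + v ^ (2 * m + 2)) := by
              gcongr
              exact h4
          _ = _ := by
              rw [Finset.card_insert_of_notMem hat]; push_cast; ring
    refine (key s subset_rfl).trans ?_
    have hn : (s.card : ℝ) ≤ (s.card : ℝ) ^ (m + 1) := by
      exact_mod_cast Nat.le_self_pow (by omega) _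
    calc (s.card : ℝ) * (expansionConst m * (mzConst m * (s.card : ℝ) ^ m + 1) * v ^ (2 * (m + 1)))
        = expansionConst m * (mzConst m * (s.card : ℝ) ^ (m + 1) + s.card) *
            v ^ (2 * (m + 1)) := by ring
      _ ≤ expansionConst m * (mzConst m * (s.card : ℝ) ^ (m + 1) + (s.card : ℝ) ^ (m + 1)) *
            v ^ (2 * (m + 1)) := by gcongr
      _ = _ := by simp only [mzConst]; ring

end MarcinkiewiczZygmund

/-! ### Dyadic chaining and Kolmogorov's maximal inequality. -/

section Chaining

/-- The `k`-th dyadic point of level `n` in `[0, T]`. -/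
def dyadicPoint (T : ℝ) (n k : ℕ) : ℝ := k / 2 ^ n * T

theorem dyadicPoint_mem {T : ℝ} (hT : 0 ≤ T) {n k : ℕ} (hk : k ≤ 2 ^ n) :
    dyadicPoint T n k ∈ Set.Icc 0 T := by
  have h1 : (k : ℝ) / 2 ^ n ≤ 1 := by
    rw [div_le_one (by positivity)]; exact_mod_cast hk
  exact ⟨by unfold dyadicPoint; positivity, mul_le_of_le_one_left hT h1⟩

theorem dyadicPoint_zero (T : ℝ) (n : ℕ) : dyadicPoint T n 0 = 0 := by simp [dyadicPoint]

theorem dyadicPoint_two_mul (T : ℝ) (n k : ℕ) :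
    dyadicPoint T (n + 1) (2 * k) = dyadicPoint T n k := by
  unfold dyadicPoint; push_cast; field_simp; ring

theorem dyadicPoint_succ_sub (T : ℝ) (n k : ℕ) :
    dyadicPoint T n (k + 1) - dyadicPoint T n k = T / 2 ^ n := by
  unfold dyadicPoint; push_cast; ring

variable {E : Type*} [NormedAddCommGroup E]

/-- The sum of the `r`-th powers of the dyadic increments of level `n`. -/
def dyadicVariation (T : ℝ) (r : ℕ) (u : ℝ → E) (n : ℕ) : ℝ≥0∞ :=
  ∑ k ∈ Finset.range (2 ^ n), ‖u (dyadicPoint T n (k + 1)) - u (dyadicPoint T n k)‖ₑ ^ r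

theorem enorm_increment_le_dyadicVariation (T : ℝ) {r : ℕ} (hr : r ≠ 0) (u : ℝ → E) {n k : ℕ}
    (hk : k < 2 ^ n) : ‖u (dyadicPoint T n (k + 1)) - u (dyadicPoint T n k)‖ₑ ≤
      dyadicVariation T r u n ^ (1 / (r : ℝ)) := by
  have h := Finset.single_le_sum
    (f := fun k => ‖u (dyadicPoint T n (k + 1)) - u (dyadicPoint T n k)‖ₑ ^ r)
    (fun i _ => bot_le) (Finset.mem_range.2 hk)
  rw [one_div, ENNReal.le_rpow_inv_iff (by positivity), ENNReal.rpow_natCast]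
  exact h

/-- A dyadic point of level n + 1 either belongs to level n or is the right neighbour of such a
point, so the way back to 0 uses at most one increment per level. -/
theorem enorm_sub_zero_le_sum (T : ℝ) {r : ℕ} (hr : r ≠ 0) (u : ℝ → E) (n : ℕ) :
    ∀ k ≤ 2 ^ n, ‖u (dyadicPoint T n k) - u 0‖ₑ ≤
      ∑ j ∈ Finset.range (n + 1), dyadicVariation T r u j ^ (1 / (r : ℝ)) := by
  induction n with
  | zero =>
    intro k hk
    obtain rfl | rfl : k = 0 ∨ k = 1 := by simp at hk; omega
    · simp [dyadicPoint_zero]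
    · have := enorm_increment_le_dyadicVariation T hr u (n := 0) (k := 0) (by norm_num)
      rw [dyadicPoint_zero] at this
      simpa using this
  | succ n ih =>
    intro k hk
    rw [Finset.sum_range_succ]
    obtain ⟨l, rfl | rfl⟩ := Nat.even_or_odd' k
    · rw [dyadicPoint_two_mul]
      exact (ih l (by rw [pow_succ] at hk; omega)).trans le_self_add
    · rw [pow_succ] at hk
      have h1 := enorm_increment_le_dyadicVariation T hr u (n := n + 1) (k := 2 * l)
        (by rw [pow_succ]; omega)
      have h2 := ih l (by omega)
      rw [dyadicPoint_two_mul] at h1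
      calc _ = ‖(u (dyadicPoint T n l) - u 0) +
              (u (dyadicPoint T (n + 1) (2 * l + 1)) - u (dyadicPoint T n l))‖ₑ := by
            congr 1; abel
        _ ≤ _ := (enorm_add_le _ _).trans (add_le_add h2 h1)

/-- The constant in the chaining bound. -/
def chainingConst (r : ℕ) (T : ℝ) : ℝ≥0∞ :=
  2 * (1 - (2⁻¹ : ℝ≥0∞) ^ (1 / (r : ℝ)))⁻¹ ^ r * ENNReal.ofReal T ^ 3

theorem chainingConst_ne_top {r : ℕ} (hr : r ≠ 0) (T : ℝ) : chainingConst r T ≠ ∞ := by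
  have : (2⁻¹ : ℝ≥0∞) ^ (1 / (r : ℝ)) < 1 :=
    ENNReal.rpow_lt_one (by norm_num) (by positivity)
  refine ENNReal.mul_ne_top (ENNReal.mul_ne_top (by simp) (ENNReal.pow_ne_top ?_)) (by simp)
  exact ENNReal.inv_ne_top.2 (tsub_pos_of_lt this).ne'

/-- The factor 2^j forces the level-j variation below 2^{-j} times the whole sum; after taking r-th
roots the levels form a geometric series. The bound is uniform in the level, hence survives passage
to all times. -/
theorem enorm_sub_zero_pow_le (T : ℝ) {r : ℕ} (hr : r ≠ 0) (u : ℝ → E) {n k : ℕ}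
    (hk : k ≤ 2 ^ n) : ‖u (dyadicPoint T n k) - u 0‖ₑ ^ r ≤
      (1 - (2⁻¹ : ℝ≥0∞) ^ (1 / (r : ℝ)))⁻¹ ^ r * ∑' j, 2 ^ j * dyadicVariation T r u j := by
  set G := ∑' j, 2 ^ j * dyadicVariation T r u j
  have hr' : (r : ℝ) ≠ 0 := by exact_mod_cast hr
  have hterm : ∀ j, dyadicVariation T r u j ^ (1 / (r : ℝ)) ≤
      ((2⁻¹ : ℝ≥0∞) ^ (1 / (r : ℝ))) ^ j * G ^ (1 / (r : ℝ)) := by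
    intro j
    have h1 : 2 ^ j * dyadicVariation T r u j ≤ G :=
      ENNReal.le_tsum (f := fun j => 2 ^ j * dyadicVariation T r u j) j
    have h2 : dyadicVariation T r u j ≤ 2⁻¹ ^ j * G := by
      calc dyadicVariation T r u j = 2⁻¹ ^ j * (2 ^ j * dyadicVariation T r u j) := by
            rw [← mul_assoc, ← mul_pow, ENNReal.inv_mul_cancel (by simp) (by simp), one_pow,
              one_mul]
        _ ≤ _ := by gcongr
    refine (ENNReal.rpow_le_rpow h2 (by positivity)).trans_eq ?_
    rw [ENNReal.mul_rpow_of_nonneg _ _ (by positivity), ← ENNReal.rpow_natCast_mul,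
      ← ENNReal.rpow_mul_natCast, mul_comm (j : ℝ)]
  have hsum : ‖u (dyadicPoint T n k) - u 0‖ₑ ≤
      (1 - (2⁻¹ : ℝ≥0∞) ^ (1 / (r : ℝ)))⁻¹ * G ^ (1 / (r : ℝ)) := by
    refine (enorm_sub_zero_le_sum T hr u n k hk).trans ?_
    refine (Finset.sum_le_sum fun j _ => hterm j).trans ?_
    rw [← Finset.sum_mul, ← ENNReal.tsum_geometric]
    gcongr
    exact ENNReal.sum_le_tsum _
  refine (pow_le_pow_left' hsum r).trans_eq ?_
  rw [mul_pow, one_div, ← ENNReal.rpow_natCast (G ^ _), ENNReal.rpow_inv_rpow hr']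

variable {Ω : Type*} [MeasurableSpace Ω] {P : Measure Ω}

/-- Kolmogorov's criterion as a maximal inequality. -/
theorem exists_maximal_bound {T : ℝ} (hT : 0 < T) {r : ℕ} (hr : r ≠ 0) {U : ℝ → Ω → E}
    (hU : ∀ t ∈ Set.Icc 0 T, AEStronglyMeasurable (U t) P)
    (hc : ∀ᵐ ω ∂P, ContinuousOn (fun t => U t ω) (Set.Icc 0 T)) {A : ℝ≥0∞}
    (hA : ∀ s ∈ Set.Icc 0 T, ∀ t ∈ Set.Icc 0 T,
      ∫⁻ ω, ‖U t ω - U s ω‖ₑ ^ r ∂P ≤ A * ENNReal.ofReal |t - s| ^ 3) :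
    ∃ γ : Ω → ℝ≥0∞, AEMeasurable γ P ∧
      (∀ᵐ ω ∂P, ∀ t ∈ Set.Icc 0 T, ‖U t ω - U 0 ω‖ₑ ^ r ≤ γ ω) ∧
      ∫⁻ ω, γ ω ∂P ≤ chainingConst r T * A := by
  set D : ℝ≥0∞ := (1 - (2⁻¹ : ℝ≥0∞) ^ (1 / (r : ℝ)))⁻¹ ^ r with hD
  have hmeas1 : ∀ j, ∀ k ∈ Finset.range (2 ^ j), AEMeasurable (fun ω =>
      ‖U (dyadicPoint T j (k + 1)) ω - U (dyadicPoint T j k) ω‖ₑ ^ r) P := by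
    intro j k hk
    have hk := Finset.mem_range.1 hk
    exact ((hU _ (dyadicPoint_mem hT.le hk)).sub
      (hU _ (dyadicPoint_mem hT.le hk.le))).enorm.pow_const r
  have hmeas : ∀ j, AEMeasurable (fun ω => dyadicVariation T r (fun t => U t ω) j) P := by
    intro j
    unfold dyadicVariation
    exact Finset.aemeasurable_fun_sum _ (hmeas1 j)
  have hmeas2 : ∀ j, AEMeasurable (fun ω => 2 ^ j * dyadicVariation T r (fun t => U t ω) j) P :=
    fun j => (hmeas j).const_mul _
  refine ⟨fun ω => D * ∑' j, 2 ^ j * dyadicVariation T r (fun t => U t ω) j,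
    (AEMeasurable.tsum hmeas2).const_mul _, ?_, ?_⟩
  · filter_upwards [hc] with ω hω t ht
    -- Dyadic approximation of `t` from below; path continuity transfers the bound to `t`.
    set d : ℕ → ℝ := fun n => dyadicPoint T n ⌊t / T * 2 ^ n⌋₊ with hd
    have ht1 : t / T ≤ 1 := (div_le_one hT).2 ht.2
    have hfl : ∀ n, ⌊t / T * 2 ^ n⌋₊ ≤ 2 ^ n := fun n => by
      refine Nat.floor_le_of_le ?_
      push_cast
      exact mul_le_of_le_one_left (by positivity) ht1
    have hdt : Filter.Tendsto d Filter.atTop (nhds t) := by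
      have h1 := (tendsto_nat_floor_mul_div_atTop (div_nonneg ht.1 hT.le)).comp
        (tendsto_pow_atTop_atTop_of_one_lt (one_lt_two : (1 : ℝ) < 2))
      have h2 := h1.mul_const T
      rwa [div_mul_cancel₀ _ hT.ne'] at h2
    have hd' : Filter.Tendsto d Filter.atTop (nhdsWithin t (Set.Icc 0 T)) :=
      tendsto_nhdsWithin_iff.2 ⟨hdt, Filter.Eventually.of_forall
        fun n => dyadicPoint_mem hT.le (hfl n)⟩
    have hlim : Filter.Tendsto (fun n => ‖U (d n) ω - U 0 ω‖ₑ ^ r) Filter.atTop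
        (nhds (‖U t ω - U 0 ω‖ₑ ^ r)) :=
      (ENNReal.continuous_pow r).continuousAt.tendsto.comp
        ((((hω t ht).tendsto.comp hd').sub_const (U 0 ω)).enorm)
    exact le_of_tendsto hlim (Filter.Eventually.of_forall fun n =>
      enorm_sub_zero_pow_le T hr (fun t => U t ω) (hfl n))
  · rw [lintegral_const_mul'' _ (AEMeasurable.tsum hmeas2), lintegral_tsum hmeas2]
    have hterm : ∀ j, ∫⁻ ω, 2 ^ j * dyadicVariation T r (fun t => U t ω) j ∂P ≤
        2⁻¹ ^ j * (A * ENNReal.ofReal T ^ 3) := by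
      intro j
      rw [lintegral_const_mul'' _ (hmeas j)]
      unfold dyadicVariation
      rw [lintegral_finsetSum' _ (hmeas1 j)]
      have hle : ∀ k ∈ Finset.range (2 ^ j), ∫⁻ ω,
          ‖U (dyadicPoint T j (k + 1)) ω - U (dyadicPoint T j k) ω‖ₑ ^ r ∂P ≤
            A * (ENNReal.ofReal T * 2⁻¹ ^ j) ^ 3 := by
        intro k hk
        have hk := Finset.mem_range.1 hk
        refine (hA _ (dyadicPoint_mem hT.le hk.le) _ (dyadicPoint_mem hT.le hk)).trans_eq ?_
        rw [dyadicPoint_succ_sub, abs_of_nonneg (by positivity), div_eq_mul_inv,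
          ENNReal.ofReal_mul hT.le, ENNReal.ofReal_inv_of_pos (by positivity),
          ENNReal.ofReal_pow (by norm_num), ENNReal.inv_pow, ENNReal.ofReal_ofNat]
      refine (mul_le_mul_right (Finset.sum_le_sum hle) _).trans_eq ?_
      rw [Finset.sum_const, Finset.card_range, nsmul_eq_mul]
      push_cast
      -- The weight 2^j and the number 2^j of increments consume two of the three factors 2^{-j};
      -- the third makes the series over levels converge. This accounts for the exponent 3.
      have h2 : (2 : ℝ≥0∞) ^ j * 2⁻¹ ^ j = 1 := by
        rw [← mul_pow, ENNReal.mul_inv_cancel (by simp) (by simp), one_pow]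
      calc (2 : ℝ≥0∞) ^ j * (2 ^ j * (A * (ENNReal.ofReal T * 2⁻¹ ^ j) ^ 3))
          = (2 ^ j * 2⁻¹ ^ j) * (2 ^ j * 2⁻¹ ^ j) * (2⁻¹ ^ j * (A * ENNReal.ofReal T ^ 3)) := by
            ring
        _ = _ := by rw [h2, one_mul, one_mul]
    calc D * ∑' j, ∫⁻ ω, 2 ^ j * dyadicVariation T r (fun t => U t ω) j ∂P
        ≤ D * ∑' j, 2⁻¹ ^ j * (A * ENNReal.ofReal T ^ 3) := by gcongr with j; exact hterm j
      _ = _ := by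
        rw [ENNReal.tsum_mul_right, ENNReal.tsum_geometric, ENNReal.one_sub_inv_two, inv_inv,
          chainingConst, ← hD]
        ring

end Chaining

/-! ### Increments and maximum of fractional Brownian motion. -/

section FractionalBrownianMotion

variable {Ω : Type*} [MeasurableSpace Ω] {P : Measure Ω} [IsProbabilityMeasure P]
  {H T : ℝ} {B : ℝ → Ω → ℝ}

/-- On a bounded interval any time exponent at least 3 may be lowered to the exponent 3 used in the
chaining bound. -/
theorem rpow_le_rpow_sub_three_mul {x T a : ℝ} (hx : 0 ≤ x) (hxT : x ≤ T) (ha : 3 ≤ a) :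
    x ^ a ≤ T ^ (a - 3) * x ^ 3 := by
  have : x ^ a = x ^ (a - 3) * x ^ (3 : ℝ) := by
    rw [← Real.rpow_add_of_nonneg hx (by linarith) (by norm_num)]; ring_nf
  rw [this, show (3 : ℝ) = (3 : ℕ) by norm_num, Real.rpow_natCast]
  have := Real.rpow_le_rpow hx hxT (z := a - (3 : ℕ)) (by push_cast; linarith)
  gcongr

theorem abs_sub_le_of_mem_Icc_zero {s t T : ℝ} (hs : s ∈ Set.Icc 0 T) (ht : t ∈ Set.Icc 0 T) :
    |t - s| ≤ T := by
  rw [abs_le]; constructor <;> linarith [hs.1, hs.2, ht.1, ht.2]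

theorem IsFractionalBrownianMotion.map_sub (hB : IsFractionalBrownianMotion H T P B) (hH : H ≠ 0)
    {s t : ℝ} (hs : s ∈ Set.Icc 0 T) (ht : t ∈ Set.Icc 0 T) :
    P.map (fun ω => B t ω - B s ω) = gaussianReal 0 (|t - s| ^ (2 * H)).toNNReal := by
  have hg : ∀ u ∈ Set.Icc 0 T, MemLp (B u) 2 P := fun u hu =>
    (hB.gaussian.hasGaussianLaw_eval ⟨u, hu⟩).memLp (by simp)
  have hlaw : HasGaussianLaw (fun ω => B t ω - B s ω) P :=
    hB.gaussian.hasGaussianLaw_fun_sub (s := ⟨t, ht⟩) (t := ⟨s, hs⟩)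
  have hmean : ∫ ω, (B t ω - B s ω) ∂P = 0 := by
    rw [integral_sub ((hg t ht).integrable one_le_two) ((hg s hs).integrable one_le_two),
      hB.centered t ht, hB.centered s hs, sub_zero]
  rw [hlaw.map_eq_gaussianReal, hmean,
    variance_of_integral_eq_zero hlaw.aemeasurable hmean]
  congr 2
  have hprod : ∀ u ∈ Set.Icc 0 T, ∀ v ∈ Set.Icc 0 T, Integrable (fun ω => B u ω * B v ω) P :=
    fun u hu v hv => (hg u hu).integrable_mul (hg v hv)
  have hexp : ∀ ω, (B t ω - B s ω) ^ 2 = B t ω * B t ω + B s ω * B s ω - 2 * (B t ω * B s ω) :=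
    fun ω => by ring
  simp_rw [hexp]
  have hadd : Integrable (fun ω => B t ω * B t ω + B s ω * B s ω) P :=
    (hprod t ht t ht).add (hprod s hs s hs)
  rw [integral_sub hadd ((hprod t ht s hs).const_mul 2),
    integral_add (hprod t ht t ht) (hprod s hs s hs), integral_const_mul,
    hB.covariance t ht t ht, hB.covariance s hs s hs, hB.covariance s hs t ht]
  have : (0 : ℝ) ^ (2 * H) = 0 := Real.zero_rpow (by simpa using hH)
  simp only [sub_self, abs_zero, this]
  ring

/-- The absolute moments of the standard normal distribution. -/
def gaussianMoment (r : ℕ) : ℝ≥0∞ := ∫⁻ x, ‖x‖ₑ ^ r ∂(gaussianReal 0 1)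

theorem gaussianMoment_ne_top (r : ℕ) : gaussianMoment r ≠ ∞ := by
  rcases eq_or_ne r 0 with rfl | hr
  · simp [gaussianMoment]
  · have h := (memLp_id_gaussianReal (μ := 0) (v := 1) r).2
    have := lintegral_rpow_enorm_lt_top_of_eLpNorm_lt_top (by exact_mod_cast hr) (by simp) h
    simpa [gaussianMoment] using this.ne

theorem IsFractionalBrownianMotion.lintegral_sub_pow (hB : IsFractionalBrownianMotion H T P B)
    (hH : H ≠ 0) {s t : ℝ} (hs : s ∈ Set.Icc 0 T) (ht : t ∈ Set.Icc 0 T) (r : ℕ) :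
    ∫⁻ ω, ‖B t ω - B s ω‖ₑ ^ r ∂P = ENNReal.ofReal (|t - s| ^ (H * r)) * gaussianMoment r := by
  have hm : Measurable (fun ω => B t ω - B s ω) := (hB.measurable t ht).sub (hB.measurable s hs)
  have hscale : gaussianReal 0 (|t - s| ^ (2 * H)).toNNReal =
      (gaussianReal 0 1).map (|t - s| ^ H * ·) := by
    rw [gaussianReal_map_const_mul, mul_zero, mul_one]
    congr 1
    ext
    rw [Real.coe_toNNReal _ (by positivity), mul_comm, Real.rpow_mul (abs_nonneg _), Real.rpow_two]
    rfl
  have h1 : ∫⁻ ω, ‖B t ω - B s ω‖ₑ ^ r ∂P =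
      ∫⁻ x, ‖x‖ₑ ^ r ∂(P.map (fun ω => B t ω - B s ω)) := by
    rw [lintegral_map (by fun_prop) hm]
  rw [h1, hB.map_sub hH hs ht, hscale, lintegral_map (by fun_prop) (by fun_prop), gaussianMoment,
    ← lintegral_const_mul _ (by fun_prop)]
  refine lintegral_congr fun x => ?_
  rw [enorm_mul, mul_pow, Real.enorm_of_nonneg (by positivity), ← ENNReal.ofReal_pow (by positivity),
    ← Real.rpow_natCast, ← Real.rpow_mul (abs_nonneg _)]

/-- The variance at time 0 is zero; this needs `H ≠ 0`, as 0^0 = 1. -/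
theorem IsFractionalBrownianMotion.zero_ae {Q : Measure Ω}
    (hB : IsFractionalBrownianMotion H T Q B) (hH : H ≠ 0) (hT : 0 ≤ T) : ∀ᵐ ω ∂Q, B 0 ω = 0 := by
  have h0 : (0 : ℝ) ∈ Set.Icc 0 T := ⟨le_rfl, hT⟩
  have hg : MemLp (B 0) 2 Q := (hB.gaussian.hasGaussianLaw_eval ⟨0, h0⟩).memLp (by simp)
  have h := hB.covariance 0 h0 0 h0
  have hz : (0 : ℝ) ^ (2 * H) = 0 := Real.zero_rpow (by simpa using hH)
  simp only [sub_self, abs_zero, hz, add_zero, zero_div] at h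
  rw [integral_eq_zero_iff_of_nonneg (fun ω => mul_self_nonneg _) (hg.integrable_mul hg)] at h
  filter_upwards [h] with ω hω
  simpa using hω

/-- The bound of the `r`-th moment of the maximum of a fractional Brownian motion. -/
def fbmMaxConst (H T : ℝ) (r : ℕ) : ℝ≥0∞ :=
  chainingConst r T * (ENNReal.ofReal (T ^ (H * r - 3)) * gaussianMoment r)

theorem fbmMaxConst_ne_top (H T : ℝ) {r : ℕ} (hr : r ≠ 0) : fbmMaxConst H T r ≠ ∞ :=
  ENNReal.mul_ne_top (chainingConst_ne_top hr T)
    (ENNReal.mul_ne_top ENNReal.ofReal_ne_top (gaussianMoment_ne_top r))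

/-- The r-th moment of an increment is of order |t - s|^{Hr}, so chaining applies as soon as Hr ≥ 3.
An a.e. measurable majorant replaces the supremum, whose measurability need not be discussed. -/
theorem IsFractionalBrownianMotion.exists_bound (hB : IsFractionalBrownianMotion H T P B)
    (hH : 0 < H) (hT : 0 < T) {r : ℕ} (hr : 3 ≤ H * r) :
    ∃ β : Ω → ℝ, AEMeasurable β P ∧ (∀ ω, 0 ≤ β ω) ∧
      (∀ᵐ ω ∂P, ∀ t ∈ Set.Icc 0 T, |B t ω| ≤ β ω) ∧
      ∫⁻ ω, ‖β ω‖ₑ ^ r ∂P ≤ fbmMaxConst H T r := by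
  have hr0 : r ≠ 0 := by rintro rfl; norm_num at hr
  obtain ⟨γ, hγm, hγ, hγi⟩ := exists_maximal_bound (P := P) hT hr0 (U := B)
    (A := ENNReal.ofReal (T ^ (H * r - 3)) * gaussianMoment r)
    (fun t ht => (hB.measurable t ht).aestronglyMeasurable) hB.continuous_paths
    (fun s hs t ht => by
      rw [hB.lintegral_sub_pow hH.ne' hs ht, mul_right_comm]
      gcongr
      rw [← ENNReal.ofReal_pow (abs_nonneg _), ← ENNReal.ofReal_mul (by positivity)]
      exact ENNReal.ofReal_le_ofReal (rpow_le_rpow_sub_three_mul (abs_nonneg _)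
        (abs_sub_le_of_mem_Icc_zero hs ht) hr))
  have hγtop : ∀ᵐ ω ∂P, γ ω < ∞ := ae_lt_top' hγm
    (ne_top_of_le_ne_top (fbmMaxConst_ne_top H T hr0) hγi)
  have hpow : ∀ x : ℝ≥0∞, (x ^ (1 / (r : ℝ))) ^ r = x := fun x => by
    rw [one_div, ← ENNReal.rpow_natCast, ENNReal.rpow_inv_rpow (by exact_mod_cast hr0)]
  refine ⟨fun ω => (γ ω ^ (1 / (r : ℝ))).toReal, (hγm.pow_const _).ennreal_toReal,
    fun ω => ENNReal.toReal_nonneg, ?_, ?_⟩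
  · filter_upwards [hγ, hγtop, hB.zero_ae hH.ne' hT.le] with ω h1 h2 h3 t ht
    have h4 := h1 t ht
    rw [h3, sub_zero, ← hpow (γ ω)] at h4
    have h5 : ‖B t ω‖ₑ ≤ γ ω ^ (1 / (r : ℝ)) := (ENNReal.pow_le_pow_left_iff hr0).1 h4
    have h6 := ENNReal.toReal_mono (ENNReal.rpow_ne_top_of_nonneg (by positivity) h2.ne) h5
    simpa using h6
  · refine le_trans (lintegral_mono_ae ?_) hγi
    filter_upwards [hγtop] with ω h2
    rw [Real.enorm_of_nonneg ENNReal.toReal_nonneg,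
      ENNReal.ofReal_toReal (ENNReal.rpow_ne_top_of_nonneg (by positivity) h2.ne), hpow]

end FractionalBrownianMotion

/-! ### Comparison of integral equations. -/

section IntegralEquations

/-- The form in which two equations are subtracted throughout. The drifts along the paths need only
be integrable; continuity is asked of the majorant `h` alone. -/
theorem abs_sub_le_add_integral {T a t : ℝ} {y z f g c d h : ℝ → ℝ}
    (hf : IntervalIntegrable f volume 0 T) (hg : IntervalIntegrable g volume 0 T)
    (hh : ContinuousOn h (Set.Icc 0 T)) (ht : t ∈ Set.Icc 0 T)
    (hfg : ∀ s ∈ Set.Icc 0 T, |f s - g s| ≤ h s)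
    (hy : y t = c t + ∫ s in (0 : ℝ)..t, f s) (hz : z t = d t + ∫ s in (0 : ℝ)..t, g s)
    (hcd : |c t - d t| ≤ a) : |y t - z t| ≤ a + ∫ s in (0 : ℝ)..t, h s := by
  have hT : (0 : ℝ) ≤ T := ht.1.trans ht.2
  have hsub : Set.uIcc 0 t ⊆ Set.uIcc 0 T := by
    rw [Set.uIcc_of_le ht.1, Set.uIcc_of_le hT]; exact Set.Icc_subset_Icc_right ht.2
  have hint : IntervalIntegrable h volume 0 t :=
    (hh.mono (Set.Icc_subset_Icc_right ht.2)).intervalIntegrable_of_Icc ht.1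
  have h1 : |∫ s in (0 : ℝ)..t, (f s - g s)| ≤ ∫ s in (0 : ℝ)..t, h s := by
    rw [← Real.norm_eq_abs]
    exact intervalIntegral.norm_integral_le_of_norm_le ht.1
      (ae_of_all _ fun s hs => hfg s ⟨hs.1.le, hs.2.trans ht.2⟩) hint
  have h2 : y t - z t = (c t - d t) + ∫ s in (0 : ℝ)..t, (f s - g s) := by
    rw [intervalIntegral.integral_sub (hf.mono_set hsub) (hg.mono_set hsub), hy, hz]; ring
  rw [h2]
  exact (abs_add_le _ _).trans (add_le_add hcd h1)

theorem abs_sub_le_mul_exp {T a L : ℝ} (hL : 0 ≤ L) {y z f g c d : ℝ → ℝ}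
    (hyc : ContinuousOn y (Set.Icc 0 T)) (hzc : ContinuousOn z (Set.Icc 0 T))
    (hf : IntervalIntegrable f volume 0 T) (hg : IntervalIntegrable g volume 0 T)
    (hfg : ∀ s ∈ Set.Icc 0 T, |f s - g s| ≤ L * |y s - z s|)
    (hy : ∀ t ∈ Set.Icc 0 T, y t = c t + ∫ s in (0 : ℝ)..t, f s)
    (hz : ∀ t ∈ Set.Icc 0 T, z t = d t + ∫ s in (0 : ℝ)..t, g s)
    (hcd : ∀ t ∈ Set.Icc 0 T, |c t - d t| ≤ a) :
    ∀ t ∈ Set.Icc 0 T, |y t - z t| ≤ a * Real.exp (L * t) := by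
  refine le_mul_exp_of_le_add_integral hL (hyc.sub hzc).abs fun t ht => ?_
  rw [← intervalIntegral.integral_const_mul]
  exact abs_sub_le_add_integral hf hg (continuousOn_const.mul (hyc.sub hzc).abs) ht hfg
    (hy t ht) (hz t ht) (hcd t ht)

theorem sq_integral_le_mul_integral_sq {t : ℝ} (ht : 0 ≤ t) {f : ℝ → ℝ}
    (hf : ContinuousOn f (Set.Icc 0 t)) :
    (∫ s in (0 : ℝ)..t, f s) ^ 2 ≤ t * ∫ s in (0 : ℝ)..t, f s ^ 2 := by
  rcases ht.eq_or_lt with rfl | ht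
  · simp
  have i1 : IntervalIntegrable f volume 0 t := hf.intervalIntegrable_of_Icc ht.le
  have i2 : IntervalIntegrable (fun s => f s ^ 2) volume 0 t :=
    (hf.pow 2).intervalIntegrable_of_Icc ht.le
  set I := ∫ s in (0 : ℝ)..t, f s with hI
  -- Cauchy–Schwarz by expanding a variance.
  have h0 : 0 ≤ ∫ s in (0 : ℝ)..t, (t * f s - I) ^ 2 :=
    intervalIntegral.integral_nonneg ht.le fun s _ => sq_nonneg _
  have hexp : ∀ s, (t * f s - I) ^ 2 = t ^ 2 * f s ^ 2 - 2 * t * I * f s + I ^ 2 :=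
    fun s => by ring
  simp_rw [hexp] at h0
  rw [intervalIntegral.integral_add ((i2.const_mul _).sub (i1.const_mul _)) (by simp),
    intervalIntegral.integral_sub (i2.const_mul _) (i1.const_mul _),
    intervalIntegral.integral_const_mul, intervalIntegral.integral_const_mul, ← hI,
    intervalIntegral.integral_const, smul_eq_mul, sub_zero] at h0
  have : t * I ^ 2 ≤ t * (t * ∫ s in (0 : ℝ)..t, f s ^ 2) := by nlinarith
  exact le_of_mul_le_mul_left this ht

end IntegralEquations

/-! ### Lipschitz and growth bounds of the drift. -/

section Drift

variable {p : ℕ} {θ : Fin p → ℝ} {b : Fin p → ℝ → P2 → ℝ}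

/-- Lipschitz continuity with constant `L` and boundedness by `K` at `(0, δ₀)` of a drift. -/
structure IsRegularDrift (L K : ℝ) (f : ℝ → P2 → ℝ) : Prop where
  L_nonneg : 0 ≤ L
  K_nonneg : 0 ≤ K
  lipschitz : ∀ x y μ ν, |f x μ - f y ν| ≤ L * (|x - y| + W2 μ ν)
  bound_zero : |f 0 diracZero| ≤ K

theorem exists_isRegularDrift (hLip : LipschitzDrift b) (hBdd : BoundedAtZero b)
    (θ : Fin p → ℝ) : ∃ L K, IsRegularDrift L K (drift θ b) := by
  obtain ⟨c, hc, hLip⟩ := hLip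
  obtain ⟨k, hk, hBdd⟩ := hBdd
  refine ⟨(∑ m, |θ m|) * c, (∑ m, |θ m|) * k, by positivity, by positivity, ?_, ?_⟩
  · intro x y μ ν
    rw [drift, drift, ← Finset.sum_sub_distrib, Finset.sum_mul, Finset.sum_mul]
    refine (Finset.abs_sum_le_sum_abs _ _).trans (Finset.sum_le_sum fun m _ => ?_)
    rw [← mul_sub, abs_mul, mul_assoc]
    gcongr
    exact hLip m x y μ ν
  · rw [drift, Finset.sum_mul]
    refine (Finset.abs_sum_le_sum_abs _ _).trans (Finset.sum_le_sum fun m _ => ?_)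
    rw [abs_mul]
    gcongr
    exact hBdd m

theorem IsRegularDrift.abs_le {L K : ℝ} {f : ℝ → P2 → ℝ} (hf : IsRegularDrift L K f) (x : ℝ)
    (μ : P2) : |f x μ| ≤ K + L * (|x| + W2 μ diracZero) := by
  have h1 := hf.lipschitz x 0 μ diracZero
  rw [sub_zero] at h1
  have h2 : f x μ = f 0 diracZero + (f x μ - f 0 diracZero) := by ring
  rw [h2]
  exact (abs_add_le _ _).trans (add_le_add hf.bound_zero h1)

theorem IsRegularDrift.abs_sub_le {L K : ℝ} {f : ℝ → P2 → ℝ} (hf : IsRegularDrift L K f)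
    (x y : ℝ) (μ : P2) : |f x μ - f y μ| ≤ L * |x - y| := by
  simpa [W2_self] using hf.lipschitz x y μ μ

end Drift

/-! ### A priori estimates for solutions of the McKean–Vlasov equation. -/

section Solutions

variable {Ω : Type*} [MeasurableSpace Ω] {P : Measure Ω}

theorem W2_le_sqrt_integral_sq {U V : Ω → ℝ} {μ ν : P2} (hU : AEMeasurable U P)
    (hV : AEMeasurable V P) (hUμ : P.map U = μ.1) (hVν : P.map V = ν.1)
    (hi : Integrable (fun ω => (U ω - V ω) ^ 2) P) :
    W2 μ ν ≤ Real.sqrt (∫ ω, (U ω - V ω) ^ 2 ∂P) := by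
  refine W2_le_of_sq_le (Real.sqrt_nonneg _) ?_
  rw [Real.sq_sqrt (integral_nonneg fun ω => sq_nonneg _), ← hUμ, ← hVν,
    ofReal_integral_eq_lintegral_ofReal hi (ae_of_all _ fun ω => sq_nonneg _)]
  refine (wasserstein_two_sq_map_le hU hV).trans_eq (lintegral_congr fun ω => ?_)
  rw [← sq_abs, ENNReal.ofReal_pow (abs_nonneg _), Real.enorm_eq_ofReal_abs]

variable {p : ℕ} {θ : Fin p → ℝ} {b : Fin p → ℝ → P2 → ℝ} {T σ L K : ℝ} {ξ : Ω → ℝ}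
  {B Y : ℝ → Ω → ℝ} {μ : ℝ → P2} {β : Ω → ℝ}

/-- Paths of a solution are controlled by the input and the second moments of the laws. -/
theorem IsMcKeanVlasovSolution.abs_le_of_W2_le
    (hY : IsMcKeanVlasovSolution T σ θ b P ξ B Y μ) (hf : IsRegularDrift L K (drift θ b))
    (hσ : 0 ≤ σ) (hβ : ∀ᵐ ω ∂P, ∀ t ∈ Set.Icc 0 T, |B t ω| ≤ β ω) {n : ℝ → ℝ}
    (hn : ContinuousOn n (Set.Icc 0 T)) (hn0 : ∀ t ∈ Set.Icc 0 T, 0 ≤ n t)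
    (hμn : ∀ t ∈ Set.Icc 0 T, W2 (μ t) diracZero ≤ n t) :
    ∀ᵐ ω ∂P, ∀ t ∈ Set.Icc 0 T, |Y t ω| ≤
      Real.exp (L * T) * (|ξ ω| + σ * β ω + K * T + L * ∫ s in (0 : ℝ)..t, n s) := by
  filter_upwards [hY.continuous_paths, hY.integrable, hY.equation, hβ] with ω hc hi he hb τ hτ
  have hL := hf.L_nonneg
  have hK := hf.K_nonneg
  have hT : (0 : ℝ) ≤ T := hτ.1.trans hτ.2
  have hβ0 : 0 ≤ β ω := (abs_nonneg _).trans (hb τ hτ)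
  have hnint : ∀ s ∈ Set.Icc 0 T, ∀ t ∈ Set.Icc 0 T, IntervalIntegrable n volume s t :=
    fun s hs t ht => (hn.mono (Set.uIcc_subset_Icc hs ht)).intervalIntegrable
  have h0T : (0 : ℝ) ∈ Set.Icc 0 T := ⟨le_rfl, hT⟩
  -- The horizon τ is frozen: as `n` is nonnegative, its integral up to τ dominates the integral up
  -- to any earlier time, so the forcing is constant and Grönwall applies on [0, τ].
  set a := |ξ ω| + σ * β ω + K * T + L * ∫ s in (0 : ℝ)..τ, n s with ha
  have hstep : ∀ t ∈ Set.Icc 0 τ, |Y t ω| ≤ a + L * ∫ s in (0 : ℝ)..t, |Y s ω| := by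
    intro t ht
    have htT : t ∈ Set.Icc 0 T := ⟨ht.1, ht.2.trans hτ.2⟩
    have h1 := abs_sub_le_add_integral (y := fun t => Y t ω) (z := fun _ => 0) (g := fun _ => 0)
      (c := fun t => ξ ω + σ * B t ω) (d := fun _ => 0) (a := |ξ ω| + σ * β ω)
      (h := fun s => K + L * (|Y s ω| + n s)) hi (by simp)
      (continuousOn_const.add (continuousOn_const.mul (hc.abs.add hn))) htT
      (fun s hs => by
        rw [sub_zero]
        refine (hf.abs_le _ _).trans ?_
        gcongr
        exact hμn s hs)
      (by rw [he t htT]; ring) (by simp)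
      (by
        rw [sub_zero]
        refine (abs_add_le _ _).trans ?_
        rw [abs_mul, abs_of_nonneg hσ]
        gcongr
        exact hb t htT)
    have iY : IntervalIntegrable (fun s => |Y s ω|) volume 0 t :=
      (hc.abs.mono (Set.Icc_subset_Icc_right htT.2)).intervalIntegrable_of_Icc ht.1
    have iN := hnint 0 h0T t htT
    rw [sub_zero, intervalIntegral.integral_add (by simp) ((iY.add iN).const_mul L),
      intervalIntegral.integral_const_mul, intervalIntegral.integral_add iY iN,
      intervalIntegral.integral_const, smul_eq_mul, sub_zero] at h1
    have h2 : ∫ s in (0 : ℝ)..t, n s ≤ ∫ s in (0 : ℝ)..τ, n s := by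
      rw [← intervalIntegral.integral_add_adjacent_intervals iN (hnint t htT τ hτ)]
      have : 0 ≤ ∫ s in t..τ, n s := intervalIntegral.integral_nonneg ht.2
        fun s hs => hn0 s ⟨ht.1.trans hs.1, hs.2.trans hτ.2⟩
      linarith
    have h3 : t * K ≤ K * T := by rw [mul_comm]; gcongr; exact htT.2
    have h4 := mul_le_mul_of_nonneg_left h2 hL
    rw [ha]
    linarith
  have hres := le_mul_exp_of_le_add_integral hL
    (hc.abs.mono (Set.Icc_subset_Icc_right hτ.2)) hstep τ ⟨hτ.1, le_rfl⟩
  have ha0 : 0 ≤ a := by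
    have : 0 ≤ ∫ s in (0 : ℝ)..τ, n s := intervalIntegral.integral_nonneg hτ.1
      fun s hs => hn0 s ⟨hs.1, hs.2.trans hτ.2⟩
    positivity
  refine hres.trans ?_
  rw [mul_comm]
  gcongr
  exact hτ.2

variable [IsProbabilityMeasure P]

theorem W2_diracZero_le_sqrt_integral_sq {U : Ω → ℝ} {μ : P2} (hU : AEMeasurable U P)
    (hUμ : P.map U = μ.1) (hi : Integrable (fun ω => U ω ^ 2) P) :
    W2 μ diracZero ≤ Real.sqrt (∫ ω, U ω ^ 2 ∂P) := by
  have h := W2_le_sqrt_integral_sq (P := P) (U := U) (V := fun _ => 0) (ν := diracZero) hU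
    aemeasurable_const hUμ (by simp [diracZero]) (by simpa using hi)
  simpa using h

/-- Paths of a solution are controlled by the input, up to an additive constant. -/
theorem IsMcKeanVlasovSolution.exists_abs_le
    (hY : IsMcKeanVlasovSolution T σ θ b P ξ B Y μ) (hf : IsRegularDrift L K (drift θ b))
    (hσ : 0 ≤ σ) (hβ : ∀ᵐ ω ∂P, ∀ t ∈ Set.Icc 0 T, |B t ω| ≤ β ω) :
    ∃ k : ℝ, ∀ᵐ ω ∂P, ∀ t ∈ Set.Icc 0 T,
      |Y t ω| ≤ k + Real.exp (L * T) * (|ξ ω| + σ * β ω) := by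
  have hall := hY.continuous_paths.and (hY.integrable.and (hY.equation.and hβ))
  -- One good path serves as reference. Both paths see the same flow `μ`, so the W₂ terms cancel and
  -- no moment of the solution is needed. The price is a constant depending on the solution,
  -- harmless because only finiteness and continuity are drawn from it.
  obtain ⟨ω₀, hc₀, hi₀, he₀, hb₀⟩ := hall.exists
  obtain ⟨k, hk⟩ := isCompact_Icc.exists_bound_of_continuousOn hc₀
  refine ⟨k + (|ξ ω₀| + σ * β ω₀) * Real.exp (L * T), ?_⟩
  filter_upwards [hall] with ω ⟨hc, hi, he, hb⟩ t ht
  have hT : (0 : ℝ) ≤ T := ht.1.trans ht.2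
  have hdiff : |Y t ω - Y t ω₀| ≤
      (|ξ ω| + σ * β ω + (|ξ ω₀| + σ * β ω₀)) * Real.exp (L * t) := by
    refine abs_sub_le_mul_exp (c := fun t => ξ ω + σ * B t ω) (d := fun t => ξ ω₀ + σ * B t ω₀)
      hf.L_nonneg hc hc₀ hi hi₀ (fun s _ => hf.abs_sub_le _ _ _)
      (fun t ht => by rw [he t ht]; ring) (fun t ht => by rw [he₀ t ht]; ring)
      (fun t ht => ?_) t ht
    have key : ∀ ω, |B t ω| ≤ β ω → |ξ ω + σ * B t ω| ≤ |ξ ω| + σ * β ω := fun ω h => by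
      refine (abs_add_le _ _).trans ?_
      rw [abs_mul, abs_of_nonneg hσ]
      gcongr
    exact (abs_sub _ _).trans (add_le_add (key ω (hb t ht)) (key ω₀ (hb₀ t ht)))
  have hβ0 : ∀ ω, |B t ω| ≤ β ω → 0 ≤ |ξ ω| + σ * β ω := fun ω h => by
    have := (abs_nonneg _).trans h
    positivity
  have hexp : Real.exp (L * t) ≤ Real.exp (L * T) :=
    Real.exp_le_exp.2 (mul_le_mul_of_nonneg_left ht.2 hf.L_nonneg)
  have h1 : |Y t ω| ≤ |Y t ω₀| + |Y t ω - Y t ω₀| := by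
    have := abs_add_le (Y t ω₀) (Y t ω - Y t ω₀)
    simpa using this
  have h2 := mul_le_mul_of_nonneg_left hexp
    (add_nonneg (hβ0 ω (hb t ht)) (hβ0 ω₀ (hb₀ t ht)))
  have h3 : |Y t ω₀| ≤ k := hk t ht
  linarith

/-- The second moment of a solution is finite and continuous in time. -/
theorem IsMcKeanVlasovSolution.continuousOn_integral_sq
    (hY : IsMcKeanVlasovSolution T σ θ b P ξ B Y μ) (hf : IsRegularDrift L K (drift θ b))
    (hσ : 0 ≤ σ) (hβ : ∀ᵐ ω ∂P, ∀ t ∈ Set.Icc 0 T, |B t ω| ≤ β ω)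
    (hξ2 : MemLp ξ 2 P) (hβ2 : MemLp β 2 P) :
    (∀ t ∈ Set.Icc 0 T, MemLp (Y t) 2 P) ∧
    (∀ V : Ω → ℝ, MemLp V 2 P →
      ContinuousOn (fun t => ∫ ω, (Y t ω - V ω) ^ 2 ∂P) (Set.Icc 0 T)) := by
  obtain ⟨k, hk⟩ := hY.exists_abs_le hf hσ hβ
  set Z : Ω → ℝ := fun ω => k + Real.exp (L * T) * (|ξ ω| + σ * β ω)
  have hZ : MemLp Z 2 P := (memLp_const k).add ((hξ2.abs.add (hβ2.const_mul σ)).const_mul _)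
  have hYm : ∀ t ∈ Set.Icc 0 T, MemLp (Y t) 2 P := fun t ht =>
    hZ.mono' (hY.aemeasurable t ht).aestronglyMeasurable (hk.mono fun ω h => h t ht)
  refine ⟨hYm, fun V hV => ?_⟩
  have hbound : Integrable (fun ω => 2 * Z ω ^ 2 + 2 * V ω ^ 2) P :=
    (hZ.integrable_sq.const_mul 2).add (hV.integrable_sq.const_mul 2)
  refine continuousOn_of_dominated (bound := fun ω => 2 * Z ω ^ 2 + 2 * V ω ^ 2)
    (fun t ht => ((hYm t ht).sub hV).integrable_sq.aestronglyMeasurable) ?_ hbound ?_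
  · intro t ht
    filter_upwards [hk] with ω h
    rw [Real.norm_of_nonneg (sq_nonneg _)]
    have := sq_le_sq' (abs_le.1 (h t ht)).1 (abs_le.1 (h t ht)).2
    nlinarith [sq_nonneg (Y t ω + V ω)]
  · filter_upwards [hY.continuous_paths] with ω h
    exact (h.sub continuousOn_const).pow 2

/-- A bound of the second moment of a solution in terms of that of the input. -/
theorem IsMcKeanVlasovSolution.integral_sq_le
    (hY : IsMcKeanVlasovSolution T σ θ b P ξ B Y μ) (hf : IsRegularDrift L K (drift θ b))
    (hσ : 0 ≤ σ) (hβ : ∀ᵐ ω ∂P, ∀ t ∈ Set.Icc 0 T, |B t ω| ≤ β ω)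
    (hξ2 : MemLp ξ 2 P) (hβ2 : MemLp β 2 P) {A : ℝ}
    (hA : ∫ ω, (|ξ ω| + σ * β ω + K * T) ^ 2 ∂P ≤ A) :
    ∀ t ∈ Set.Icc 0 T, ∫ ω, Y t ω ^ 2 ∂P ≤
      2 * Real.exp (L * T) ^ 2 * A * Real.exp (2 * Real.exp (L * T) ^ 2 * L ^ 2 * T * t) := by
  intro τ hτ
  have hT : (0 : ℝ) ≤ T := hτ.1.trans hτ.2
  obtain ⟨hY2, hcont⟩ := hY.continuousOn_integral_sq hf hσ hβ hξ2 hβ2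
  have hM : ContinuousOn (fun t => ∫ ω, Y t ω ^ 2 ∂P) (Set.Icc 0 T) := by
    simpa using hcont (fun _ => 0) MemLp.zero'
  have hM0 : ∀ t, 0 ≤ ∫ ω, Y t ω ^ 2 ∂P := fun t => integral_nonneg fun ω => sq_nonneg _
  have hsqrt : ContinuousOn (fun t => Real.sqrt (∫ ω, Y t ω ^ 2 ∂P)) (Set.Icc 0 T) := hM.sqrt
  have hb := hY.abs_le_of_W2_le hf hσ hβ hsqrt (fun t _ => Real.sqrt_nonneg _) (fun t ht =>
    W2_diracZero_le_sqrt_integral_sq (hY.aemeasurable t ht) (hY.law t ht) (hY2 t ht).integrable_sq)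
  refine le_mul_exp_of_le_add_integral (by positivity) hM (fun t ht => ?_) τ hτ
  set e := Real.exp (L * T)
  set I := ∫ s in (0 : ℝ)..t, Real.sqrt (∫ ω, Y s ω ^ 2 ∂P)
  have hZ : MemLp (fun ω => |ξ ω| + σ * β ω + K * T) 2 P :=
    (hξ2.abs.add (hβ2.const_mul σ)).add (memLp_const _)
  -- Cauchy–Schwarz in time makes the estimate linear in the second moment, so that Grönwall closes.
  have hI : I ^ 2 ≤ T * ∫ s in (0 : ℝ)..t, ∫ ω, Y s ω ^ 2 ∂P := by
    have h1 := sq_integral_le_mul_integral_sq ht.1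
      (hsqrt.mono (Set.Icc_subset_Icc_right ht.2))
    have h2 : ∀ s, Real.sqrt (∫ ω, Y s ω ^ 2 ∂P) ^ 2 = ∫ ω, Y s ω ^ 2 ∂P := fun s =>
      Real.sq_sqrt (hM0 s)
    simp_rw [h2] at h1
    refine h1.trans (mul_le_mul_of_nonneg_right ht.2 ?_)
    exact intervalIntegral.integral_nonneg ht.1 fun s _ => hM0 s
  have hpt : ∀ᵐ ω ∂P, Y t ω ^ 2 ≤
      2 * e ^ 2 * (|ξ ω| + σ * β ω + K * T) ^ 2 + 2 * e ^ 2 * L ^ 2 * I ^ 2 := by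
    filter_upwards [hb] with ω h
    have h1 := h t ht
    have h2 := sq_le_sq' (by linarith [(abs_le.1 h1).1]) (abs_le.1 h1).2
    refine h2.trans ?_
    nlinarith [sq_nonneg (e * (|ξ ω| + σ * β ω + K * T) - e * (L * I))]
  have h1 := integral_mono_ae (hY2 t ht).integrable_sq
    ((hZ.integrable_sq.const_mul (2 * e ^ 2)).add (integrable_const (2 * e ^ 2 * L ^ 2 * I ^ 2)))
    hpt
  simp only [Pi.add_apply] at h1
  rw [integral_add (hZ.integrable_sq.const_mul _) (integrable_const _), integral_const_mul] at h1
  simp only [integral_const, probReal_univ, one_smul] at h1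
  calc ∫ ω, Y t ω ^ 2 ∂P ≤ _ := h1
    _ ≤ 2 * e ^ 2 * A + 2 * e ^ 2 * L ^ 2 * (T * ∫ s in (0 : ℝ)..t, ∫ ω, Y s ω ^ 2 ∂P) := by
      gcongr
    _ = _ := by ring

end Solutions

/-! ### Moment bounds uniform over all solutions. -/

section UniformBounds

theorem add_add_pow_le (x y z : ℝ≥0∞) (r : ℕ) :
    (x + y + z) ^ r ≤ 3 ^ r * (x ^ r + y ^ r + z ^ r) := by
  set m := max x (max y z)
  have h1 : x + y + z ≤ 3 * m := by
    calc x + y + z ≤ m + m + m := by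
          gcongr <;> simp [m]
      _ = 3 * m := by ring
  have h2 : m ^ r ≤ x ^ r + y ^ r + z ^ r := by
    rcases max_choice x (max y z) with h | h
    · simp only [m, h]; exact le_self_add.trans le_self_add
    · rcases max_choice y z with h' | h' <;> simp only [m, h, h']
      · exact le_add_self.trans le_self_add
      · exact le_add_self
  calc (x + y + z) ^ r ≤ (3 * m) ^ r := by gcongr
    _ = 3 ^ r * m ^ r := mul_pow _ _ _
    _ ≤ _ := by gcongr

variable {Ω : Type*} [MeasurableSpace Ω] {P : Measure Ω}

theorem memLp_of_lintegral_pow_ne_top {E : Type*} [NormedAddCommGroup E] {f : Ω → E}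
    (hf : AEStronglyMeasurable f P) {r : ℕ} (hr : r ≠ 0) (h : ∫⁻ ω, ‖f ω‖ₑ ^ r ∂P ≠ ∞) :
    MemLp f r P := by
  refine ⟨hf, ?_⟩
  rw [eLpNorm_lt_top_iff_lintegral_rpow_enorm_lt_top (by exact_mod_cast hr) (by simp)]
  simpa using h.lt_top

theorem lintegral_pow_le_one_add [IsProbabilityMeasure P] {f : Ω → ℝ≥0∞} {j r : ℕ}
    (hjr : j ≤ r) : ∫⁻ ω, f ω ^ j ∂P ≤ 1 + ∫⁻ ω, f ω ^ r ∂P := by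
  calc ∫⁻ ω, f ω ^ j ∂P ≤ ∫⁻ ω, (1 + f ω ^ r) ∂P := by
        refine lintegral_mono fun ω => ?_
        rcases le_total (f ω) 1 with h | h
        · exact (pow_le_one₀ bot_le h).trans le_self_add
        · exact (pow_le_pow_right₀ h hjr).trans le_add_self
    _ = _ := by rw [lintegral_add_left measurable_const]; simp

theorem lintegral_enorm_pow_ne_top {μ₀ : Measure ℝ} [IsProbabilityMeasure μ₀]
    (h : FiniteMoments μ₀) (r : ℕ) : ∫⁻ x, ‖x‖ₑ ^ r ∂μ₀ ≠ ∞ := by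
  rcases eq_or_ne r 0 with rfl | hr
  · simp
  · have h1 := (h r (Nat.one_le_iff_ne_zero.2 hr)).2
    refine ne_top_of_le_ne_top h1.ne (lintegral_mono fun x => ?_)
    simp [enorm_pow]

theorem integral_sq_le_of_lintegral_pow_le [IsProbabilityMeasure P] {f : Ω → ℝ}
    (hf : AEMeasurable f P) {r : ℕ} (hr : 2 ≤ r) {C : ℝ≥0∞} (hC : C ≠ ∞)
    (h : ∫⁻ ω, ‖f ω‖ₑ ^ r ∂P ≤ C) : MemLp f 2 P ∧ ∫ ω, f ω ^ 2 ∂P ≤ (1 + C).toReal := by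
  have h2 : ∫⁻ ω, ‖f ω‖ₑ ^ 2 ∂P ≤ 1 + C := (lintegral_pow_le_one_add hr).trans (by gcongr)
  have hC' : 1 + C ≠ ∞ := by simpa using hC
  have hm : MemLp f 2 P := by
    exact_mod_cast memLp_of_lintegral_pow_ne_top hf.aestronglyMeasurable two_ne_zero
      (ne_top_of_le_ne_top hC' h2)
  refine ⟨hm, ?_⟩
  rw [integral_eq_lintegral_of_nonneg_ae (ae_of_all _ fun ω => sq_nonneg _)
    hm.integrable_sq.aestronglyMeasurable]
  refine ENNReal.toReal_mono hC' (le_trans (lintegral_mono fun ω => ?_) h2)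
  rw [← sq_abs, ENNReal.ofReal_pow (abs_nonneg _), Real.enorm_eq_ofReal_abs]

/-- Moment bounds and path increments of solutions, uniformly over all solutions. -/
theorem exists_uniform_bound {p : ℕ} {θ : Fin p → ℝ} {b : Fin p → ℝ → P2 → ℝ}
    {H T σ L K : ℝ} (hf : IsRegularDrift L K (drift θ b)) (hH : 0 < H) (hT : 0 < T)
    (hσ : 0 ≤ σ) {μ₀ : Measure ℝ} [IsProbabilityMeasure μ₀] (hμ₀ : FiniteMoments μ₀)
    {r : ℕ} (hr : 3 ≤ H * r) (hr2 : 2 ≤ r) :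
    ∃ C : ℝ≥0∞, C ≠ ∞ ∧ ∀ (Ω : Type*) [MeasurableSpace Ω] (P : Measure Ω)
      [IsProbabilityMeasure P] (ξ : Ω → ℝ) (B Y : ℝ → Ω → ℝ) (μ : ℝ → P2),
      Measurable ξ → P.map ξ = μ₀ → IsFractionalBrownianMotion H T P B →
      IsMcKeanVlasovSolution T σ θ b P ξ B Y μ →
      ∃ Λ : Ω → ℝ, AEMeasurable Λ P ∧ (∀ ω, 1 ≤ Λ ω) ∧ ∫⁻ ω, ‖Λ ω‖ₑ ^ r ∂P ≤ C ∧
        ∀ᵐ ω ∂P, (∀ t ∈ Set.Icc 0 T, |Y t ω| ≤ Λ ω) ∧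
          ∀ s ∈ Set.Icc 0 T, ∀ t ∈ Set.Icc 0 T,
            |Y t ω - Y s ω| ≤ Λ ω * |t - s| + σ * |B t ω - B s ω| := by
  have hL := hf.L_nonneg
  have hK := hf.K_nonneg
  set X₀ : ℝ≥0∞ := ∫⁻ x, ‖x‖ₑ ^ r ∂μ₀ with hX₀
  have hX₀top : X₀ ≠ ∞ := lintegral_enorm_pow_ne_top hμ₀ r
  set F₀ : ℝ≥0∞ := fbmMaxConst H T r with hF₀
  have hF₀top : F₀ ≠ ∞ := fbmMaxConst_ne_top H T (by omega)
  set e := Real.exp (L * T) with he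
  -- The 3 comes from (x + y + z)² ≤ 3(x² + y² + z²); each second moment is dominated by 1 plus the
  -- moment of order `r`.
  set A : ℝ := 3 * ((1 + X₀).toReal + σ ^ 2 * (1 + F₀).toReal + (K * T) ^ 2) with hA
  set M : ℝ := 2 * e ^ 2 * A * Real.exp (2 * e ^ 2 * L ^ 2 * T * T) with hM
  have hA0 : 0 ≤ A := by positivity
  -- Coefficients of Λ, chosen as 1 plus the bound of |Y| plus the bound of the drift: a single Λ ≥
  -- 1 controls both the size and the Lipschitz part of the increments.
  set a₀ : ℝ := 1 + K + L * Real.sqrt M + (1 + L) * (e * (K * T + L * (T * Real.sqrt M))) with ha₀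
  set a₁ : ℝ := (1 + L) * e with ha₁
  have ha₀0 : 0 ≤ a₀ := by positivity
  have ha₁0 : 0 ≤ a₁ := by positivity
  refine ⟨3 ^ r * (ENNReal.ofReal a₀ ^ r + ENNReal.ofReal a₁ ^ r * X₀ +
    ENNReal.ofReal (a₁ * σ) ^ r * F₀), by finiteness, ?_⟩
  intro Ω _ P _ ξ B Y μ hξ hξμ hB hY
  obtain ⟨β, hβm, hβ0, hβ, hβr⟩ := hB.exists_bound hH hT hr
  have hξr : ∫⁻ ω, ‖ξ ω‖ₑ ^ r ∂P = X₀ := by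
    rw [hX₀, ← hξμ, lintegral_map (by fun_prop) hξ]
  obtain ⟨hξ2, hξ2'⟩ := integral_sq_le_of_lintegral_pow_le hξ.aemeasurable hr2 hX₀top hξr.le
  obtain ⟨hβ2, hβ2'⟩ := integral_sq_le_of_lintegral_pow_le hβm hr2 hF₀top hβr
  have hAle : ∫ ω, (|ξ ω| + σ * β ω + K * T) ^ 2 ∂P ≤ A := by
    have hZ : MemLp (fun ω => |ξ ω| + σ * β ω + K * T) 2 P :=
      (hξ2.abs.add (hβ2.const_mul σ)).add (memLp_const _)
    have i1 : Integrable (fun ω => ξ ω ^ 2 + σ ^ 2 * β ω ^ 2) P :=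
      hξ2.integrable_sq.add (hβ2.integrable_sq.const_mul _)
    have h1 : ∫ ω, (|ξ ω| + σ * β ω + K * T) ^ 2 ∂P ≤
        ∫ ω, 3 * (ξ ω ^ 2 + σ ^ 2 * β ω ^ 2 + (K * T) ^ 2) ∂P := by
      refine integral_mono hZ.integrable_sq ((i1.add (integrable_const _)).const_mul 3)
        fun ω => ?_
      simp only
      nlinarith [sq_abs (ξ ω), sq_nonneg (|ξ ω| - σ * β ω), sq_nonneg (|ξ ω| - K * T),
        sq_nonneg (σ * β ω - K * T)]
    rw [integral_const_mul, integral_add i1 (integrable_const _),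
      integral_add hξ2.integrable_sq (hβ2.integrable_sq.const_mul _), integral_const_mul] at h1
    simp only [integral_const, probReal_univ, one_smul] at h1
    refine h1.trans ?_
    rw [hA]
    gcongr
  have hY2 := (hY.continuousOn_integral_sq hf hσ hβ hξ2 hβ2).1
  have hMle : ∀ t ∈ Set.Icc 0 T, W2 (μ t) diracZero ≤ Real.sqrt M := by
    intro t ht
    refine (W2_diracZero_le_sqrt_integral_sq (hY.aemeasurable t ht) (hY.law t ht)
      (hY2 t ht).integrable_sq).trans (Real.sqrt_le_sqrt ?_)
    refine (hY.integral_sq_le hf hσ hβ hξ2 hβ2 hAle t ht).trans ?_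
    rw [hM]
    gcongr
    exact ht.2
  have hYb := hY.abs_le_of_W2_le hf hσ hβ (n := fun _ => Real.sqrt M) continuousOn_const
    (fun _ _ => Real.sqrt_nonneg _) hMle
  refine ⟨fun ω => a₀ + a₁ * |ξ ω| + a₁ * σ * β ω, by fun_prop, fun ω => ?_, ?_, ?_⟩
  · have h1 : 1 ≤ a₀ := by
      have : 0 ≤ K + L * Real.sqrt M + (1 + L) * (e * (K * T + L * (T * Real.sqrt M))) := by
        positivity
      rw [ha₀]; linarith
    have h2 : 0 ≤ a₁ * |ξ ω| := by positivity
    have h3 : 0 ≤ a₁ * σ * β ω := mul_nonneg (by positivity) (hβ0 ω)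
    linarith
  · calc ∫⁻ ω, ‖a₀ + a₁ * |ξ ω| + a₁ * σ * β ω‖ₑ ^ r ∂P
        ≤ ∫⁻ ω, 3 ^ r * (ENNReal.ofReal a₀ ^ r + ENNReal.ofReal a₁ ^ r * ‖ξ ω‖ₑ ^ r +
            ENNReal.ofReal (a₁ * σ) ^ r * ‖β ω‖ₑ ^ r) ∂P := by
          refine lintegral_mono fun ω => ?_
          refine le_trans (pow_le_pow_left' ((enorm_add_le _ _).trans
            (add_le_add (enorm_add_le _ _) le_rfl)) r) ?_
          refine (add_add_pow_le _ _ _ r).trans_eq ?_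
          rw [enorm_mul, enorm_mul (a₁ * σ), Real.enorm_of_nonneg ha₀0, Real.enorm_of_nonneg ha₁0,
            Real.enorm_of_nonneg (mul_nonneg ha₁0 hσ), Real.enorm_abs, mul_pow,
            mul_pow]
      _ = 3 ^ r * (ENNReal.ofReal a₀ ^ r + ENNReal.ofReal a₁ ^ r * X₀ +
            ENNReal.ofReal (a₁ * σ) ^ r * ∫⁻ ω, ‖β ω‖ₑ ^ r ∂P) := by
          rw [lintegral_const_mul'' _ (by fun_prop), lintegral_add_left' (by fun_prop),
            lintegral_add_left' (by fun_prop), lintegral_const_mul'' _ (by fun_prop),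
            lintegral_const_mul'' _ (by fun_prop), hξr]
          simp
      _ ≤ _ := by gcongr
  · filter_upwards [hYb, hY.integrable, hY.equation] with ω h hi heq
    have hb0 := hβ0 ω
    have hb : ∀ t ∈ Set.Icc 0 T, |Y t ω| ≤
        e * (|ξ ω| + σ * β ω + K * T + L * (T * Real.sqrt M)) := by
      intro t ht
      refine (h t ht).trans ?_
      rw [intervalIntegral.integral_const, smul_eq_mul, sub_zero]
      gcongr
      exact ht.2
    have hdr : ∀ t ∈ Set.Icc 0 T, |drift θ b (Y t ω) (μ t)| ≤
        a₀ + a₁ * |ξ ω| + a₁ * σ * β ω := by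
      intro t ht
      refine (hf.abs_le _ _).trans ?_
      have h1 := hb t ht
      have h2 := hMle t ht
      calc K + L * (|Y t ω| + W2 (μ t) diracZero) ≤ K + L * (e * (|ξ ω| + σ * β ω + K * T +
            L * (T * Real.sqrt M)) + Real.sqrt M) := by gcongr
        _ ≤ _ := by
          have : 0 ≤ 1 + e * (|ξ ω| + σ * β ω + K * T + L * (T * Real.sqrt M)) := by positivity
          rw [ha₀, ha₁]
          linarith
    refine ⟨fun t ht => (hb t ht).trans ?_, fun s hs t ht => ?_⟩
    · have : 0 ≤ 1 + K + L * Real.sqrt M +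
          L * (e * (|ξ ω| + σ * β ω + K * T + L * (T * Real.sqrt M))) := by positivity
      rw [ha₀, ha₁]
      linarith
    · have hint : ∀ t ∈ Set.Icc 0 T,
          IntervalIntegrable (fun s => drift θ b (Y s ω) (μ s)) volume 0 t := fun t ht =>
        hi.mono_set (by
          rw [Set.uIcc_of_le ht.1, Set.uIcc_of_le hT.le]; exact Set.Icc_subset_Icc_right ht.2)
      have h1 : Y t ω - Y s ω =
          (∫ u in s..t, drift θ b (Y u ω) (μ u)) + σ * (B t ω - B s ω) := by
        rw [← intervalIntegral.integral_interval_sub_left (hint t ht) (hint s hs), heq t ht,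
          heq s hs]
        ring
      have h2 : ‖∫ u in s..t, drift θ b (Y u ω) (μ u)‖ ≤
          (a₀ + a₁ * |ξ ω| + a₁ * σ * β ω) * |t - s| :=
        intervalIntegral.norm_integral_le_of_norm_le_const fun u hu =>
          hdr u (Set.uIcc_subset_Icc hs ht (Set.uIoc_subset_uIcc hu))
      rw [h1]
      refine (abs_add_le _ _).trans (add_le_add h2 ?_)
      rw [abs_mul, abs_of_nonneg hσ]

end UniformBounds

/-! ### Euler schemes as measurable functionals of the input. -/

section Euler

/-- The explicit Euler scheme with step `h` for `dy = g(y, s) ds + dw`, started at `x + w 0`. -/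
def eulerScheme (g : ℝ → ℝ → ℝ) (h x : ℝ) (w : ℝ → ℝ) : ℕ → ℝ
  | 0 => x + w 0
  | k + 1 => eulerScheme g h x w k + h * g (eulerScheme g h x w k) (k * h) +
      (w ((k + 1) * h) - w (k * h))

/-- The noise is additive and its increments enter the scheme exactly, so they cancel in the error
and no regularity of `w` is required. Only freezing the drift over one step costs anything, and
uniform continuity of the drift along the solution controls that. -/
theorem tendsto_eulerScheme {g : ℝ → ℝ → ℝ} {L t x : ℝ} {y w : ℝ → ℝ} (hL : 0 ≤ L)
    (ht : 0 ≤ t) (hg : ∀ s x y, |g x s - g y s| ≤ L * |x - y|)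
    (hgc : ContinuousOn (fun s => g (y s) s) (Set.Icc 0 t))
    (hy : ∀ s ∈ Set.Icc 0 t, y s = x + (∫ u in (0 : ℝ)..s, g (y u) u) + w s) :
    Filter.Tendsto (fun n : ℕ => eulerScheme g (t / n) x w n) Filter.atTop (nhds (y t)) := by
  have hC : 0 ≤ t * Real.exp (L * t) := by positivity
  rw [Metric.tendsto_atTop]
  intro ε hε
  -- The accumulated error will be at most t exp(Lt) η; the extra 1 gives strict inequality and
  -- covers t = 0.
  set η : ℝ := ε / (t * Real.exp (L * t) + 1) with hη
  have hη0 : 0 < η := by positivity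
  obtain ⟨δ, hδ, hδg⟩ := Metric.uniformContinuousOn_iff_le.1
    (isCompact_Icc.uniformContinuousOn_of_continuous hgc) η hη0
  obtain ⟨n₀, hn₀⟩ := exists_nat_gt (t / δ)
  refine ⟨n₀ + 1, fun n hn => ?_⟩
  have hn0 : (0 : ℝ) < n := by exact_mod_cast (by omega : 0 < n)
  set h : ℝ := t / n with hh
  have hh0 : 0 ≤ h := by positivity
  have hhδ : h ≤ δ := by
    rw [hh, div_le_iff₀ hn0, ← div_le_iff₀' hδ]
    exact hn₀.le.trans (by exact_mod_cast (by omega : n₀ ≤ n))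
  have hnh : n * h = t := by rw [hh]; field_simp
  have hmem : ∀ k : ℕ, k ≤ n → (k : ℝ) * h ∈ Set.Icc 0 t := fun k hk => by
    refine ⟨by positivity, ?_⟩
    rw [← hnh]
    gcongr
  -- One step multiplies the error by at most 1 + hL and adds at most hη.
  have herr : ∀ k : ℕ, k ≤ n →
      |eulerScheme g h x w k - y (k * h)| ≤ k * h * η * (1 + h * L) ^ k := by
    intro k
    induction k with
    | zero =>
      intro _
      have := hy 0 ⟨le_rfl, ht⟩
      simp only [intervalIntegral.integral_same, add_zero] at this
      simp [eulerScheme, this]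
    | succ k ih =>
      intro hk
      have hk1 := hmem k (by omega)
      have hk2 := hmem (k + 1) hk
      have ih := ih (by omega)
      set e := eulerScheme g h x w k
      push_cast at hk2 ⊢
      have hint : ∀ s ∈ Set.Icc 0 t, ∀ s' ∈ Set.Icc 0 t,
          IntervalIntegrable (fun u => g (y u) u) volume s s' := fun s hs s' hs' =>
        (hgc.mono (Set.uIcc_subset_Icc hs hs')).intervalIntegrable
      have h0 : (0 : ℝ) ∈ Set.Icc 0 t := ⟨le_rfl, ht⟩
      have hlen : ((k : ℝ) + 1) * h - k * h = h := by ring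
      have hy1 : y ((k + 1) * h) = y (k * h) + (∫ u in k * h..(k + 1) * h, g (y u) u) +
          (w ((k + 1) * h) - w (k * h)) := by
        rw [hy _ hk2, hy _ hk1, ← intervalIntegral.integral_add_adjacent_intervals
          (hint _ h0 _ hk1) (hint _ hk1 _ hk2)]
        ring
      have hloc : |h * g (y (k * h)) (k * h) - ∫ u in k * h..(k + 1) * h, g (y u) u| ≤ h * η := by
        have hc : h * g (y (k * h)) (k * h) =
            ∫ _u in (k : ℝ) * h..(k + 1) * h, g (y (k * h)) (k * h) := by
          rw [intervalIntegral.integral_const, smul_eq_mul, hlen]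
        rw [hc, ← intervalIntegral.integral_sub (by simp) (hint _ hk1 _ hk2)]
        have hb : ∀ u ∈ Set.uIoc ((k : ℝ) * h) ((k + 1) * h),
            ‖g (y (k * h)) (k * h) - g (y u) u‖ ≤ η := by
          intro u hu
          rw [Set.uIoc_of_le (by linarith)] at hu
          refine hδg _ hk1 _ ⟨hk1.1.trans hu.1.le, hu.2.trans hk2.2⟩ ?_
          rw [Real.dist_eq, abs_sub_comm, abs_of_nonneg (by linarith [hu.1])]
          linarith [hu.2]
        have := intervalIntegral.norm_integral_le_of_norm_le_const hb
        rw [hlen, abs_of_nonneg hh0, mul_comm η h] at this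
        exact this
      have hlip := hg (k * h) e (y (k * h))
      have hsplit : eulerScheme g h x w (k + 1) - y ((k + 1) * h) =
          (e - y (k * h)) + h * (g e (k * h) - g (y (k * h)) (k * h)) +
          (h * g (y (k * h)) (k * h) - ∫ u in k * h..(k + 1) * h, g (y u) u) := by
        rw [hy1, eulerScheme]; ring
      have hpow : 1 ≤ (1 + h * L) ^ (k + 1) :=
        one_le_pow₀ (by linarith [mul_nonneg hh0 hL])
      rw [hsplit]
      calc _ ≤ |e - y (k * h)| + h * (L * |e - y (k * h)|) + h * η := by
            refine (abs_add_three _ _ _).trans ?_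
            rw [abs_mul, abs_of_nonneg hh0]
            gcongr
        _ = (1 + h * L) * |e - y (k * h)| + h * η * 1 := by ring
        _ ≤ (1 + h * L) * (k * h * η * (1 + h * L) ^ k) + h * η * (1 + h * L) ^ (k + 1) := by
            gcongr
        _ = _ := by ring
  have hfin := herr n le_rfl
  rw [hnh] at hfin
  have hexp : (1 + h * L) ^ n ≤ Real.exp (L * t) := by
    calc (1 + h * L) ^ n ≤ Real.exp (h * L) ^ n := by
          gcongr
          linarith [Real.add_one_le_exp (h * L)]
      _ = Real.exp (L * t) := by
          rw [← Real.exp_nat_mul, ← mul_assoc, hnh, mul_comm]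
  rw [Real.dist_eq]
  calc _ ≤ t * η * (1 + h * L) ^ n := hfin
    _ ≤ t * η * Real.exp (L * t) := by gcongr
    _ = t * Real.exp (L * t) * η := by ring
    _ < (t * Real.exp (L * t) + 1) * η := by linarith
    _ = ε := by rw [hη]; field_simp

/-- Extension by zero of a path on `[0, T]`. -/
def extendPath {T : ℝ} (w : Set.Icc (0 : ℝ) T → ℝ) (s : ℝ) : ℝ :=
  if h : s ∈ Set.Icc 0 T then w ⟨s, h⟩ else 0

theorem extendPath_of_mem {T s : ℝ} (w : Set.Icc (0 : ℝ) T → ℝ) (h : s ∈ Set.Icc 0 T) :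
    extendPath w s = w ⟨s, h⟩ := dif_pos h

theorem measurable_extendPath {T : ℝ} (s : ℝ) :
    Measurable fun w : Set.Icc (0 : ℝ) T → ℝ => extendPath w s := by
  by_cases h : s ∈ Set.Icc 0 T
  · simp only [extendPath_of_mem _ h]; fun_prop
  · simp [extendPath, h]

/-- A scheme reads finitely many values of the path, so the product σ-algebra suffices. Joint
measurability of `g` is not needed, as the grid times are fixed. -/
theorem measurable_eulerScheme {T h : ℝ} {g : ℝ → ℝ → ℝ} (hg : ∀ s, Measurable fun x => g x s)
    (k : ℕ) : Measurable fun z : ℝ × (Set.Icc (0 : ℝ) T → ℝ) =>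
      eulerScheme g h z.1 (extendPath z.2) k := by
  have hw : ∀ s, Measurable fun z : ℝ × (Set.Icc (0 : ℝ) T → ℝ) => extendPath z.2 s :=
    fun s => (measurable_extendPath s).comp measurable_snd
  induction k with
  | zero => exact measurable_fst.add (hw 0)
  | succ k ih =>
    exact (ih.add (((hg _).comp ih).const_mul h)).add ((hw _).sub (hw _))

/-- The limit of the Euler schemes at time `t`, as a functional of the input. -/
def eulerLimit (T : ℝ) (g : ℝ → ℝ → ℝ) (t : ℝ) (z : ℝ × (Set.Icc (0 : ℝ) T → ℝ)) : ℝ :=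
  Filter.limsup (fun n : ℕ => eulerScheme g (t / n) z.1 (extendPath z.2) n) Filter.atTop

theorem measurable_eulerLimit {T : ℝ} {g : ℝ → ℝ → ℝ} (hg : ∀ s, Measurable fun x => g x s)
    (t : ℝ) : Measurable (eulerLimit T g t) :=
  Measurable.limsup fun n => measurable_eulerScheme hg n

end Euler

/-! ### Independence of the copies. -/

section Independence

variable {Ω : Type*} [MeasurableSpace Ω] {P : Measure Ω} [IsProbabilityMeasure P]

/-- The joint law of both families is a product of product measures; regrouping the coordinates by
index gives the product of the laws of the pairs. -/
theorem iIndepFun_prodMk {ι α β : Type*} [Fintype ι] [MeasurableSpace α] [MeasurableSpace β]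
    {U : ι → Ω → α} {V : ι → Ω → β} (hU : ∀ i, Measurable (U i)) (hV : ∀ i, Measurable (V i))
    (hUi : iIndepFun U P) (hVi : iIndepFun V P)
    (hUV : IndepFun (fun ω i => U i ω) (fun ω i => V i ω) P) :
    iIndepFun (fun i ω => (U i ω, V i ω)) P := by
  have hUp : ∀ i, IsProbabilityMeasure (P.map (U i)) := fun i =>
    Measure.isProbabilityMeasure_map (hU i).aemeasurable
  have hVp : ∀ i, IsProbabilityMeasure (P.map (V i)) := fun i =>
    Measure.isProbabilityMeasure_map (hV i).aemeasurable
  have hpair : ∀ i, P.map (fun ω => (U i ω, V i ω)) = (P.map (U i)).prod (P.map (V i)) := by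
    intro i
    refine (indepFun_iff_map_prod_eq_prod_map_map (hU i).aemeasurable (hV i).aemeasurable).1 ?_
    exact hUV.comp (φ := fun u : ι → α => u i) (ψ := fun v : ι → β => v i) (by fun_prop)
      (by fun_prop)
  rw [iIndepFun_iff_map_fun_eq_pi_map fun i => ((hU i).prodMk (hV i)).aemeasurable]
  simp_rw [hpair]
  have hmp := measurePreserving_arrowProdEquivProdArrow α β ι (fun i => P.map (U i))
    (fun i => P.map (V i))
  rw [← (iIndepFun_iff_map_fun_eq_pi_map fun i => (hU i).aemeasurable).1 hUi,
    ← (iIndepFun_iff_map_fun_eq_pi_map fun i => (hV i).aemeasurable).1 hVi,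
    ← (indepFun_iff_map_prod_eq_prod_map_map (measurable_pi_lambda _ hU).aemeasurable
      (measurable_pi_lambda _ hV).aemeasurable).1 hUV] at hmp
  have h1 := (hmp.symm _).map_eq
  rw [← h1, Measure.map_map (MeasurableEquiv.measurable _)
    ((measurable_pi_lambda _ hU).prodMk (measurable_pi_lambda _ hV))]
  rfl

variable {p : ℕ} {θ : Fin p → ℝ} {b : Fin p → ℝ → P2 → ℝ} {T σ L K : ℝ} {μ : ℝ → P2}

theorem IsRegularDrift.measurable {f : ℝ → P2 → ℝ} (hf : IsRegularDrift L K f) (ν : P2) :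
    Measurable fun x => f x ν :=
  (LipschitzWith.of_dist_le_mul (K := L.toNNReal) fun x y => by
    rw [Real.coe_toNNReal _ hf.L_nonneg]; exact hf.abs_sub_le x y ν).continuous.measurable

/-- The law of a solution is continuous in time for the distance `W₂`. -/
theorem IsMcKeanVlasovSolution.tendsto_W2 {ξ β : Ω → ℝ} {B Y : ℝ → Ω → ℝ}
    (hY : IsMcKeanVlasovSolution T σ θ b P ξ B Y μ) (hf : IsRegularDrift L K (drift θ b))
    (hσ : 0 ≤ σ) (hβ : ∀ᵐ ω ∂P, ∀ t ∈ Set.Icc 0 T, |B t ω| ≤ β ω)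
    (hξ2 : MemLp ξ 2 P) (hβ2 : MemLp β 2 P) {t : ℝ} (ht : t ∈ Set.Icc 0 T) :
    Filter.Tendsto (fun s => W2 (μ s) (μ t)) (nhdsWithin t (Set.Icc 0 T)) (nhds 0) := by
  obtain ⟨hY2, hcont⟩ := hY.continuousOn_integral_sq hf hσ hβ hξ2 hβ2
  have h1 := ((hcont (Y t) (hY2 t ht)).sqrt t ht).tendsto
  simp only [sub_self, ne_eq, OfNat.ofNat_ne_zero, not_false_eq_true, zero_pow, integral_zero,
    Real.sqrt_zero] at h1
  refine tendsto_of_tendsto_of_tendsto_of_le_of_le' tendsto_const_nhds h1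
    (Filter.Eventually.of_forall fun s => W2_nonneg _ _) ?_
  filter_upwards [self_mem_nhdsWithin] with s hs
  exact W2_le_sqrt_integral_sq (hY.aemeasurable s hs) (hY.aemeasurable t ht) (hY.law s hs)
    (hY.law t ht) ((hY2 s hs).sub (hY2 t ht)).integrable_sq

/-- A solution is a functional of its input. -/
theorem IsMcKeanVlasovSolution.ae_eq_eulerLimit {ξ β : Ω → ℝ} {B Y : ℝ → Ω → ℝ}
    (hY : IsMcKeanVlasovSolution T σ θ b P ξ B Y μ) (hf : IsRegularDrift L K (drift θ b))
    (hσ : 0 ≤ σ) (hβ : ∀ᵐ ω ∂P, ∀ t ∈ Set.Icc 0 T, |B t ω| ≤ β ω)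
    (hξ2 : MemLp ξ 2 P) (hβ2 : MemLp β 2 P) {t : ℝ} (ht : t ∈ Set.Icc 0 T) :
    Y t =ᵐ[P] fun ω => eulerLimit T (fun x s => drift θ b x (μ s)) t
      (ξ ω, fun s : Set.Icc (0 : ℝ) T => σ * B s ω) := by
  filter_upwards [hY.continuous_paths, hY.equation] with ω hc he
  have hsub : Set.Icc 0 t ⊆ Set.Icc 0 T := Set.Icc_subset_Icc_right ht.2
  -- Convergence of the schemes requires continuity of the drift in time, which combines continuity
  -- of the path with W₂-continuity of its law.
  have hgc : ContinuousOn (fun s => drift θ b (Y s ω) (μ s)) (Set.Icc 0 T) := by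
    intro s hs
    rw [ContinuousWithinAt, tendsto_iff_dist_tendsto_zero]
    have h1 := ((tendsto_iff_dist_tendsto_zero.1 (hc s hs)).add
      (hY.tendsto_W2 hf hσ hβ hξ2 hβ2 hs)).const_mul L
    simp only [add_zero, mul_zero] at h1
    exact squeeze_zero (fun u => dist_nonneg) (fun u => hf.lipschitz _ _ _ _) h1
  refine (Filter.Tendsto.limsup_eq ?_).symm
  refine tendsto_eulerScheme hf.L_nonneg ht.1 (fun s x y => hf.abs_sub_le x y (μ s))
    (y := fun s => Y s ω) (hgc.mono hsub) fun s hs => ?_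
  rw [extendPath_of_mem _ (hsub hs)]
  exact he s (hsub hs)

end Independence

/-! ### Moments of centered averages. -/

section Averages

variable {Ω : Type*} [MeasurableSpace Ω] {P : Measure Ω} [IsProbabilityMeasure P]

/-- Monotonicity of L^p norms on a probability space. It supplies the lower moments required by the
Marcinkiewicz–Zygmund inequality from the top one. -/
theorem lintegral_enorm_pow_le_pow {E : Type*} [NormedAddCommGroup E] {f : Ω → E}
    (hf : AEStronglyMeasurable f P) {j n : ℕ} (hn : n ≠ 0) (hjn : j ≤ n) {v : ℝ≥0∞}
    (h : ∫⁻ ω, ‖f ω‖ₑ ^ n ∂P ≤ v ^ n) : ∫⁻ ω, ‖f ω‖ₑ ^ j ∂P ≤ v ^ j := by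
  rcases eq_or_ne j 0 with rfl | hj
  · simp
  have hpow : ∀ k : ℕ, k ≠ 0 → eLpNorm f k P ^ k = ∫⁻ ω, ‖f ω‖ₑ ^ k ∂P := by
    intro k hk
    rw [eLpNorm_eq_lintegral_rpow_enorm_toReal (by exact_mod_cast hk) (by simp)]
    simp only [ENNReal.toReal_natCast, ENNReal.rpow_natCast]
    rw [one_div, ← ENNReal.rpow_natCast, ENNReal.rpow_inv_rpow (by exact_mod_cast hk)]
  rw [← hpow n hn] at h
  rw [← hpow j hj]
  have h1 : eLpNorm f n P ≤ v := (ENNReal.pow_le_pow_left_iff hn).1 h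
  exact pow_le_pow_left'
    ((eLpNorm_le_eLpNorm_of_exponent_le (by exact_mod_cast hjn) hf).trans h1) j

theorem enorm_add_pow_le {E : Type*} [NormedAddCommGroup E] (x y : E) (n : ℕ) :
    ‖x + y‖ₑ ^ n ≤ 2 ^ n * (‖x‖ₑ ^ n + ‖y‖ₑ ^ n) := by
  set m := max ‖x‖ₑ ‖y‖ₑ
  have h1 : ‖x + y‖ₑ ≤ 2 * m := by
    rw [two_mul]
    exact (enorm_add_le _ _).trans (add_le_add (le_max_left _ _) (le_max_right _ _))
  have h2 : m ^ n ≤ ‖x‖ₑ ^ n + ‖y‖ₑ ^ n := by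
    rcases max_choice ‖x‖ₑ ‖y‖ₑ with h | h <;> simp only [m, h]
    · exact le_self_add
    · exact le_add_self
  calc _ ≤ (2 * m) ^ n := by gcongr
    _ = 2 ^ n * m ^ n := mul_pow _ _ _
    _ ≤ _ := by gcongr

variable {E : Type*} [NormedAddCommGroup E] [InnerProductSpace ℝ E]
  [CompleteSpace E] [SecondCountableTopology E] [MeasurableSpace E] [BorelSpace E]

/-- Moments of averages of independent variables around their mean. -/
theorem lintegral_enorm_average_sub_pow_le {N : ℕ} [NeZero N] {W : Fin N → Ω → E}
    (hind : iIndepFun W P) (hW : ∀ i, AEStronglyMeasurable (W i) P) {m : ℕ} (hm : m ≠ 0)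
    {A : ℝ≥0∞} (hA : A ≠ ∞) (hWA : ∀ i, ∫⁻ ω, ‖W i ω‖ₑ ^ (2 * m) ∂P ≤ A) :
    ∫⁻ ω, ‖(N : ℝ)⁻¹ • ∑ i, (W i ω - ∫ ω', W i ω' ∂P)‖ₑ ^ (2 * m) ∂P ≤
      ENNReal.ofReal (mzConst m) * 4 ^ (2 * m) * A * (N : ℝ≥0∞)⁻¹ ^ m := by
  have h2m : 2 * m ≠ 0 := by omega
  set v : ℝ≥0∞ := A ^ (1 / ((2 * m : ℕ) : ℝ)) with hv
  have hvA : v ^ (2 * m) = A := by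
    rw [hv, one_div, ← ENNReal.rpow_natCast, ENNReal.rpow_inv_rpow (by exact_mod_cast h2m)]
  have hvtop : v ≠ ∞ := ENNReal.rpow_ne_top_of_nonneg (by positivity) hA
  have hWint : ∀ i, Integrable (W i) P := fun i =>
    (memLp_of_lintegral_pow_ne_top (hW i) h2m (ne_top_of_le_ne_top hA (hWA i))).integrable
      (by exact_mod_cast (by omega : 1 ≤ 2 * m))
  set V : Fin N → Ω → E := fun i ω => W i ω - ∫ ω', W i ω' ∂P with hV
  have hVm : ∀ i, AEStronglyMeasurable (V i) P := fun i => (hW i).sub aestronglyMeasurable_const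
  have hVind : iIndepFun V P :=
    hind.comp (fun i x => x - ∫ ω', W i ω' ∂P) fun i => by fun_prop
  have hmean : ∀ i, ‖∫ ω', W i ω' ∂P‖ₑ ≤ v := by
    intro i
    have h1 := lintegral_enorm_pow_le_pow (hW i) h2m (by omega : 1 ≤ 2 * m)
      ((hWA i).trans_eq hvA.symm)
    simp only [pow_one] at h1
    exact (enorm_integral_le_lintegral_enorm _).trans h1
  have hVn : ∀ i, ∫⁻ ω, ‖V i ω‖ₑ ^ (2 * m) ∂P ≤ (4 * v) ^ (2 * m) := by
    intro i
    calc ∫⁻ ω, ‖V i ω‖ₑ ^ (2 * m) ∂P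
        ≤ ∫⁻ ω, 2 ^ (2 * m) * (‖W i ω‖ₑ ^ (2 * m) + v ^ (2 * m)) ∂P := by
          refine lintegral_mono fun ω => ?_
          simp only [hV, sub_eq_add_neg]
          refine (enorm_add_pow_le _ _ _).trans ?_
          rw [enorm_neg]
          gcongr
          exact hmean i
      _ = 2 ^ (2 * m) * (∫⁻ ω, ‖W i ω‖ₑ ^ (2 * m) ∂P + v ^ (2 * m)) := by
          rw [lintegral_const_mul' _ _ (by simp), lintegral_add_right _ measurable_const]
          simp
      _ ≤ 2 ^ (2 * m) * (v ^ (2 * m) + v ^ (2 * m)) := by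
          gcongr
          rw [hvA]; exact hWA i
      _ = 2 ^ (2 * m) * 2 * v ^ (2 * m) := by ring
      -- A crude bound of 2 by 2^{2m}, so that centering merely replaces the scale v by 4v.
      _ ≤ 2 ^ (2 * m) * 2 ^ (2 * m) * v ^ (2 * m) := by
          gcongr
          exact le_self_pow₀ one_le_two h2m
      _ = (4 * v) ^ (2 * m) := by rw [← mul_pow, ← mul_pow]; norm_num
  have hVfin : ∀ i, MemLp (V i) (2 * m : ℕ) P := fun i =>
    memLp_of_lintegral_pow_ne_top (hVm i) h2m (ne_top_of_le_ne_top (by finiteness) (hVn i))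
  have hreal : ∀ {f : Ω → E} (_ : AEStronglyMeasurable f P) (j : ℕ),
      ∫ ω, ‖f ω‖ ^ j ∂P = (∫⁻ ω, ‖f ω‖ₑ ^ j ∂P).toReal := by
    intro f hf j
    rw [integral_eq_lintegral_of_nonneg_ae (f := fun ω => ‖f ω‖ ^ j)
      (ae_of_all _ fun ω => pow_nonneg (norm_nonneg _) j) (hf.norm.pow j)]
    simp_rw [ENNReal.ofReal_pow (norm_nonneg _), ofReal_norm]
  have h4v : 4 * v ≠ ∞ := ENNReal.mul_ne_top (by simp) hvtop
  have key := integral_norm_sum_pow_le hVind m hVfin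
    (fun i => (hWint i).sub (integrable_const _))
    (fun i => by
      simp only [hV]
      rw [integral_sub (hWint i) (integrable_const _)]
      simp)
    (v := (4 * v).toReal) ENNReal.toReal_nonneg
    (fun i j hj => by
      rw [hreal (hVm i), ← ENNReal.toReal_pow]
      exact ENNReal.toReal_mono (by finiteness)
        (lintegral_enorm_pow_le_pow (hVm i) h2m (by omega) (hVn i)))
    Finset.univ
  have hSm : AEStronglyMeasurable (fun ω => ∑ i, V i ω) P :=
    Finset.aestronglyMeasurable_fun_sum _ fun i _ => hVm i
  have hSfin : ∫⁻ ω, ‖∑ i, V i ω‖ₑ ^ (2 * m) ∂P ≠ ∞ := by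
    have h := (memLp_finsetSum Finset.univ fun i _ => hVfin i).2
    have := lintegral_rpow_enorm_lt_top_of_eLpNorm_lt_top (by exact_mod_cast h2m)
      (ENNReal.natCast_ne_top _) h
    simp only [ENNReal.toReal_natCast, ENNReal.rpow_natCast] at this
    exact this.ne
  rw [hreal hSm, Finset.card_univ, Fintype.card_fin] at key
  have hsum : ∫⁻ ω, ‖∑ i, V i ω‖ₑ ^ (2 * m) ∂P ≤
      ENNReal.ofReal (mzConst m) * (N : ℝ≥0∞) ^ m * (4 ^ (2 * m) * A) := by
    rw [← ENNReal.ofReal_toReal hSfin]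
    refine (ENNReal.ofReal_le_ofReal key).trans_eq ?_
    rw [ENNReal.ofReal_mul (mul_nonneg (mzConst_nonneg m) (by positivity)),
      ENNReal.ofReal_mul (mzConst_nonneg m), ENNReal.ofReal_pow (by positivity),
      ENNReal.ofReal_natCast, ENNReal.ofReal_pow ENNReal.toReal_nonneg, ENNReal.ofReal_toReal h4v,
      mul_pow, hvA]
  have hN0 : (N : ℝ≥0∞) ≠ 0 := by exact_mod_cast NeZero.ne N
  have hNinv : ‖(N : ℝ)⁻¹‖ₑ = (N : ℝ≥0∞)⁻¹ := by
    rw [enorm_inv (by exact_mod_cast NeZero.ne N)]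
    simp
  simp_rw [enorm_smul, mul_pow, hNinv]
  rw [lintegral_const_mul' _ _ (by finiteness)]
  calc (N : ℝ≥0∞)⁻¹ ^ (2 * m) * ∫⁻ ω, ‖∑ i, V i ω‖ₑ ^ (2 * m) ∂P
      ≤ (N : ℝ≥0∞)⁻¹ ^ (2 * m) *
          (ENNReal.ofReal (mzConst m) * (N : ℝ≥0∞) ^ m * (4 ^ (2 * m) * A)) := by gcongr
    _ = ENNReal.ofReal (mzConst m) * 4 ^ (2 * m) * A * (N : ℝ≥0∞)⁻¹ ^ m *
          ((N : ℝ≥0∞)⁻¹ * N) ^ m := by ring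
    _ = _ := by rw [ENNReal.inv_mul_cancel hN0 (by simp), one_pow, mul_one]

end Averages

/-! ### Time increments of embedded solutions. -/

section EmbeddedIncrements

theorem embed_zero : embed 0 = 0 := by simp [embed]

theorem norm_embed_sub_sq_le_of_abs_le {x y l : ℝ} (hl : 1 ≤ l) (hx : |x| ≤ l) (hy : |y| ≤ l) :
    ‖embed x - embed y‖ ^ 2 ≤ 27 * l ^ 6 * |x - y| := by
  have h1 := sq_le_sq' (abs_le.1 hx).1 (abs_le.1 hx).2
  have h2 := sq_le_sq' (abs_le.1 hy).1 (abs_le.1 hy).2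
  have h3 : 1 + x ^ 2 + y ^ 2 ≤ 3 * l ^ 2 := by nlinarith
  calc ‖embed x - embed y‖ ^ 2 ≤ |x - y| * (1 + x ^ 2 + y ^ 2) ^ 3 := norm_embed_sub_sq_le x y
    _ ≤ |x - y| * (3 * l ^ 2) ^ 3 := by gcongr
    _ = _ := by ring

theorem norm_embed_sq_le_of_abs_le {x l : ℝ} (hl : 1 ≤ l) (hx : |x| ≤ l) :
    ‖embed x‖ ^ 2 ≤ 27 * l ^ 7 := by
  have h := norm_embed_sub_sq_le_of_abs_le (y := 0) hl hx (by simpa using zero_le_one.trans hl)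
  rw [embed_zero, sub_zero, sub_zero] at h
  calc _ ≤ 27 * l ^ 6 * |x| := h
    _ ≤ 27 * l ^ 6 * l := by gcongr
    _ = _ := by ring

/-- Young's inequality with a free weight `a`, used to separate the path bound Λ from a noise
increment: the two are dependent and of different orders in |t - s|. -/
theorem mul_le_mul_sq_add_inv_mul_sq {a : ℝ≥0∞} (ha : a ≠ 0) (ha' : a ≠ ∞) (x y : ℝ≥0∞) :
    x * y ≤ a * x ^ 2 + a⁻¹ * y ^ 2 := by
  rcases le_total y (a * x) with h | h
  · calc x * y ≤ x * (a * x) := by gcongr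
      _ = a * x ^ 2 := by ring
      _ ≤ _ := le_self_add
  · have h' : x ≤ a⁻¹ * y := by
      calc x = a⁻¹ * (a * x) := by rw [← mul_assoc, ENNReal.inv_mul_cancel ha ha', one_mul]
        _ ≤ _ := by gcongr
    calc x * y ≤ a⁻¹ * y * y := by gcongr
      _ = a⁻¹ * y ^ 2 := by ring
      _ ≤ _ := le_add_self

theorem enorm_embed_sub_pow_le {σ x y l d e : ℝ} (hσ : 0 ≤ σ) (hd : 0 ≤ d) (hl : 1 ≤ l)
    (hx : |x| ≤ l) (hy : |y| ≤ l) (hxy : |x - y| ≤ l * d + σ * |e|) {a : ℝ≥0∞} (ha : a ≠ 0)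
    (ha' : a ≠ ∞) (m : ℕ) :
    ‖embed x - embed y‖ₑ ^ (2 * m) ≤ 54 ^ m * (‖l‖ₑ ^ (7 * m) * ENNReal.ofReal d ^ m +
      ENNReal.ofReal σ ^ m * (a * ‖l‖ₑ ^ (12 * m) + a⁻¹ * ‖e‖ₑ ^ (2 * m))) := by
  have hl0 : 0 ≤ l := zero_le_one.trans hl
  have h1 : ‖embed x - embed y‖ₑ ^ 2 ≤
      27 * ‖l‖ₑ ^ 6 * ‖l * d + σ * |e|‖ₑ := by
    rw [← ofReal_norm, ← ENNReal.ofReal_pow (norm_nonneg _)]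
    refine (ENNReal.ofReal_le_ofReal ((norm_embed_sub_sq_le_of_abs_le hl hx hy).trans
      (mul_le_mul_of_nonneg_left hxy (by positivity)))).trans_eq ?_
    rw [ENNReal.ofReal_mul (by positivity), ENNReal.ofReal_mul (by positivity),
      ENNReal.ofReal_pow hl0, Real.enorm_of_nonneg hl0, Real.enorm_of_nonneg (by positivity),
      ENNReal.ofReal_ofNat]
  have h2 : ‖l * d + σ * |e|‖ₑ ^ m ≤
      2 ^ m * ((‖l‖ₑ * ENNReal.ofReal d) ^ m + (ENNReal.ofReal σ * ‖e‖ₑ) ^ m) := by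
    refine (enorm_add_pow_le _ _ m).trans_eq ?_
    rw [enorm_mul, enorm_mul, Real.enorm_abs, Real.enorm_of_nonneg hσ, Real.enorm_of_nonneg hd]
  have h54 : (54 : ℝ≥0∞) ^ m = 27 ^ m * 2 ^ m := by rw [← mul_pow]; norm_num
  calc ‖embed x - embed y‖ₑ ^ (2 * m) = (‖embed x - embed y‖ₑ ^ 2) ^ m := by rw [pow_mul]
    _ ≤ (27 * ‖l‖ₑ ^ 6 * ‖l * d + σ * |e|‖ₑ) ^ m := by gcongr
    _ = 27 ^ m * ‖l‖ₑ ^ (6 * m) * ‖l * d + σ * |e|‖ₑ ^ m := by rw [mul_pow, mul_pow, ← pow_mul]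
    _ ≤ 27 ^ m * ‖l‖ₑ ^ (6 * m) *
          (2 ^ m * ((‖l‖ₑ * ENNReal.ofReal d) ^ m + (ENNReal.ofReal σ * ‖e‖ₑ) ^ m)) := by gcongr
    _ = 27 ^ m * 2 ^ m * (‖l‖ₑ ^ (7 * m) * ENNReal.ofReal d ^ m +
          ENNReal.ofReal σ ^ m * (‖l‖ₑ ^ (6 * m) * ‖e‖ₑ ^ m)) := by
        rw [mul_pow, mul_pow]; ring
    _ ≤ 27 ^ m * 2 ^ m * (‖l‖ₑ ^ (7 * m) * ENNReal.ofReal d ^ m +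
          ENNReal.ofReal σ ^ m * (a * (‖l‖ₑ ^ (6 * m)) ^ 2 + a⁻¹ * (‖e‖ₑ ^ m) ^ 2)) := by
        gcongr
        exact mul_le_mul_sq_add_inv_mul_sq ha ha' _ _
    _ = _ := by
        rw [h54, ← pow_mul, ← pow_mul, mul_comm m 2, show 6 * m * 2 = 12 * m by ring]

/-- The constant in the bound of the increments of an embedded solution. -/
def embedIncrementConst (H T σ : ℝ) (m : ℕ) (C : ℝ≥0∞) : ℝ≥0∞ :=
  54 ^ m * ((1 + C) * ENNReal.ofReal (T ^ ((m : ℝ) - 3)) +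
    ENNReal.ofReal σ ^ m * ((1 + C + gaussianMoment (2 * m)) * ENNReal.ofReal (T ^ (H * m - 3))))

theorem embedIncrementConst_ne_top (H T σ : ℝ) (m : ℕ) {C : ℝ≥0∞} (hC : C ≠ ∞) :
    embedIncrementConst H T σ m C ≠ ∞ := by
  have := gaussianMoment_ne_top (2 * m)
  unfold embedIncrementConst
  finiteness

variable {Ω : Type*} [MeasurableSpace Ω] {P : Measure Ω} [IsProbabilityMeasure P]

theorem lintegral_enorm_embed_sub_pow_le {H T σ : ℝ} (hH : H ∈ Set.Ioo (0 : ℝ) 1) (hσ : 0 ≤ σ)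
    {m : ℕ} (hm : 3 ≤ H * m) {B Y : ℝ → Ω → ℝ} (hB : IsFractionalBrownianMotion H T P B)
    {Λ : Ω → ℝ} (hΛm : AEMeasurable Λ P) (hΛ1 : ∀ ω, 1 ≤ Λ ω) {C : ℝ≥0∞}
    (hΛC : ∫⁻ ω, ‖Λ ω‖ₑ ^ (12 * m) ∂P ≤ C)
    (hY : ∀ᵐ ω ∂P, (∀ t ∈ Set.Icc 0 T, |Y t ω| ≤ Λ ω) ∧
      ∀ s ∈ Set.Icc 0 T, ∀ t ∈ Set.Icc 0 T,
        |Y t ω - Y s ω| ≤ Λ ω * |t - s| + σ * |B t ω - B s ω|)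
    {s t : ℝ} (hs : s ∈ Set.Icc 0 T) (ht : t ∈ Set.Icc 0 T) :
    ∫⁻ ω, ‖embed (Y t ω) - embed (Y s ω)‖ₑ ^ (2 * m) ∂P ≤
      embedIncrementConst H T σ m C * ENNReal.ofReal |t - s| ^ 3 := by
  rcases eq_or_ne t s with rfl | hts
  · have : m ≠ 0 := by rintro rfl; norm_num at hm
    simp [this]
  have hd : 0 < |t - s| := abs_pos.2 (sub_ne_zero.2 hts)
  have hdT := abs_sub_le_of_mem_Icc_zero hs ht
  have hm3 : (3 : ℝ) ≤ m := hm.trans (mul_le_of_le_one_left (by positivity) hH.2.le)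
  set d := ENNReal.ofReal |t - s| with hd'
  -- The balancing weight: the noise increment to the power 2m has mean of order |t - s|^{2Hm} = a²,
  -- so both Young terms are of order a. Positivity of `a` is why t = s was treated apart.
  set a := ENNReal.ofReal (|t - s| ^ (H * m)) with ha
  have ha0 : a ≠ 0 := by
    rw [ha, ne_eq, ENNReal.ofReal_eq_zero, not_le]; positivity
  have hatop : a ≠ ∞ := ENNReal.ofReal_ne_top
  have ha2 : ENNReal.ofReal (|t - s| ^ (H * (2 * m : ℕ))) = a ^ 2 := by
    rw [ha, ← ENNReal.ofReal_pow (by positivity), ← Real.rpow_natCast, ← Real.rpow_mul hd.le]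
    push_cast
    ring_nf
  have had : a ≤ ENNReal.ofReal (T ^ (H * m - 3)) * d ^ 3 := by
    rw [ha, hd', ← ENNReal.ofReal_pow hd.le, ← ENNReal.ofReal_mul' (by positivity)]
    exact ENNReal.ofReal_le_ofReal (rpow_le_rpow_sub_three_mul hd.le hdT hm)
  have hdd : d ^ m ≤ ENNReal.ofReal (T ^ ((m : ℝ) - 3)) * d ^ 3 := by
    rw [hd', ← ENNReal.ofReal_pow hd.le, ← ENNReal.ofReal_pow hd.le,
      ← ENNReal.ofReal_mul' (by positivity), ← Real.rpow_natCast]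
    exact ENNReal.ofReal_le_ofReal (rpow_le_rpow_sub_three_mul hd.le hdT hm3)
  have hpt : ∀ᵐ ω ∂P, ‖embed (Y t ω) - embed (Y s ω)‖ₑ ^ (2 * m) ≤
      54 ^ m * (‖Λ ω‖ₑ ^ (7 * m) * d ^ m + ENNReal.ofReal σ ^ m *
        (a * ‖Λ ω‖ₑ ^ (12 * m) + a⁻¹ * ‖B t ω - B s ω‖ₑ ^ (2 * m))) := by
    filter_upwards [hY] with ω ⟨h1, h2⟩
    exact enorm_embed_sub_pow_le hσ (abs_nonneg _) (hΛ1 ω) (h1 t ht) (h1 s hs) (h2 s hs t ht) ha0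
      hatop m
  have h7 : ∫⁻ ω, ‖Λ ω‖ₑ ^ (7 * m) ∂P ≤ 1 + C :=
    (lintegral_pow_le_one_add (r := 12 * m) (by omega)).trans (by gcongr)
  have mΛ : ∀ k : ℕ, AEMeasurable (fun ω => ‖Λ ω‖ₑ ^ k) P := fun k => hΛm.enorm.pow_const k
  calc ∫⁻ ω, ‖embed (Y t ω) - embed (Y s ω)‖ₑ ^ (2 * m) ∂P
      ≤ ∫⁻ ω, 54 ^ m * (‖Λ ω‖ₑ ^ (7 * m) * d ^ m + ENNReal.ofReal σ ^ m *
        (a * ‖Λ ω‖ₑ ^ (12 * m) + a⁻¹ * ‖B t ω - B s ω‖ₑ ^ (2 * m))) ∂P := lintegral_mono_ae hpt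
    _ = 54 ^ m * ((∫⁻ ω, ‖Λ ω‖ₑ ^ (7 * m) ∂P) * d ^ m + ENNReal.ofReal σ ^ m *
        (a * ∫⁻ ω, ‖Λ ω‖ₑ ^ (12 * m) ∂P + a⁻¹ * (a ^ 2 * gaussianMoment (2 * m)))) := by
      rw [lintegral_const_mul' _ _ (by finiteness),
        lintegral_add_left' ((mΛ (7 * m)).mul_const _), lintegral_mul_const' _ _ (by finiteness),
        lintegral_const_mul' _ _ (by finiteness), lintegral_add_left' ((mΛ (12 * m)).const_mul a),
        lintegral_const_mul' _ _ hatop, lintegral_const_mul' _ _ (ENNReal.inv_ne_top.2 ha0),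
        hB.lintegral_sub_pow hH.1.ne' hs ht, ha2]
    _ = 54 ^ m * ((∫⁻ ω, ‖Λ ω‖ₑ ^ (7 * m) ∂P) * d ^ m + ENNReal.ofReal σ ^ m *
        ((∫⁻ ω, ‖Λ ω‖ₑ ^ (12 * m) ∂P + gaussianMoment (2 * m)) * a)) := by
      have : a⁻¹ * (a ^ 2 * gaussianMoment (2 * m)) = gaussianMoment (2 * m) * a := by
        rw [pow_two, ← mul_assoc, ← mul_assoc, ENNReal.inv_mul_cancel ha0 hatop, one_mul, mul_comm]
      rw [this]
      ring
    _ ≤ 54 ^ m * ((1 + C) * (ENNReal.ofReal (T ^ ((m : ℝ) - 3)) * d ^ 3) +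
        ENNReal.ofReal σ ^ m * ((1 + C + gaussianMoment (2 * m)) *
          (ENNReal.ofReal (T ^ (H * m - 3)) * d ^ 3))) := by
      gcongr
      exact hΛC.trans le_add_self
    _ = _ := by unfold embedIncrementConst; ring

end EmbeddedIncrements

/-! ### Fluctuations of the empirical measure, uniformly in time. -/

section Fluctuation

instance : SigmaFinite weight :=
  inferInstanceAs (SigmaFinite (volume.withDensity fun x => ENNReal.ofReal ((1 + x ^ 2) ^ 3)))

instance : SecondCountableTopology (Lp ℝ 2 weight) :=
  haveI : Fact ((2 : ℝ≥0∞) ≠ ∞) := ⟨ENNReal.ofNat_ne_top⟩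
  Lp.SecondCountableTopology

theorem integrable_empiricalMeasure {E : Type*} [NormedAddCommGroup E] {N : ℕ} [NeZero N]
    (f : ℝ → E) (x : Fin N → ℝ) : Integrable f (empiricalMeasure x).1 :=
  Integrable.smul_measure
    (integrable_finsetSum_measure.2 fun i _ => integrable_dirac (by simp))
    (ENNReal.inv_ne_top.2 (by exact_mod_cast NeZero.ne N))

theorem integral_empiricalMeasure {E : Type*} [NormedAddCommGroup E] [NormedSpace ℝ E]
    [CompleteSpace E] {N : ℕ} [NeZero N] (f : ℝ → E) (x : Fin N → ℝ) :
    ∫ y, f y ∂(empiricalMeasure x).1 = (N : ℝ)⁻¹ • ∑ i, f (x i) := by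
  simp only [empiricalMeasure]
  rw [integral_smul_measure, integral_finsetSum_measure fun i _ => integrable_dirac (by simp)]
  simp

/-- The deviation of the embedded empirical measure of `y` from the embedding of `ν`. -/
def deviation {N : ℕ} [NeZero N] (y : Fin N → ℝ) (ν : P2) : Lp ℝ 2 weight :=
  ∫ x, embed x ∂(empiricalMeasure y).1 - ∫ x, embed x ∂ν.1

theorem deviation_eq {N : ℕ} [NeZero N] (y : Fin N → ℝ) (ν : P2) :
    deviation y ν = (N : ℝ)⁻¹ • ∑ i, (embed (y i) - ∫ x, embed x ∂ν.1) := by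
  have hN : (N : ℝ) ≠ 0 := by exact_mod_cast NeZero.ne N
  rw [deviation, integral_empiricalMeasure, Finset.sum_sub_distrib, smul_sub, Finset.sum_const,
    Finset.card_univ, Fintype.card_fin, ← Nat.cast_smul_eq_nsmul ℝ, smul_smul,
    inv_mul_cancel₀ hN, one_smul]

variable {p : ℕ} {θ : Fin p → ℝ} {b : Fin p → ℝ → P2 → ℝ} {H T σ L K : ℝ}

/-- Uniform-in-time moment bound of the fluctuations of the empirical measure of independent
solutions of the McKean–Vlasov equation. -/
theorem exists_deviation_bound (hf : IsRegularDrift L K (drift θ b)) (hH : H ∈ Set.Ioo (0 : ℝ) 1)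
    (hT : 0 < T) (hσ : 0 ≤ σ) {μ₀ : Measure ℝ} [IsProbabilityMeasure μ₀]
    (hμ₀ : FiniteMoments μ₀) {m : ℕ} (hm : 3 ≤ H * m) :
    ∃ C : ℝ≥0∞, C ≠ ∞ ∧ ∀ (N : ℕ) [NeZero N] (Ω : Type*) [MeasurableSpace Ω] (P : Measure Ω)
      [IsProbabilityMeasure P] (ξ : Fin N → Ω → ℝ) (B Y : Fin N → ℝ → Ω → ℝ) (μ : ℝ → P2),
      IsInput H T μ₀ P ξ B →
      (∀ i, IsMcKeanVlasovSolution T σ θ b P (ξ i) (B i) (Y i) μ) →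
      (∀ t ∈ Set.Icc 0 T, Integrable embed (μ t).1) ∧
      ∃ γ : Ω → ℝ≥0∞, AEMeasurable γ P ∧
        (∀ᵐ ω ∂P, ∀ t ∈ Set.Icc 0 T,
          ‖deviation (fun i => Y i t ω) (μ t)‖ₑ ^ (2 * m) ≤ γ ω) ∧
        ∫⁻ ω, γ ω ∂P ≤ C * (N : ℝ≥0∞)⁻¹ ^ m := by
  have hm0 : m ≠ 0 := by rintro rfl; norm_num at hm
  have h2m : 2 * m ≠ 0 := by omega
  -- The order 12m is the highest power of Λ appearing in the bound of embedded increments.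
  have hr : 3 ≤ H * (12 * m : ℕ) := by
    push_cast
    nlinarith
  obtain ⟨C₀, hC₀, hbound⟩ := exists_uniform_bound hf hH.1 hT hσ hμ₀ hr (by omega)
  set A₁ := embedIncrementConst H T σ m C₀ with hA₁
  have hA₁top : A₁ ≠ ∞ := embedIncrementConst_ne_top H T σ m hC₀
  set A₀ : ℝ≥0∞ := 27 ^ m * (1 + C₀) with hA₀
  have hA₀top : A₀ ≠ ∞ := by finiteness
  set k : ℝ≥0∞ := ENNReal.ofReal (mzConst m) * 4 ^ (2 * m) with hk
  have hktop : k ≠ ∞ := by finiteness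
  have hchain := chainingConst_ne_top h2m T
  refine ⟨2 ^ (2 * m) * (chainingConst (2 * m) T * (k * A₁) + k * A₀), by finiteness, ?_⟩
  intro N _ Ω _ P _ ξ B Y μ hin hY
  have h0T : (0 : ℝ) ∈ Set.Icc 0 T := ⟨le_rfl, hT.le⟩
  choose Λ hΛm hΛ1 hΛC hΛY using fun i => hbound Ω P (ξ i) (B i) (Y i) μ (hin.measurable_init i)
    (hin.law_init i) (hin.fbm i) (hY i)
  borelize ↥(Lp ℝ 2 weight)
  have hem : Measurable embed := continuous_embed.measurable
  have hYm : ∀ i, ∀ t ∈ Set.Icc 0 T, AEStronglyMeasurable (fun ω => embed (Y i t ω)) P :=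
    fun i t ht => continuous_embed.comp_aestronglyMeasurable
      ((hY i).aemeasurable t ht).aestronglyMeasurable
  have hC7 : ∀ i, ∫⁻ ω, ‖Λ i ω‖ₑ ^ (7 * m) ∂P ≤ 1 + C₀ := fun i =>
    (lintegral_pow_le_one_add (r := 12 * m) (by omega)).trans (by gcongr; exact hΛC i)
  have hsize : ∀ i, ∀ t ∈ Set.Icc 0 T, ∫⁻ ω, ‖embed (Y i t ω)‖ₑ ^ (2 * m) ∂P ≤ A₀ := by
    intro i t ht
    calc ∫⁻ ω, ‖embed (Y i t ω)‖ₑ ^ (2 * m) ∂P ≤ ∫⁻ ω, 27 ^ m * ‖Λ i ω‖ₑ ^ (7 * m) ∂P := by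
          refine lintegral_mono_ae ?_
          filter_upwards [hΛY i] with ω h
          have h1 := norm_embed_sq_le_of_abs_le (hΛ1 i ω) (h.1 t ht)
          have h2 : ‖embed (Y i t ω)‖ₑ ^ 2 ≤ 27 * ‖Λ i ω‖ₑ ^ 7 := by
            rw [← ofReal_norm, ← ENNReal.ofReal_pow (norm_nonneg _)]
            refine (ENNReal.ofReal_le_ofReal h1).trans_eq ?_
            have hΛ0 := zero_le_one.trans (hΛ1 i ω)
            rw [ENNReal.ofReal_mul (by norm_num), ENNReal.ofReal_pow hΛ0,
              Real.enorm_of_nonneg hΛ0, ENNReal.ofReal_ofNat]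
          calc ‖embed (Y i t ω)‖ₑ ^ (2 * m) = (‖embed (Y i t ω)‖ₑ ^ 2) ^ m := pow_mul _ _ _
            _ ≤ (27 * ‖Λ i ω‖ₑ ^ 7) ^ m := pow_le_pow_left' h2 m
            _ = _ := by rw [mul_pow, ← pow_mul]
      _ ≤ _ := by
          rw [lintegral_const_mul' _ _ (by finiteness), hA₀]
          gcongr
          exact hC7 i
  have hYint : ∀ i, ∀ t ∈ Set.Icc 0 T, Integrable (fun ω => embed (Y i t ω)) P :=
    fun i t ht => (memLp_of_lintegral_pow_ne_top (hYm i t ht) h2m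
      (ne_top_of_le_ne_top hA₀top (hsize i t ht))).integrable
        (by exact_mod_cast (by omega : 1 ≤ 2 * m))
  have hlaw : ∀ i, ∀ t ∈ Set.Icc 0 T, ∫ x, embed x ∂(μ t).1 = ∫ ω, embed (Y i t ω) ∂P := by
    intro i t ht
    rw [← (hY i).law t ht, integral_map ((hY i).aemeasurable t ht)
      continuous_embed.aestronglyMeasurable]
  have hincr : ∀ i, ∀ s ∈ Set.Icc 0 T, ∀ t ∈ Set.Icc 0 T,
      ∫⁻ ω, ‖embed (Y i t ω) - embed (Y i s ω)‖ₑ ^ (2 * m) ∂P ≤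
        A₁ * ENNReal.ofReal |t - s| ^ 3 := fun i s hs t ht =>
    lintegral_enorm_embed_sub_pow_le hH hσ hm (hin.fbm i) (hΛm i) (hΛ1 i) (hΛC i) (hΛY i) hs ht
  -- Two times are treated at once, because the increments of the embedded copies must be
  -- independent across particles, as well as their values at time 0.
  have hindep : ∀ (f : ℝ → ℝ → Lp ℝ 2 weight), Measurable (Function.uncurry f) →
      ∀ s ∈ Set.Icc 0 T, ∀ t ∈ Set.Icc 0 T,
        iIndepFun (fun i ω => f (Y i s ω) (Y i t ω)) P := by
    intro f hfm s hs t ht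
    have h1 : iIndepFun (fun i ω => (ξ i ω, fun u : Set.Icc (0 : ℝ) T => B i u ω)) P :=
      iIndepFun_prodMk hin.measurable_init
        (fun i => measurable_pi_lambda _ fun u => (hin.fbm i).measurable u u.2)
        hin.indep_init hin.indep_fbm hin.indep_init_fbm
    set Φ : ℝ → ℝ × (Set.Icc (0 : ℝ) T → ℝ) → ℝ := fun t z =>
      eulerLimit T (fun x s => drift θ b x (μ s)) t (z.1, fun u => σ * z.2 u) with hΦ
    have hΦm : ∀ t, Measurable (Φ t) := fun t =>
      (measurable_eulerLimit (fun s => hf.measurable (μ s)) t).comp (by fun_prop)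
    have hae : ∀ i, ∀ t ∈ Set.Icc 0 T,
        Y i t =ᵐ[P] fun ω => Φ t (ξ i ω, fun u : Set.Icc (0 : ℝ) T => B i u ω) := by
      intro i t ht
      obtain ⟨β, hβm, -, hβ, hβr⟩ := (hin.fbm i).exists_bound hH.1 hT hr
      have hβ2 := (integral_sq_le_of_lintegral_pow_le hβm (by omega)
        (fbmMaxConst_ne_top H T (by omega)) hβr).1
      have hξr : ∫⁻ ω, ‖ξ i ω‖ₑ ^ 2 ∂P = ∫⁻ x, ‖x‖ₑ ^ 2 ∂μ₀ := by
        rw [← hin.law_init i, lintegral_map (by fun_prop) (hin.measurable_init i)]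
      have hξ2 := (integral_sq_le_of_lintegral_pow_le (hin.measurable_init i).aemeasurable le_rfl
        (lintegral_enorm_pow_ne_top hμ₀ 2) hξr.le).1
      exact (hY i).ae_eq_eulerLimit hf hσ hβ hξ2 hβ2 ht
    have h2 := h1.comp (fun _ z => f (Φ s z) (Φ t z))
      fun _ => hfm.comp ((hΦm s).prodMk (hΦm t))
    refine h2.congr fun i => ?_
    filter_upwards [hae i s hs, hae i t ht] with ω h3 h4
    simp only [Function.comp_apply, h3, h4]
  set Z : ℝ → Ω → Lp ℝ 2 weight := fun t ω => deviation (fun i => Y i t ω) (μ t) with hZ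
  have hZ0 : ∫⁻ ω, ‖Z 0 ω‖ₑ ^ (2 * m) ∂P ≤ k * A₀ * (N : ℝ≥0∞)⁻¹ ^ m := by
    have h1 := lintegral_enorm_average_sub_pow_le
      (hindep (fun x _ => embed x) (hem.comp measurable_fst) 0 h0T 0 h0T)
      (fun i => hYm i 0 h0T) hm0 hA₀top (fun i => hsize i 0 h0T)
    refine le_trans (le_of_eq (lintegral_congr fun ω => ?_)) h1
    simp only [hZ]
    rw [deviation_eq]
    congr 4
    ext1 i
    rw [hlaw i 0 h0T]
  have hZincr : ∀ s ∈ Set.Icc 0 T, ∀ t ∈ Set.Icc 0 T,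
      ∫⁻ ω, ‖Z t ω - Z s ω‖ₑ ^ (2 * m) ∂P ≤
        k * A₁ * (N : ℝ≥0∞)⁻¹ ^ m * ENNReal.ofReal |t - s| ^ 3 := by
    intro s hs t ht
    have h1 := lintegral_enorm_average_sub_pow_le
      (hindep (fun x y => embed y - embed x)
        ((hem.comp measurable_snd).sub (hem.comp measurable_fst)) s hs t ht)
      (fun i => (hYm i t ht).sub (hYm i s hs)) hm0
      (A := A₁ * ENNReal.ofReal |t - s| ^ 3) (by finiteness) (fun i => hincr i s hs t ht)
    refine le_trans (le_of_eq (lintegral_congr fun ω => ?_)) (h1.trans_eq (by rw [hk]; ring))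
    simp only [hZ]
    rw [deviation_eq, deviation_eq, ← smul_sub, ← Finset.sum_sub_distrib]
    congr 4
    ext1 i
    rw [integral_sub (hYint i t ht) (hYint i s hs), hlaw i t ht, hlaw i s hs]
    abel
  have hZm : ∀ t ∈ Set.Icc 0 T, AEStronglyMeasurable (Z t) P := by
    intro t ht
    simp only [hZ, deviation_eq]
    refine (continuous_const_smul (N : ℝ)⁻¹).comp_aestronglyMeasurable
      (Finset.aestronglyMeasurable_fun_sum _ fun i _ => ?_)
    exact (hYm i t ht).sub aestronglyMeasurable_const
  -- Chaining needs continuous paths of the deviation, hence of its deterministic centering;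
  -- dominated convergence along one copy provides it.
  have hmeanc : ContinuousOn (fun t => ∫ x, embed x ∂(μ t).1) (Set.Icc 0 T) := by
    refine ContinuousOn.congr ?_ (hlaw 0)
    have hΛ7 : Integrable (fun ω => 27 * ‖Λ 0 ω‖ ^ 7) P :=
      (integrable_norm_pow_of_le_memLp (memLp_of_lintegral_pow_ne_top (hΛm 0).aestronglyMeasurable
        (by omega) (ne_top_of_le_ne_top hC₀ (hΛC 0))) (by omega)).const_mul 27
    refine continuousOn_of_dominated (hYm 0) (fun t ht => ?_) hΛ7 ?_
    · filter_upwards [hΛY 0] with ω h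
      have h1 := norm_embed_sq_le_of_abs_le (hΛ1 0 ω) (h.1 t ht)
      rw [Real.norm_of_nonneg (zero_le_one.trans (hΛ1 0 ω))]
      have h2 : 1 ≤ Λ 0 ω ^ 7 := one_le_pow₀ (hΛ1 0 ω)
      nlinarith [norm_nonneg (embed (Y 0 t ω))]
    · filter_upwards [(hY 0).continuous_paths] with ω h
      exact continuous_embed.comp_continuousOn h
  have hZc : ∀ᵐ ω ∂P, ContinuousOn (fun t => Z t ω) (Set.Icc 0 T) := by
    filter_upwards [ae_all_iff.2 fun i => (hY i).continuous_paths] with ω h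
    simp only [hZ, deviation_eq]
    refine (continuous_const_smul (N : ℝ)⁻¹).comp_continuousOn
      (continuousOn_finsetSum _ fun i _ => ?_)
    exact (continuous_embed.comp_continuousOn (h i)).sub hmeanc
  obtain ⟨γ, hγm, hγ, hγi⟩ := exists_maximal_bound hT h2m hZm hZc hZincr
  refine ⟨fun t ht => ?_, fun ω => 2 ^ (2 * m) * (γ ω + ‖Z 0 ω‖ₑ ^ (2 * m)), ?_, ?_, ?_⟩
  · rw [← (hY 0).law t ht, integrable_map_measure continuous_embed.aestronglyMeasurable
      ((hY 0).aemeasurable t ht)]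
    exact hYint 0 t ht
  · exact (hγm.add ((hZm 0 h0T).enorm.pow_const _)).const_mul _
  · filter_upwards [hγ] with ω h t ht
    have h1 := enorm_add_pow_le (Z t ω - Z 0 ω) (Z 0 ω) (2 * m)
    rw [sub_add_cancel] at h1
    refine h1.trans ?_
    gcongr
    exact h t ht
  · rw [lintegral_const_mul' _ _ (by finiteness), lintegral_add_left' hγm]
    calc _ ≤ 2 ^ (2 * m) * (chainingConst (2 * m) T * (k * A₁ * (N : ℝ≥0∞)⁻¹ ^ m) +
          k * A₀ * (N : ℝ≥0∞)⁻¹ ^ m) := by gcongr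
      _ = _ := by ring

end Fluctuation

/-! ### Propagation of chaos. -/

section Comparison

/-- Pathwise stability: the distance of the particle system to independent copies of the limit is
controlled by the distance of the empirical measure of the copies to the limit law. -/
theorem IsRegularDrift.abs_sub_le_mul_exp {L K T R : ℝ} {f : ℝ → P2 → ℝ}
    (hf : IsRegularDrift L K f) (hT : 0 ≤ T) (hR : 0 ≤ R) {N : ℕ} [NeZero N]
    {x y w : Fin N → ℝ → ℝ} {ν : ℝ → P2}
    (hxc : ∀ i, ContinuousOn (x i) (Set.Icc 0 T)) (hyc : ∀ i, ContinuousOn (y i) (Set.Icc 0 T))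
    (hxi : ∀ i, IntervalIntegrable (fun s => f (x i s) (empiricalMeasure fun j => x j s))
      volume 0 T)
    (hyi : ∀ i, IntervalIntegrable (fun s => f (y i s) (ν s)) volume 0 T)
    (hx : ∀ i, ∀ t ∈ Set.Icc 0 T,
      x i t = w i t + ∫ s in (0 : ℝ)..t, f (x i s) (empiricalMeasure fun j => x j s))
    (hy : ∀ i, ∀ t ∈ Set.Icc 0 T, y i t = w i t + ∫ s in (0 : ℝ)..t, f (y i s) (ν s))
    (hW : ∀ t ∈ Set.Icc 0 T, W2 (empiricalMeasure fun j => y j t) (ν t) ≤ R)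
    {t : ℝ} (ht : t ∈ Set.Icc 0 T) (i : Fin N) :
    |x i t - y i t| ≤ L * T * Real.exp (2 * L * T) * R := by
  have hL := hf.L_nonneg
  -- The sup norm over particles dominates both each single gap and the W₂ distance of the two
  -- empirical measures, so Grönwall closes with constants free of N.
  set M : ℝ → ℝ := fun t => ‖fun j => x j t - y j t‖ with hM
  have hMc : ContinuousOn M (Set.Icc 0 T) :=
    (continuousOn_pi.2 fun j => (hxc j).sub (hyc j)).norm
  have hle : ∀ t j, |x j t - y j t| ≤ M t := fun t j =>
    norm_le_pi_norm (fun j => x j t - y j t) j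
  have hdrift : ∀ i, ∀ s ∈ Set.Icc 0 T,
      |f (x i s) (empiricalMeasure fun j => x j s) - f (y i s) (ν s)| ≤
        L * R + 2 * L * M s := by
    intro i s hs
    have h1 := hf.lipschitz (x i s) (y i s) (empiricalMeasure fun j => x j s)
      (empiricalMeasure fun j => y j s)
    have h2 := hf.lipschitz (y i s) (y i s) (empiricalMeasure fun j => y j s) (ν s)
    have h3 : W2 (empiricalMeasure fun j => x j s) (empiricalMeasure fun j => y j s) ≤ M s :=
      W2_empiricalMeasure_le (norm_nonneg _) (hle s)
    rw [sub_self, abs_zero, zero_add] at h2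
    calc _ ≤ L * (|x i s - y i s| + W2 (empiricalMeasure fun j => x j s)
          (empiricalMeasure fun j => y j s)) +
          L * W2 (empiricalMeasure fun j => y j s) (ν s) :=
          (_root_.abs_sub_le _ _ _).trans (add_le_add h1 h2)
      _ ≤ L * (M s + M s) + L * R := by
          gcongr
          · exact hle s i
          · exact hW s hs
      _ = _ := by ring
  have hint : ∀ t ∈ Set.Icc 0 T, M t ≤ L * T * R + 2 * L * ∫ s in (0 : ℝ)..t, M s := by
    intro t ht
    have hMi : IntervalIntegrable M volume 0 t :=
      (hMc.mono (by
        rw [Set.uIcc_of_le ht.1]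
        exact Set.Icc_subset_Icc le_rfl ht.2)).intervalIntegrable
    have hI : 0 ≤ ∫ s in (0 : ℝ)..t, M s :=
      intervalIntegral.integral_nonneg ht.1 fun s _ => norm_nonneg _
    refine (pi_norm_le_iff_of_nonneg (by positivity)).2 fun i => ?_
    have h1 := abs_sub_le_add_integral (hxi i) (hyi i)
      (by fun_prop) ht (hdrift i) (hx i t ht) (hy i t ht)
      (a := 0) (h := fun s => L * R + 2 * L * M s) (by simp)
    rw [intervalIntegral.integral_add (by simp) (hMi.const_mul _),
      intervalIntegral.integral_const, intervalIntegral.integral_const_mul, smul_eq_mul,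
      sub_zero, zero_add] at h1
    refine h1.trans (add_le_add ?_ le_rfl)
    calc t * (L * R) ≤ T * (L * R) := by gcongr; exact ht.2
      _ = _ := by ring
  refine (hle t i).trans ((le_mul_exp_of_le_add_integral (by positivity) hMc hint t ht).trans ?_)
  rw [mul_right_comm _ R]
  gcongr
  exact ht.2

/-- Split at the level `s`: below it g^a ≤ s^a, above it g^(a-1) ≤ s^(a-1). -/
theorem rpow_le_mul_add_rpow {a g s : ℝ} (ha : 0 < a) (ha1 : a ≤ 1) (hg : 0 ≤ g) (hs : 0 < s) :
    g ^ a ≤ s ^ (a - 1) * g + s ^ a := by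
  rcases le_total g s with h | h
  · have := Real.rpow_le_rpow hg h ha.le
    have : 0 ≤ s ^ (a - 1) * g := by positivity
    linarith
  · have hg0 : 0 < g := hs.trans_le h
    calc g ^ a = g ^ (a - 1) * g := by
          rw [← Real.rpow_add_one hg0.ne', sub_add_cancel]
      _ ≤ s ^ (a - 1) * g := by
          gcongr ?_ * g
          exact Real.rpow_le_rpow_of_nonpos hs h (by linarith)
      _ ≤ _ := le_add_of_nonneg_right (by positivity)

/-- A substitute for Jensen's inequality with a worse constant: integrate the preceding linear bound
with `s` of the size of the mean of γ. -/
theorem lintegral_rpow_le {Ω : Type*} [MeasurableSpace Ω] {P : Measure Ω} [IsProbabilityMeasure P]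
    {γ : Ω → ℝ≥0∞} {C : ℝ≥0∞} {a s : ℝ} (ha : 0 < a) (ha1 : a ≤ 1)
    (hs : 0 < s) (h : ∫⁻ ω, γ ω ∂P ≤ C * ENNReal.ofReal s) :
    ∫⁻ ω, ENNReal.ofReal ((γ ω).toReal ^ a) ∂P ≤ (C + 1) * ENNReal.ofReal (s ^ a) := by
  have hpos : 0 < s ^ (a - 1) := by positivity
  calc ∫⁻ ω, ENNReal.ofReal ((γ ω).toReal ^ a) ∂P
      ≤ ∫⁻ ω, (ENNReal.ofReal (s ^ (a - 1)) * γ ω + ENNReal.ofReal (s ^ a)) ∂P := by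
        refine lintegral_mono fun ω => ?_
        refine (ENNReal.ofReal_le_ofReal (rpow_le_mul_add_rpow ha ha1 ENNReal.toReal_nonneg
          hs)).trans ?_
        rw [ENNReal.ofReal_add (by positivity) (by positivity), ENNReal.ofReal_mul hpos.le]
        gcongr
        exact ENNReal.ofReal_toReal_le
    _ = ENNReal.ofReal (s ^ (a - 1)) * ∫⁻ ω, γ ω ∂P + ENNReal.ofReal (s ^ a) := by
        rw [lintegral_add_right _ measurable_const, lintegral_const_mul' _ _ ENNReal.ofReal_ne_top]
        simp
    _ ≤ ENNReal.ofReal (s ^ (a - 1)) * (C * ENNReal.ofReal s) + ENNReal.ofReal (s ^ a) := by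
        gcongr
    _ = C * ENNReal.ofReal (s ^ (a - 1) * s) + ENNReal.ofReal (s ^ a) := by
        rw [ENNReal.ofReal_mul hpos.le]
        ring
    _ = _ := by
        rw [← Real.rpow_add_one hs.ne', sub_add_cancel]
        ring

variable {p : ℕ} {θ : Fin p → ℝ} {b : Fin p → ℝ → P2 → ℝ} {H T σ L K q : ℝ}

/-- Propagation of chaos: a common bound for the distance of the particles to their limits and
for the distance of the empirical measure to the limit law, with its moment of order `q`. -/
theorem exists_propagation_bound (hf : IsRegularDrift L K (drift θ b))
    (hH : H ∈ Set.Ioo (0 : ℝ) 1) (hT : 0 < T) (hσ : 0 ≤ σ) (hq : 2 ≤ q) {μ₀ : Measure ℝ}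
    [IsProbabilityMeasure μ₀] (hμ₀ : FiniteMoments μ₀) :
    ∃ c : ℝ, 0 < c ∧ ∀ (N : ℕ) [NeZero N] (Ω : Type*) [MeasurableSpace Ω] (P : Measure Ω)
      [IsProbabilityMeasure P] (ξ : Fin N → Ω → ℝ) (B X Y : Fin N → ℝ → Ω → ℝ) (μ : ℝ → P2),
      IsInput H T μ₀ P ξ B → IsParticleSystem T σ θ b P ξ B X →
      (∀ i, IsMcKeanVlasovSolution T σ θ b P (ξ i) (B i) (Y i) μ) →
      ∃ R : Ω → ℝ, (∀ᵐ ω ∂P, 0 ≤ R ω ∧ ∀ t ∈ Set.Icc 0 T,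
        (∀ i, |X i t ω - Y i t ω| ≤ R ω) ∧
        W2 (empiricalMeasure fun j => X j t ω) (μ t) ≤ R ω) ∧
        ∫⁻ ω, ENNReal.ofReal (R ω ^ q) ∂P ≤ ENNReal.ofReal (c * (1 / Real.sqrt N)) := by
  -- `m₁` secures Hm ≥ 3 for chaining, and `m₂` secures q ≤ 4m, so that the final power a = q/(4m)
  -- is at most 1.
  obtain ⟨m₁, hm₁⟩ := exists_nat_ge (3 / H)
  obtain ⟨m₂, hm₂⟩ := exists_nat_ge (q / 4)
  set m := m₁ + m₂ with hmdef
  have hm : 3 ≤ H * m := by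
    rw [div_le_iff₀ hH.1] at hm₁
    push_cast [hmdef]
    nlinarith [mul_nonneg hH.1.le (Nat.cast_nonneg (α := ℝ) m₂)]
  have hqm : q / 4 ≤ m := by
    push_cast [hmdef]
    linarith [Nat.cast_nonneg (α := ℝ) m₁]
  have hmpos : (0 : ℝ) < m := by linarith
  have hm0 : 2 * m ≠ 0 := by
    have : 0 < m := by exact_mod_cast hmpos
    omega
  obtain ⟨C, hC, hdev⟩ := exists_deviation_bound hf hH hT hσ hμ₀ hm
  obtain ⟨c, hc, hW⟩ := exists_wasserstein_two_sq_le
  set κ : ℝ := L * T * Real.exp (2 * L * T) with hκ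
  have hκ0 : 0 ≤ κ := by have := hf.L_nonneg; positivity
  set D : ℝ := (2 * κ + 2) ^ q * c ^ (q / 2) with hD
  have hD0 : 0 ≤ D := by positivity
  set a : ℝ := q / (4 * m) with ha
  have ha0 : 0 < a := by positivity
  have ha1 : a ≤ 1 := by
    rw [ha, div_le_one (by positivity)]
    linarith
  refine ⟨D * (C + 1).toReal + 1, by positivity, ?_⟩
  intro N _ Ω _ P _ ξ B X Y μ hin hX hY
  obtain ⟨hem, γ, hγm, hγ, hγi⟩ := hdev N Ω P ξ B Y μ hin hY
  have hNpos : (0 : ℝ) < N := by exact_mod_cast Nat.pos_of_ne_zero (NeZero.ne N)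
  have hN1 : (1 : ℝ) ≤ N := by exact_mod_cast Nat.one_le_iff_ne_zero.2 (NeZero.ne N)
  have hs : (0 : ℝ) < (N : ℝ)⁻¹ ^ m := by positivity
  have hγs : ∫⁻ ω, γ ω ∂P ≤ C * ENNReal.ofReal ((N : ℝ)⁻¹ ^ m) := by
    rwa [ENNReal.ofReal_pow (by positivity), ENNReal.ofReal_inv_of_pos hNpos,
      ENNReal.ofReal_natCast]
  have hγfin : ∀ᵐ ω ∂P, γ ω < ∞ :=
    ae_lt_top' hγm (ne_top_of_le_ne_top (by finiteness) hγs)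
  set g : Ω → ℝ := fun ω => (γ ω).toReal with hg
  have hg0 : ∀ ω, 0 ≤ g ω := fun ω => ENNReal.toReal_nonneg
  -- `g` dominates the 2m-th power of the deviation and W₂² is at most c times the deviation, so `r`
  -- dominates W₂.
  set r : Ω → ℝ := fun ω => Real.sqrt (c * g ω ^ (1 / (2 * m : ℝ))) with hr
  have hr0 : ∀ ω, 0 ≤ r ω := fun ω => Real.sqrt_nonneg _
  -- The particles need only the factor κ; the squared triangle inequality needs 2κ² + 2 ≤ (2κ +
  -- 2)².
  refine ⟨fun ω => (2 * κ + 2) * r ω, ?_, ?_⟩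
  · filter_upwards [hγ, hγfin, hX.continuous_paths, hX.integrable, hX.equation,
      ae_all_iff.2 fun i => (hY i).continuous_paths, ae_all_iff.2 fun i => (hY i).integrable,
      ae_all_iff.2 fun i => (hY i).equation] with ω h hfin hXc hXi hXe hYc hYi hYe
    have hWY : ∀ t ∈ Set.Icc 0 T, W2 (empiricalMeasure fun j => Y j t ω) (μ t) ≤ r ω := by
      intro t ht
      have := (μ t).2.1
      have := (empiricalMeasure fun j => Y j t ω).2.1
      refine W2_le_of_sq_le (hr0 ω) ((hW _ _ (integrable_empiricalMeasure _ _) (hem t ht)).trans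
        (ENNReal.ofReal_le_ofReal ?_))
      rw [Real.sq_sqrt (by have := hg0 ω; positivity)]
      refine mul_le_mul_of_nonneg_left ?_ hc
      have h1 : ‖deviation (fun j => Y j t ω) (μ t)‖ ^ (2 * m) ≤ g ω := by
        rw [hg, ← ENNReal.ofReal_le_iff_le_toReal hfin.ne, ENNReal.ofReal_pow (norm_nonneg _),
          ofReal_norm]
        exact h t ht
      have h2 := Real.rpow_le_rpow (by positivity) h1 (z := 1 / (2 * m : ℝ)) (by positivity)
      rw [show 1 / (2 * m : ℝ) = ((2 * m : ℕ) : ℝ)⁻¹ by push_cast; rw [one_div]] at h2 ⊢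
      rwa [Real.pow_rpow_inv_natCast (norm_nonneg _) hm0] at h2
    have hXY : ∀ t ∈ Set.Icc 0 T, ∀ i, |X i t ω - Y i t ω| ≤ κ * r ω := fun t ht i =>
      hf.abs_sub_le_mul_exp (x := fun i t => X i t ω) (y := fun i t => Y i t ω)
        (w := fun i t => ξ i ω + σ * B i t ω) (ν := μ) hT.le (hr0 ω) hXc hYc hXi hYi
        (fun i t ht => by rw [hXe i t ht]; ring) (fun i t ht => by rw [hYe i t ht]; ring) hWY ht i
    have hrω := hr0 ω
    refine ⟨by positivity, fun t ht => ⟨fun i => (hXY t ht i).trans ?_, ?_⟩⟩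
    · nlinarith [mul_nonneg hκ0 hrω]
    · have := (empiricalMeasure fun j => Y j t ω).2.1
      refine W2_le_of_sq_le (by positivity) ((wasserstein_two_sq_triangle _
        (empiricalMeasure fun j => Y j t ω).1 _).trans ?_)
      have h1 := W2_empiricalMeasure_le (by positivity) (hXY t ht)
      have h2 := hWY t ht
      have h3 := W2_nonneg (empiricalMeasure fun j => X j t ω) (empiricalMeasure fun j => Y j t ω)
      have h4 := W2_nonneg (empiricalMeasure fun j => Y j t ω) (μ t)
      rw [← ofReal_W2, ← ofReal_W2, ← ENNReal.ofReal_pow h3, ← ENNReal.ofReal_pow h4,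
        ← ENNReal.ofReal_ofNat 2, ← ENNReal.ofReal_mul zero_le_two,
        ← ENNReal.ofReal_mul zero_le_two, ← ENNReal.ofReal_add (by positivity) (by positivity)]
      refine ENNReal.ofReal_le_ofReal ?_
      calc _ ≤ 2 * (κ * r ω) ^ 2 + 2 * r ω ^ 2 := by gcongr
        _ ≤ _ := by
          nlinarith [mul_nonneg hκ0 (sq_nonneg (r ω)), sq_nonneg (κ * r ω), sq_nonneg (r ω)]
  · have hRq : ∀ ω, ((2 * κ + 2) * r ω) ^ q = D * g ω ^ a := by
      intro ω
      rw [Real.mul_rpow (by positivity) (hr0 ω), hr]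
      simp only
      rw [Real.sqrt_eq_rpow, ← Real.rpow_mul (by have := hg0 ω; positivity),
        Real.mul_rpow hc (by have := hg0 ω; positivity), ← Real.rpow_mul (hg0 ω), hD, mul_assoc,
        show 1 / 2 * q = q / 2 by ring, show 1 / (2 * (m : ℝ)) * (q / 2) = a by
          rw [ha]; field_simp; norm_num]
    -- The true rate is N^{-q/4}; it is weakened using q ≥ 2 and N ≥ 1.
    have hrate : ((N : ℝ)⁻¹ ^ m) ^ a ≤ 1 / Real.sqrt N := by
      rw [← Real.rpow_natCast, ← Real.rpow_mul (by positivity), Real.sqrt_eq_rpow, one_div,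
        ← Real.inv_rpow hNpos.le]
      refine Real.rpow_le_rpow_of_exponent_ge (by positivity) (inv_le_one_of_one_le₀ hN1) ?_
      rw [ha, show (m : ℝ) * (q / (4 * m)) = q / 4 by field_simp]
      linarith
    calc ∫⁻ ω, ENNReal.ofReal (((2 * κ + 2) * r ω) ^ q) ∂P
        = ENNReal.ofReal D * ∫⁻ ω, ENNReal.ofReal (g ω ^ a) ∂P := by
          rw [← lintegral_const_mul' _ _ ENNReal.ofReal_ne_top]
          refine lintegral_congr fun ω => ?_
          rw [hRq, ENNReal.ofReal_mul hD0]
      _ ≤ ENNReal.ofReal D * ((C + 1) * ENNReal.ofReal (((N : ℝ)⁻¹ ^ m) ^ a)) := by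
          gcongr
          exact lintegral_rpow_le ha0 ha1 hs hγs
      _ = ENNReal.ofReal (D * (C + 1).toReal * ((N : ℝ)⁻¹ ^ m) ^ a) := by
          rw [ENNReal.ofReal_mul (p := D * (C + 1).toReal) (by positivity),
            ENNReal.ofReal_mul (p := D) hD0, ENNReal.ofReal_toReal (by finiteness), mul_assoc]
      _ ≤ _ := by
          refine ENNReal.ofReal_le_ofReal (mul_le_mul ?_ hrate (by positivity) (by positivity))
          linarith

end Comparison

end McKeanVlasovFBM

end

/-! ### The main theorem. -/

theorem mainTheorem7 (H T σ q : ℝ) (hH : H ∈ Set.Ioo (0 : ℝ) 1) (hT : 0 < T) (hσ : 0 < σ)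
    (hq : 2 ≤ q) (p : ℕ) (θ : Fin p → ℝ) (b : Fin p → ℝ → McKeanVlasovFBM.P2 → ℝ)
    (hLip : McKeanVlasovFBM.LipschitzDrift b) (hBdd : McKeanVlasovFBM.BoundedAtZero b)
    (μ₀ : Measure ℝ) [IsProbabilityMeasure μ₀] (hMom : McKeanVlasovFBM.FiniteMoments μ₀) :
    ∃ c : ℝ, 0 < c ∧
      ∀ (N : ℕ) [NeZero N] (Ω : Type*) [MeasurableSpace Ω] (P : Measure Ω)
        [IsProbabilityMeasure P] (ξ : Fin N → Ω → ℝ) (B X Y : Fin N → ℝ → Ω → ℝ)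
        (μ : ℝ → McKeanVlasovFBM.P2),
        McKeanVlasovFBM.IsInput H T μ₀ P ξ B →
        McKeanVlasovFBM.IsParticleSystem T σ θ b P ξ B X →
        (∀ i, McKeanVlasovFBM.IsMcKeanVlasovSolution T σ θ b P (ξ i) (B i) (Y i) μ) →
        (∀ i, ∫⁻ ω, ⨆ t ∈ Set.Icc (0 : ℝ) T, ENNReal.ofReal (|X i t ω - Y i t ω| ^ q) ∂P
            ≤ ENNReal.ofReal (c * (1 / Real.sqrt N))) ∧
        ∫⁻ ω, ⨆ t ∈ Set.Icc (0 : ℝ) T,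
            McKeanVlasovFBM.wasserstein 2
              (McKeanVlasovFBM.empiricalMeasure fun j => X j t ω).1 (μ t).1 ^ q ∂P
            ≤ ENNReal.ofReal (c * (1 / Real.sqrt N)) := by
  obtain ⟨L, K, hf⟩ := McKeanVlasovFBM.exists_isRegularDrift hLip hBdd θ
  obtain ⟨c, hc, hbound⟩ :=
    McKeanVlasovFBM.exists_propagation_bound hf hH hT hσ.le hq hMom
  refine ⟨c, hc, ?_⟩
  intro N _ Ω _ P _ ξ B X Y μ hin hX hY
  obtain ⟨R, hR, hRq⟩ := hbound N Ω P ξ B X Y μ hin hX hY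
  have hq0 : 0 ≤ q := zero_le_two.trans hq
  -- Both suprema are dominated almost surely by the same R^q; monotonicity of the lower integral
  -- asks for no measurability of the suprema.
  refine ⟨fun i => le_trans (lintegral_mono_ae ?_) hRq, le_trans (lintegral_mono_ae ?_) hRq⟩
  · filter_upwards [hR] with ω h
    exact iSup₂_le fun t ht => ENNReal.ofReal_le_ofReal
      (Real.rpow_le_rpow (abs_nonneg _) ((h.2 t ht).1 i) hq0)
  · filter_upwards [hR] with ω h
    refine iSup₂_le fun t ht => ?_
    rw [← McKeanVlasovFBM.ofReal_W2,
      ENNReal.ofReal_rpow_of_nonneg (McKeanVlasovFBM.W2_nonneg _ _) hq0]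
    exact ENNReal.ofReal_le_ofReal
      (Real.rpow_le_rpow (McKeanVlasovFBM.W2_nonneg _ _) (h.2 t ht).2 hq0)
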